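/- Let $p$ be a prime, $K/\mathbf{Q}_p$ a finite unramified extension of degree $f$ with residue field $k$, $\overline K$ an algebraic closure of $K$, $G_K=\mathrm{Gal}(\overline K/K)$ with inertia subgroup $I_K$, and $\overline{\mathbf F}_p$ an algebraic closure of $\mathbf F_p$. Fix an embedding $\tau_0:k\to\overline{\mathbf F}_p$ and put $\tau_i=\tau_0\circ\mathrm{Frob}^i$ for $i\in\mathbf Z/f\mathbf Z$. Let $\chi:G_K\to\overline{\mathbf F}_p^\times$ be a character with tame signature $(a_i)_{i\in\mathbf Z/f\mathbf Z}$: $1\le a_i\le p$, not all $a_i=p$, and $\chi|_{I_K}=(\tau_0\circ\omega_f)^{n_0}|_{I_K}$, where $\omega_f(g)=g(\varpi)/\varpi$ modulo the maximal ideal for $\varpi^{p^f-1}=-p$, and $n_i=\sum_{j=0}^{f-1}a_{i+j}p^j$. Let $M\subset\overline K$ be a finite, tamely ramified, abelian extension of $K$ such that $\chi|_{G_M}$ is trivial. Assume that the ramification degree $e$ of $M/K$ divides $p^f-1$, and that $M=L(\pi)$, where $L/K$ is unramified of degree prime to $p$ and $\pi$ is a uniformizer of $M$ with $\pi^e\in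 K^\times$. Let $l$ be the residue field of $L$ (equivalently of $M$). For $\alpha\in M$ with $|\alpha|<1$, let $\varepsilon_\alpha:l\otimes_{\mathbf F_p}\overline{\mathbf F}_p\to\mathcal O_M^\times\otimes_{\mathbf Z}\overline{\mathbf F}_p$ be the homomorphism $a\otimes b\mapsto E([a]\alpha)\otimes b$, where $[a]$ is the Teichmüller lift and $E(x)=\exp\bigl(\sum_{n\ge0}x^{p^n}/p^n\bigr)$ is the Artin–Hasse exponential. For each $i$: if $a_{i+1}\ne p$, put $\tau_i'=\tau_{i+1}$ and $n_i'=en_{i+1}/(p^f-1)$; if $a_{i+1}=p$, let $j$ be the least integer greater than $i$ with $a_{j+1}\ne p-1$, and put $\tau_i'=\tau_{j+1}$ and $n_i'=en_{j+1}/(p^f-1)-e$. Let $\overline\omega_\pi(g)\in k^\times$ be the reduction of $g(\pi)/\pi$, and let $\mu$ be the unramified character with $\chi=\mu\,(\tau_i'\circ\overline\omega_\pi)^{n_i'}$ (it does not depend on $i$). Viewing $l\otimes_{k,\tau_i'}\overline{\mathbf F}_p$ as a direct summand of $l\otimes_{\mathbf F_p}\overline{\mathbf F}_p$, choose a non-zero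 $\lambda_i\in l\otimes_{k,\tau_i'}\overline{\mathbf F}_p$ with $g\lambda_i=(1\otimes\mu(g))\lambda_i$ for all $g$ (such a $\lambda_i$ is unique up to scalars), and put $$u_i=\varepsilon_{\pi^{n_i'}}(\lambda_i)\in\mathcal O_M^\times\otimes\overline{\mathbf F}_p .$$ If $\chi$ is the mod $p$ cyclotomic character, put also $u_{\mathrm{cyc}}=\varepsilon_{\delta^p}(b\otimes1)$, where $\delta\in M$ satisfies $\delta^{p-1}=-p$ and $b\in l$ satisfies $\mathrm{tr}_{l/\mathbf F_p}(b)\ne0$. Call $(i,j)\in(\mathbf Z/f\mathbf Z)^2$ a dependent pair if there are integers $1\le s\le t\le f-1$ with $j=i+t$, $a_{i+1}=p$, $a_{i+t+1}\ne p$, $a_{i+2}=\dots=a_{i+s}=p-1$ and $a_{i+s+1}=\dots=a_{i+t}=p$. Let $\pi'$ be another uniformizer of $M$ with $(\pi')^e\in K^\times$, and let $u_i'$ be the elements defined in the same way with $\pi'$ in place of $\pi$. Then for every $i$ there is $c\in\overline{\mathbf F}_p^\times$ such that $u_i'-c\,u_i$ lies in the $\overline{\mathbf F}_p$-span of $\{u_j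 : (i,j)\text{ is a dependent pair}\}$, together with $u_{\mathrm{cyc}}$ if $\chi$ is cyclotomic. -/

import Mathlib

open scoped TensorProduct Topology

noncomputable section

namespace TameUnits

open IsLocalRing

section Integers

variable (p : ℕ) [Fact p.Prime]

/-- The absolute value of an algebraic extension `E` of `ℚ_p`: the unique extension of the
`p`-adic absolute value. -/
abbrev absv (E : Type*) [Field E] [Algebra ℚ_[p] E] (x : E) : ℝ := spectralNorm ℚ_[p] E x

theorem absv_map {E E' : Type*} [Field E] [Algebra ℚ_[p] E] [Field E'] [Algebra ℚ_[p] E']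
    (φ : E →ₐ[ℚ_[p]] E') (x : E) : absv p E' (φ x) = absv p E x := by
  simp only [absv, spectralNorm, minpoly.algHom_eq φ φ.injective]

/-- The ring of integers `𝒪_E = {x | |x| ≤ 1}` of an algebraic extension `E` of `ℚ_p`. -/
def integers (E : Type*) [Field E] [Algebra ℚ_[p] E] [Algebra.IsAlgebraic ℚ_[p] E] :
    ValuationSubring E where
  carrier := {x | absv p E x ≤ 1}
  mul_mem' {x y} hx hy := by
    have := spectralNorm_mul (Algebra.IsAlgebraic.isAlgebraic (R := ℚ_[p]) x)
      (Algebra.IsAlgebraic.isAlgebraic (R := ℚ_[p]) y)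
    exact this.trans (mul_le_one₀ hx (spectralNorm_nonneg y) hy)
  one_mem' := (spectralNorm_one (K := ℚ_[p]) (L := E)).le
  add_mem' {x y} hx hy := by
    exact (isNonarchimedean_spectralNorm (K := ℚ_[p]) (L := E) x y).trans (max_le hx hy)
  zero_mem' := by
    have := spectralNorm_zero (K := ℚ_[p]) (L := E)
    exact this.le.trans zero_le_one
  neg_mem' {x} hx := by
    have := spectralNorm_neg (Algebra.IsAlgebraic.isAlgebraic (R := ℚ_[p]) x)
    exact this.le.trans hx
  mem_or_inv_mem' x := by
    change absv p E x ≤ 1 ∨ absv p E x⁻¹ ≤ 1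
    by_cases hx : x = 0
    · left
      rw [hx, absv, spectralNorm_zero]
      exact zero_le_one
    · have h := spectralAlgNorm_mul (K := ℚ_[p]) (L := E) x x⁻¹
      simp only [spectralAlgNorm_def] at h
      rw [mul_inv_cancel₀ hx, spectralNorm_one] at h
      by_contra! hc
      have := one_lt_mul_of_lt_of_le hc.1 hc.2.le
      exact absurd h.symm this.ne'

variable (E : Type*) [Field E] [Algebra ℚ_[p] E] [Algebra.IsAlgebraic ℚ_[p] E]

theorem mem_integers {E : Type*} [Field E] [Algebra ℚ_[p] E] [Algebra.IsAlgebraic ℚ_[p] E]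
    (x : E) : x ∈ integers p E ↔ absv p E x ≤ 1 := Iff.rfl

/-- The residue field of `𝒪_E`. -/
abbrev resField : Type _ := ResidueField (integers p E)

variable {E} {E' : Type*} [Field E'] [Algebra ℚ_[p] E'] [Algebra.IsAlgebraic ℚ_[p] E']

/-- The map `𝒪_E → 𝒪_{E'}` induced by an embedding `E → E'` over `ℚ_p`. -/
def intMap (φ : E →ₐ[ℚ_[p]] E') : integers p E →+* integers p E' :=
  (φ : E →+* E').restrict (integers p E) (integers p E') fun x hx => by
    rw [mem_integers] at hx ⊢
    exact (absv_map p φ x).le.trans hx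

instance (φ : E →ₐ[ℚ_[p]] E') : IsLocalHom (intMap p φ) where
  map_nonunit x hx := by
    obtain ⟨y, hy⟩ := hx.exists_right_inv
    have hφ : φ (x : E) * (y : E') = 1 := congrArg Subtype.val hy
    have hx0 : (x : E) ≠ 0 := fun h => by simp [h] at hφ
    have hinv : φ ((x : E)⁻¹) = y := by
      rw [map_inv₀]
      exact inv_eq_of_mul_eq_one_right hφ
    have hmem : (x : E)⁻¹ ∈ integers p E := by
      rw [mem_integers, ← absv_map p φ, hinv]
      exact y.2
    exact IsUnit.of_mul_eq_one ⟨_, hmem⟩ (Subtype.ext (mul_inv_cancel₀ hx0))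

/-- The map on residue fields induced by an embedding `E → E'` over `ℚ_p`. -/
def resMap (φ : E →ₐ[ℚ_[p]] E') : resField p E →+* resField p E' :=
  ResidueField.map (intMap p φ)

variable (E)

instance : CharP (resField p E) p := by
  rw [CharP.charP_iff_prime_eq_zero Fact.out]
  have h : residue (integers p E) (p : integers p E) = 0 := by
    rw [residue_eq_zero_iff, mem_maximalIdeal, mem_nonunits_iff]
    intro hu
    obtain ⟨y, hy⟩ := hu.exists_right_inv
    have hE : (p : E) * (y : E) = 1 := by simpa using congrArg Subtype.val hy
    have h := spectralAlgNorm_mul (K := ℚ_[p]) (L := E) (p : E) y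
    rw [hE] at h
    simp only [spectralAlgNorm_def] at h
    have hp : spectralNorm ℚ_[p] E (p : E) = (p : ℝ)⁻¹ := by
      have := spectralNorm_extends (K := ℚ_[p]) (L := E) (p : ℚ_[p])
      simpa using this
    rw [spectralNorm_one, hp] at h
    have hlt : (p : ℝ)⁻¹ < 1 := inv_lt_one_of_one_lt₀
      (by exact_mod_cast (Fact.out : p.Prime).one_lt)
    have hy1 : spectralNorm ℚ_[p] E (y : E) ≤ 1 := y.2
    have := mul_lt_one_of_nonneg_of_lt_one_left (by positivity) hlt hy1
    exact absurd h this.ne'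
  simpa using h

instance : Algebra (ZMod p) (resField p E) := ZMod.algebra _ p

/-- `x` generates the maximal ideal of `𝒪_E`. -/
def IsUniformizer {E : Type*} [Field E] [Algebra ℚ_[p] E] (x : E) : Prop :=
  x ≠ 0 ∧ absv p E x < 1 ∧ ∀ y : E, absv p E y < 1 → absv p E y ≤ absv p E x

/-- `e` is the ramification index of `E'/E`: a uniformizer of `E` is a unit times the `e`-th
power of a uniformizer of `E'`. -/
def IsRamificationIndex (E E' : Type*) [Field E] [Algebra ℚ_[p] E] [Field E'] [Algebra ℚ_[p] E']
    [Algebra E E'] (e : ℕ) : Prop :=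
  ∃ (x : E) (y : E'), IsUniformizer p x ∧ IsUniformizer p y ∧
    absv p E' (algebraMap E E' x) = absv p E' y ^ e

/-- The finite extension `E'/E` of `p`-adic fields is unramified: the two fields have the same
value group.  (Residue fields being finite, residue extensions are automatically separable.) -/
def IsUnramified (E E' : Type*) [Field E] [Field E'] [Algebra ℚ_[p] E'] [Algebra E E'] : Prop :=
  ∀ x : E', ∃ y : E, absv p E' x = absv p E' (algebraMap E E' y)

end Integers

section ArtinHasse

variable (p : ℕ)

/-- The power series `∑_{n ≥ 0} x^{p^n} / p^n`. -/
def artinHasseLog : PowerSeries ℚ :=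
  open Classical in PowerSeries.mk fun m => if ∃ n : ℕ, m = p ^ n then (m : ℚ)⁻¹ else 0

/-- The Artin–Hasse exponential `E(x) = exp (∑_{n ≥ 0} x^{p^n} / p^n)`. -/
def artinHasse : PowerSeries ℚ := (PowerSeries.exp ℚ).subst (artinHasseLog p)

/-- The substitution defining `artinHasse` is legitimate. -/
theorem hasSubst_artinHasseLog : PowerSeries.HasSubst (artinHasseLog p) := by
  apply PowerSeries.HasSubst.of_constantCoeff_zero'
  rw [← PowerSeries.coeff_zero_eq_constantCoeff_apply, artinHasseLog, PowerSeries.coeff_mk]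
  simp

variable [Fact p.Prime] (M : Type*) [Field M] [Algebra ℚ_[p] M] [Algebra.IsAlgebraic ℚ_[p] M]

/-- The value `E(z) ∈ 𝒪_M^×` of the Artin–Hasse exponential at `z ∈ M`, `|z| < 1`, for `M` a finite
extension of `ℚ_p`: the unit to which the partial sums of the series converge. -/
def ahValue (z : M) : (integers p M)ˣ :=
  Classical.epsilon fun w : (integers p M)ˣ =>
    Filter.Tendsto (fun N : ℕ => absv p M (((w : integers p M) : M) -
      ∑ n ∈ Finset.range N, ((PowerSeries.coeff n (artinHasse p) : ℚ) : M) * z ^ n))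
      Filter.atTop (𝓝 0)

/-- The Teichmüller lift `[a]`: the element of `𝒪_M` reducing to `a` and fixed by some
power of `x ↦ x ^ p`. -/
def teich (a : resField p M) : integers p M :=
  Classical.epsilon fun z : integers p M =>
    residue (integers p M) z = a ∧ ∃ m : ℕ, 0 < m ∧ z ^ p ^ m = z

variable (F : Type*) [Field F]

/-- `l ⊗ F`, where `l` is the residue field of `M`.  (The tensor product over `ℤ` is the tensor
product over `𝔽_p`; the scalars `F` are written on the left.) -/
abbrev resTensor : Type _ := F ⊗[ℤ] resField p M

/-- `𝒪_M^× ⊗ F`, written additively, with the scalars `F` on the left. -/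
abbrev unitTensor : Type _ := F ⊗[ℤ] Additive (integers p M)ˣ

/-- The graph of the `F`-linear extension to `l ⊗ F` of `a ↦ E([a] α) ⊗ 1`. -/
def epsGraph (α : M) : Submodule F (resTensor p M F × unitTensor p M F) :=
  Submodule.span F (Set.range fun a : resField p M =>
    ((1 : F) ⊗ₜ[ℤ] a, (1 : F) ⊗ₜ[ℤ] Additive.ofMul (ahValue p M ((teich p M a : M) * α))))

/-- The homomorphism `ε_α : l ⊗ F → 𝒪_M^× ⊗ F`, `a ⊗ b ↦ E([a] α) ⊗ b`, for `|α| < 1`: its value at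
`x` is the (unique) `u` such that `(x, u)` lies in the graph. -/
def eps (α : M) (x : resTensor p M F) : unitTensor p M F :=
  Classical.epsilon fun u => (x, u) ∈ epsGraph p M F α

end ArtinHasse

section Characters

variable (p : ℕ) [Fact p.Prime]
variable (K : Type*) [Field K] [Algebra ℚ_[p] K] [Algebra.IsAlgebraic ℚ_[p] K]

/-- The reduction in the residue field `k` of `K` of the element `g(x) / x`, when the latter lies
in `𝒪_K`; here `g` is an automorphism over `K` of an extension `E` of `K`, and `x ∈ E` is nonzero.
It is used only when some power of `x` of exponent dividing `p ^ f - 1` lies in `K`, so that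
`g(x) / x` is a root of unity of `K`. -/
def kummerChar {E : Type*} [Field E] [Algebra K E] (x : E) (g : E ≃ₐ[K] E) : resField p K :=
  residue (integers p K)
    (Classical.epsilon fun ζ : integers p K => g x = algebraMap K E (ζ : K) * x)

variable {F : Type*} [Field F] {f : ℕ}

/-- The embedding `τ_i = τ_0 ∘ Frob ^ i` of `k` in `F`, for `i` modulo `f = [k : 𝔽_p]`. -/
def tau (τ₀ : resField p K →+* F) (i : ZMod f) : resField p K →+* F :=
  τ₀.comp (iterateFrobenius (resField p K) p i.val)

/-- `n_i = ∑_{0 ≤ j < f} a_{i+j} p^j`. -/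
def digitSum (a : ZMod f → ℕ) (i : ZMod f) : ℕ :=
  ∑ j ∈ Finset.range f, a (i + (j : ZMod f)) * p ^ j

/-- `j - i` for the `j` in the definition of `τ_i'` and `n_i'` in the case `a_{i+1} = p`, and `0` in
the case `a_{i+1} ≠ p`: if `a_{i+1} = p`, then `j` is the least integer greater than `i` such
that `a_{j+1} ≠ p - 1`. -/
def shift (a : ZMod f → ℕ) (i : ZMod f) : ℕ :=
  if a (i + 1) = p then sInf {s : ℕ | 1 ≤ s ∧ a (i + (s : ZMod f) + 1) ≠ p - 1} else 0

/-- The embedding `τ_i'`: it is `τ_{i+1}` if `a_{i+1} ≠ p`, and `τ_{j+1}` otherwise. -/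
def tau' (τ₀ : resField p K →+* F) (a : ZMod f → ℕ) (i : ZMod f) : resField p K →+* F :=
  tau p K τ₀ (i + (shift p a i : ZMod f) + 1)

/-- The integer `n_i'`: it is `e n_{i+1} / (p^f - 1)` if `a_{i+1} ≠ p`, and
`e n_{j+1} / (p^f - 1) - e` otherwise.  (The divisions are exact and the result is positive.) -/
def nPrime (e : ℕ) (a : ZMod f → ℕ) (i : ZMod f) : ℕ :=
  e * digitSum p a (i + (shift p a i : ZMod f) + 1) / (p ^ f - 1) - if a (i + 1) = p then e else 0

/-- `([i], [j])` is a dependent pair for the tame signature `a`. -/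
def DependentPair (a : ZMod f → ℕ) (i j : ZMod f) : Prop :=
  ∃ t : ℕ, 1 ≤ t ∧ t ≤ f - 1 ∧ j = i + (t : ZMod f) ∧
    a (i + 1) = p ∧ a (i + (t : ZMod f) + 1) ≠ p ∧
    ∃ s : ℕ, 1 ≤ s ∧ s ≤ t ∧
      (∀ r : ℕ, 2 ≤ r → r ≤ s → a (i + (r : ZMod f)) = p - 1) ∧
      (∀ r : ℕ, s + 1 ≤ r → r ≤ t → a (i + (r : ZMod f)) = p)

variable (Kbar : Type*) [Field Kbar] [Algebra K Kbar]

/-- `g ∈ G_K` lies in the inertia subgroup `I_K`: it acts trivially on the residue field of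
the algebraic closure. -/
def IsInertial [Algebra ℚ_[p] Kbar] (g : Kbar ≃ₐ[K] Kbar) : Prop :=
  ∀ x : Kbar, absv p Kbar x ≤ 1 → absv p Kbar (g x - x) < 1

/-- `a` is the tame signature of `χ` with respect to `τ_0`: `1 ≤ a_i ≤ p`, not all `a_i` are
equal to `p`, and `χ = (τ_0 ∘ ω_f) ^ n_0` on inertia, `ω_f` being the fundamental character
`g ↦ g(ϖ) / ϖ`, `ϖ ^ (p ^ f - 1) = -p`. -/
def IsTameSignature [Algebra ℚ_[p] Kbar] (τ₀ : resField p K →+* F) (χ : (Kbar ≃ₐ[K] Kbar) →* Fˣ)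
    (a : ZMod f → ℕ) : Prop :=
  (∀ i, 1 ≤ a i ∧ a i ≤ p) ∧ (∃ i, a i ≠ p) ∧
    ∀ ϖ : Kbar, ϖ ^ (p ^ f - 1) = -(p : Kbar) → ∀ g : Kbar ≃ₐ[K] Kbar, IsInertial p K Kbar g →
      (χ g : F) = τ₀ (kummerChar p K ϖ g) ^ digitSum p a 0

/-- `χ` is the mod `p` cyclotomic character of `G_K`. -/
def IsCyclotomic {K Kbar : Type*} [Field K] [Field Kbar] [Algebra K Kbar]
    (χ : (Kbar ≃ₐ[K] Kbar) →* Fˣ) : Prop :=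
  ∀ g : Kbar ≃ₐ[K] Kbar, ∃ m : ℕ, (χ g : F) = (m : F) ∧ ∀ ζ : Kbar, ζ ^ p = 1 → g ζ = ζ ^ m

end Characters

section Units

variable (p : ℕ) [Fact p.Prime]
variable (K : Type*) [Field K] [Algebra ℚ_[p] K] [Algebra.IsAlgebraic ℚ_[p] K]
variable {Kbar : Type*} [Field Kbar] [Algebra K Kbar]
variable (M : Type*) [Field M] [Algebra ℚ_[p] M] [Algebra.IsAlgebraic ℚ_[p] M] [Algebra K M]
  [IsScalarTower ℚ_[p] K M] [Algebra M Kbar] [IsScalarTower K M Kbar] [Normal K M]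
variable {F : Type*} [Field F] {f : ℕ}

/-- The action of `g ∈ G_K` on `l ⊗ F`, through its action on the residue field `l` of `M`. -/
def galAct (g : Kbar ≃ₐ[K] Kbar) : resTensor p M F →ₗ[F] resTensor p M F :=
  TensorProduct.AlgebraTensorModule.map LinearMap.id
    (resMap p ((AlgEquiv.restrictNormal g M).restrictScalars ℚ_[p] :
      M →ₐ[ℚ_[p]] M)).toAddMonoidHom.toIntLinearMap

/-- The value at `g` of the unramified character `μ` with `χ = μ (τ_i' ∘ ω_π) ^ n_i'`, where
`ω_π(g) = g(π) / π` mod `π`. -/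
def mu (τ₀ : resField p K →+* F) (χ : (Kbar ≃ₐ[K] Kbar) →* Fˣ) (a : ZMod f → ℕ) (e : ℕ) (π : M)
    (i : ZMod f) (g : Kbar ≃ₐ[K] Kbar) : F :=
  (χ g : F) *
    (tau' p K τ₀ a i (kummerChar p K π (AlgEquiv.restrictNormal g M)) ^ nPrime p e a i)⁻¹

/-- The eigenspace `Λ_{τ, μ}` for `τ = τ_i'`: the elements of the summand `l ⊗_{k,τ} F` of `l ⊗ F`
(on which `c ⊗ 1` acts as `1 ⊗ τ(c)` for every `c ∈ k`) on which Galois acts through `μ`. -/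
def IsEigenvector (τ₀ : resField p K →+* F) (χ : (Kbar ≃ₐ[K] Kbar) →* Fˣ) (a : ZMod f → ℕ) (e : ℕ)
    (π : M) (i : ZMod f) (x : resTensor p M F) : Prop :=
  (∀ c : resField p K,
    ((1 : F) ⊗ₜ[ℤ] resMap p (IsScalarTower.toAlgHom ℚ_[p] K M) c) * x = tau' p K τ₀ a i c • x) ∧
  ∀ g : Kbar ≃ₐ[K] Kbar, galAct p K M g x = mu p K M τ₀ χ a e π i g • x

/-- The element `u_i = ε_{π ^ n_i'}(λ)` of `𝒪_M^× ⊗ F`. -/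
def basisUnit (a : ZMod f → ℕ) (e : ℕ) (π : M) (i : ZMod f) (x : resTensor p M F) :
    unitTensor p M F :=
  eps p M F (π ^ nPrime p e a i) x

/-- The element `u_cyc = ε_{δ ^ p}(b ⊗ 1)` of `𝒪_M^× ⊗ F`. -/
def cycUnit (F : Type*) [Field F] (δ : M) (b : resField p M) : unitTensor p M F :=
  eps p M F (δ ^ p) ((1 : F) ⊗ₜ[ℤ] b)

end Units

end TameUnits

end

/-! Two uniformizers of M with e-th power in K differ by a Teichmüller factor [β] and a principal
unit y of K, y ≡ 1 mod p (`exists_uniformizer_eq`). With n = n_i', the unit u_i' is therefore ε at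
π^n y^n of β^n λ_i'. Multiplication by β^n carries the eigenspace for π' into the one for π, which
is at most a line because Galois permutes transitively the embeddings of l above a given embedding
of k. So β^n λ_i' = c λ_i with c ≠ 0, and it remains to compare ε at π^n y^n with ε at π^n on this
line.

Since y^{p^k} ≡ 1 mod p^{k+1}, the quotient E(zy)/E(z) = exp(Σ z^{p^k} (y^{p^k} - 1)/p^k) is a value
of exp(p ·). Let φ be the Frobenius of l, A_m = ε_{π^m}, and P_m the linear extension of a ↦ exp(p
[a] π^m). The difference is then a combination of the classes P_{n p^k}(φ^k x), x = c λ_i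
(`epsLin_mul`, `epsLin_mul_intMap_sub_mem`). Three relations govern them (`TameRelations`): A_{pm} φ
= -P_m, from E(x)^p = E(x^p) exp(px); A_{m+e}(v x) = P_m(x) + p^{p-2} P_{pm}(φ x), from expanding
E(px), where p is π^e times a unit with residue v; and P_m = 0 when (p-1) m > e.

Put m_h = e n_h/(p^f - 1). Then p m_{h+1} = m_h + e a_h, and (p-1) m_h ≥ e, strictly unless every
a_h is 1. If a_{i+1} = p and j is as in the definition of n_i', the numbers n_i' p^k run through
m_{i+t+1} - e for t = j - i, ..., 1 and then through multiples of m_{i+1}, where P vanishes. The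
second relation rewrites P at m_{i+t+1} - e as a multiple of A at m_{i+t+1} plus a multiple of P at
the preceding t. If a_{i+t+1} ≠ p, the A term is a multiple of u_{i+t}, and (i, i+t) is a dependent
pair; if a_{i+t+1} = p, the first two relations move it to the next index, until a digit other than
p is met (`eps_mem_of_chain`, `exp_mem_of_le_shift`).

If a_{i+1} ≠ p, every term vanishes unless all a_h are 1. In that case n = e/(p-1) lies on the
boundary of convergence and only k = 0 survives. If -v has no (p-1)-th root in l the term is again
zero. If d is such a root, the relations give P_n(d(w^p - w)) = 0, so P_n(d ·) factors through the
trace of l over the prime field. An eigenvector with nonzero trace forces χ to be cyclotomic,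
because [d] π^n is an approximate (p-1)-th root of -p, and then its class is a multiple of u_cyc
(`expLin_mem_of_mem_eigenSubmodule`).

Two inputs lie deeper. The integrality of the m_h follows from the triviality of χ on G_M and the
surjectivity of the fundamental character on inertia (`dvd_mul_of_forall_inertial`). The additivity
of a ↦ E([a] z) modulo p-th powers, on which the meaning of ε depends, follows from Dwork's
integrality of a twisted Artin–Hasse series over the Witt vectors of l (`exists_ahUnit_teich_add`).
-/

open scoped TensorProduct Topology

noncomputable section

namespace TameUnits

open IsLocalRing

/-! ### Integrality of series of Artin–Hasse type. -/

section PowerSeriesIdentities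

open PowerSeries

section ODE

variable {R : Type*} [CommRing R]

/-- In A' = A c, each coefficient of A times its index is determined by the earlier ones. Identities
between exponentials are checked through this uniqueness, so that logarithms with p-power
denominators can be avoided. -/
theorem powerSeries_eq_of_derivative_eq_mul [IsDomain R] [CharZero R] {A B c : R⟦X⟧} (hA : derivative R A = A * c)
    (hB : derivative R B = B * c) (h0 : constantCoeff A = constantCoeff B) : A = B := by
  suffices h : ∀ n, coeff n (A - B) = 0 by
    ext n
    simpa [sub_eq_zero] using h n
  have hD : derivative R (A - B) = (A - B) * c := by rw [map_sub, hA, hB, sub_mul]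
  intro n
  induction n using Nat.strong_induction_on with
  | _ n ih =>
    rcases n with _ | n
    · simp [h0]
    · have h1 := congrArg (coeff n) hD
      rw [coeff_derivative, coeff_mul] at h1
      rw [Finset.sum_eq_zero] at h1
      · rcases mul_eq_zero.1 h1 with h | h
        · exact h
        · exact absurd h (by exact_mod_cast n.succ_ne_zero)
      · rintro ⟨i, j⟩ hij
        have hij' := Finset.HasAntidiagonal.mem_antidiagonal.1 hij
        simp only at hij' ⊢
        rw [ih i (by omega), zero_mul]

theorem powerSeries_derivative_rescale (a : R) (A : R⟦X⟧) :
    derivative R (rescale a A) = C a * rescale a (derivative R A) := by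
  ext n
  rw [coeff_derivative, coeff_rescale, coeff_C_mul, coeff_rescale, coeff_derivative, pow_succ]
  ring

end ODE

/-! ### Series supported on powers of p, and their derivatives. -/

section PrimePowSeries

variable {R : Type*} [CommRing R] (p : ℕ)

/-- The power series `∑ c n * X ^ (p ^ n)`. -/
def primePowSeries (c : ℕ → R) : R⟦X⟧ :=
  PowerSeries.mk fun m => if m = p ^ Nat.log p m then c (Nat.log p m) else 0

/-- The power series `∑ c n * X ^ (p ^ n - 1)`. -/
def primePowSubOneSeries (c : ℕ → R) : R⟦X⟧ :=
  PowerSeries.mk fun m => if m + 1 = p ^ Nat.log p (m + 1) then c (Nat.log p (m + 1)) else 0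

theorem coeff_primePowSubOneSeries (c : ℕ → R) (m : ℕ) :
    coeff m (primePowSubOneSeries p c) = coeff (m + 1) (primePowSeries p c) := by
  simp [primePowSeries, primePowSubOneSeries]

theorem constantCoeff_primePowSeries (c : ℕ → R) :
    constantCoeff (primePowSeries p c) = 0 := by
  rw [← coeff_zero_eq_constantCoeff_apply]
  simp [primePowSeries]

theorem derivative_primePowSeries (c : ℕ → R) :
    derivative R (primePowSeries p c) = primePowSubOneSeries p fun n => (p : R) ^ n * c n := by
  ext m
  rw [coeff_derivative]
  simp only [primePowSeries, primePowSubOneSeries, coeff_mk]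
  split_ifs with h
  · have : (m : R) + 1 = (p : R) ^ Nat.log p (m + 1) := by exact_mod_cast congrArg (Nat.cast (R := R)) h
    rw [this, mul_comm]
  · simp

theorem map_primePowSubOneSeries {S : Type*} [CommRing S] (g : R →+* S) (c : ℕ → R) :
    PowerSeries.map g (primePowSubOneSeries p c) = primePowSubOneSeries p fun n => g (c n) := by
  ext m
  simp only [primePowSubOneSeries, coeff_map, coeff_mk]
  split_ifs <;> simp

theorem primePowSubOneSeries_add (c d : ℕ → R) :
    primePowSubOneSeries p (fun n => c n + d n) =
      primePowSubOneSeries p c + primePowSubOneSeries p d := by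
  ext m
  simp only [primePowSubOneSeries, map_add, coeff_mk]
  split_ifs <;> simp

theorem primePowSubOneSeries_mul_left (r : R) (c : ℕ → R) :
    primePowSubOneSeries p (fun n => r * c n) = C r * primePowSubOneSeries p c := by
  ext m
  simp only [primePowSubOneSeries, coeff_C_mul, coeff_mk]
  split_ifs <;> simp

theorem rescale_primePowSubOneSeries (r : R) (c : ℕ → R) :
    C r * rescale r (primePowSubOneSeries p c) =
      primePowSubOneSeries p fun n => r ^ p ^ n * c n := by
  ext m
  simp only [primePowSubOneSeries, coeff_C_mul, coeff_mk, coeff_rescale]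
  split_ifs with h
  · conv_rhs => rw [← h]
    ring
  · simp

variable {p} in
-- Since p^{n+1} - 1 = (p - 1) + p (p^n - 1), all terms but the first form X^{p-1} times a series of
-- the same shape in X^p.
theorem primePowSubOneSeries_eq (hp : p.Prime) (c : ℕ → R) :
    primePowSubOneSeries p c =
      C (c 0) + X ^ (p - 1) * expand p hp.ne_zero (primePowSubOneSeries p fun n => c (n + 1)) := by
  have h2 := hp.two_le
  ext m
  rw [map_add, coeff_X_pow_mul', coeff_C]
  rcases Nat.lt_or_ge m (p - 1) with hm | hm
  · rw [if_neg (by omega : ¬ p - 1 ≤ m), add_zero]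
    simp only [primePowSubOneSeries, coeff_mk]
    have hl : Nat.log p (m + 1) = 0 := Nat.log_of_lt (by omega)
    rw [hl, pow_zero]
    simp
  · rw [if_neg (by omega : ¬ m = 0), zero_add, if_pos hm, coeff_expand]
    by_cases hd : p ∣ m + 1
    · obtain ⟨j, hj⟩ := hd
      have hj1 : j ≠ 0 := by rintro rfl; omega
      have hm' : m - (p - 1) = p * (j - 1) := by
        rw [Nat.mul_sub]
        omega
      rw [hm', if_pos (dvd_mul_right _ _), Nat.mul_div_cancel_left _ hp.pos]
      simp only [primePowSubOneSeries, coeff_mk]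
      rw [Nat.sub_add_cancel (Nat.one_le_iff_ne_zero.2 hj1), hj, mul_comm p j,
        Nat.log_mul_base hp.one_lt hj1, pow_succ]
      simp only [Nat.mul_left_inj hp.ne_zero]
    · have hd' : ¬ p ∣ m - (p - 1) := by
        intro h
        apply hd
        have := (Nat.dvd_add_right h).2 (dvd_refl p)
        rwa [show m - (p - 1) + p = m + 1 by omega] at this
      rw [if_neg hd']
      simp only [primePowSubOneSeries, coeff_mk]
      rw [if_neg]
      intro h
      apply hd
      rw [h]
      refine dvd_pow_self p fun h0 => ?_
      rw [Nat.log_eq_zero_iff] at h0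
      omega

end PrimePowSeries

/-! ### Integrality of exp(pX). -/

section PExp

variable {R : Type*} [CommRing R] {p : ℕ}

/-- By Legendre's formula (p - 1) v_p(n!) is n minus the sum of the base p digits of n, so v_p(n!) ≤
n, strictly if n ≠ 0. The prime-to-p part of n! is invertible. -/
theorem exists_factorial_mul_eq_pow (hp : p.Prime) (hu : ∀ n : ℕ, ¬ p ∣ n → IsUnit (n : R))
    (n : ℕ) : ∃ c : R, (n.factorial : R) * c = (p : R) ^ n ∧ (n ≠ 0 → (p : R) ∣ c) := by
  have : Fact p.Prime := ⟨hp⟩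
  obtain ⟨m, hm⟩ := pow_padicValNat_dvd (p := p) (n := n.factorial)
  have hpm : ¬ p ∣ m := by
    rintro ⟨k, rfl⟩
    have h : p ^ (padicValNat p n.factorial + 1) ∣ n.factorial := ⟨k, by
      rw [pow_succ, mul_assoc]; exact hm⟩
    exact pow_succ_padicValNat_not_dvd n.factorial_ne_zero h
  obtain ⟨u, hu⟩ := hu m hpm
  set v := padicValNat p n.factorial with hv
  have hle : v ≤ n ∧ (n ≠ 0 → v < n) := by
    have h1 := sub_one_mul_padicValNat_factorial (p := p) n
    rw [← hv] at h1
    have h2 : v ≤ (p - 1) * v := Nat.le_mul_of_pos_left _ (by have := hp.two_le; omega)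
    refine ⟨by omega, fun hn => ?_⟩
    have : 0 < (p.digits n).sum := by
      rw [Nat.pos_iff_ne_zero]
      intro h0
      have h3 : n % p = n % p := rfl
      have h4 := Nat.ofDigits_digits p n
      have h5 : ∀ x ∈ p.digits n, x = 0 := List.sum_eq_zero_iff.1 h0
      have h6 := Nat.getLast_digit_ne_zero p hn
      exact h6 (h5 _ (List.getLast_mem _))
    omega
  refine ⟨(p : R) ^ (n - v) * (u⁻¹ : Rˣ), ?_, fun hn => ?_⟩
  · rw [hm, Nat.cast_mul, ← hu, Nat.cast_pow]
    calc (p : R) ^ v * u * ((p : R) ^ (n - v) * (u⁻¹ : Rˣ))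
        = (p : R) ^ v * (p : R) ^ (n - v) * (u * (u⁻¹ : Rˣ)) := by ring
      _ = _ := by rw [Units.mul_inv, mul_one, ← pow_add, Nat.add_sub_cancel' hle.1]
  · exact Dvd.dvd.mul_right (dvd_pow_self _ (by have := hle.2 hn; omega)) _

/-- The series `exp (p X)` has coefficients in every domain of characteristic zero in which the
integers prime to `p` are invertible. -/
theorem exists_expMulSeries [IsDomain R] [CharZero R] (hp : p.Prime) (hu : ∀ n : ℕ, ¬ p ∣ n → IsUnit (n : R)) :
    ∃ A : R⟦X⟧, constantCoeff A = 1 ∧ derivative R A = A * C (p : R) ∧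
      ∀ n, n ≠ 0 → (p : R) ∣ coeff n A := by
  choose c hc hcd using exists_factorial_mul_eq_pow (R := R) hp hu
  refine ⟨PowerSeries.mk c, ?_, ?_, fun n hn => by simpa using hcd n hn⟩
  · rw [← coeff_zero_eq_constantCoeff_apply, coeff_mk]
    simpa using hc 0
  · ext n
    rw [coeff_derivative, mul_comm _ (C (p : R)), coeff_C_mul, coeff_mk, coeff_mk]
    have h1 := hc n
    have h2 := hc (n + 1)
    have hn : (n.factorial : R) ≠ 0 := by exact_mod_cast n.factorial_ne_zero
    apply mul_left_cancel₀ hn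
    rw [pow_succ, ← h1, Nat.factorial_succ] at h2
    push_cast at h2
    linear_combination h2

end PExp

/-! ### Dwork's lemma and the twisted Artin–Hasse series. -/

section Dwork

variable {R : Type*} [CommRing R] {p : ℕ}

/-- Modulo p, σ becomes Frobenius, and in characteristic p the p-th power of a series is Frobenius
on coefficients together with X ↦ X^p. -/
theorem dvd_expand_sub_pow (hp : p.Prime) (σ : R →+* R) (hσ : ∀ x, (p : R) ∣ σ x - x ^ p)
    (A : R⟦X⟧) (n : ℕ) :
    (p : R) ∣ coeff n (expand p hp.ne_zero (PowerSeries.map σ A) - A ^ p) := by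
  have : Fact p.Prime := ⟨hp⟩
  rw [← Ideal.mem_span_singleton, ← Ideal.Quotient.eq_zero_iff_mem]
  set q := Ideal.Quotient.mk (Ideal.span {(p : R)})
  by_cases hnt : (Ideal.span {(p : R)} = ⊤)
  · have := Ideal.Quotient.subsingleton_iff.2 hnt
    exact Subsingleton.elim _ _
  have hnt' := Ideal.Quotient.nontrivial_iff.2 hnt
  have hch : CharP (R ⧸ Ideal.span {(p : R)}) p := by
    rw [CharP.charP_iff_prime_eq_zero hp]
    have : q (p : R) = 0 := Ideal.Quotient.eq_zero_iff_mem.2 (Ideal.mem_span_singleton_self _)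
    simpa using this
  rw [← coeff_map, map_sub, map_pow, map_expand]
  have hσq : PowerSeries.map q (PowerSeries.map σ A) =
      PowerSeries.map (frobenius _ p) (PowerSeries.map q A) := by
    ext m
    simp only [coeff_map, frobenius_def]
    rw [← map_pow, ← sub_eq_zero, ← map_sub]
    exact Ideal.Quotient.eq_zero_iff_mem.2 (Ideal.mem_span_singleton.2 (hσ _))
  have hfrob : ∀ B : (R ⧸ Ideal.span {(p : R)})⟦X⟧,
      expand p hp.ne_zero (PowerSeries.map (frobenius _ p) B) = B ^ p := by
    intro B
    rw [← map_expand]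
    exact MvPowerSeries.map_frobenius_expand p hp.ne_zero
  rw [hσq, hfrob, sub_self, map_zero]

/-- Adding c X^n to A changes A^p H by p c X^n up to higher order, and the expanded side only in
degree pn > n. So c is the n-th coefficient of the discrepancy divided by p; the division is exact
because A(X^p) twisted by σ is A^p mod p and H is 1 mod p. -/
theorem exists_dwork_step (hp : p.Prime) (σ : R →+* R) (hσ : ∀ x, (p : R) ∣ σ x - x ^ p)
    {H : R⟦X⟧} (hH0 : constantCoeff H = 1) (hH : ∀ n, n ≠ 0 → (p : R) ∣ coeff n H)
    {A : R⟦X⟧} (hA0 : constantCoeff A = 1) {n : ℕ} (hn : n ≠ 0)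
    (hA : X ^ n ∣ expand p hp.ne_zero (PowerSeries.map σ A) - A ^ p * H) :
    ∃ c : R, X ^ (n + 1) ∣
      expand p hp.ne_zero (PowerSeries.map σ (A + C c * X ^ n)) - (A + C c * X ^ n) ^ p * H := by
  have hdvd : (p : R) ∣ coeff n (expand p hp.ne_zero (PowerSeries.map σ A) - A ^ p * H) := by
    have h1 : expand p hp.ne_zero (PowerSeries.map σ A) - A ^ p * H =
        (expand p hp.ne_zero (PowerSeries.map σ A) - A ^ p) - A ^ p * (H - 1) := by ring
    rw [h1, map_sub]
    refine dvd_sub (dvd_expand_sub_pow hp σ hσ A n) ?_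
    rw [coeff_mul]
    refine Finset.dvd_sum fun x _ => Dvd.dvd.mul_left ?_ _
    rcases eq_or_ne x.2 0 with h | h
    · rw [h, coeff_zero_eq_constantCoeff_apply, map_sub, hH0, map_one, sub_self]
      exact dvd_zero _
    · rw [map_sub, coeff_one, if_neg h, sub_zero]
      exact hH _ h
  obtain ⟨c, hc⟩ := hdvd
  refine ⟨c, ?_⟩
  obtain ⟨D, hD⟩ := hA
  obtain ⟨k, hk⟩ := Polynomial.powAddExpansion A (C c * X ^ n) p
  have hcD : constantCoeff D = p * c := by
    rw [← hc, hD, ← coeff_zero_eq_constantCoeff_apply, coeff_X_pow_mul', if_pos le_rfl,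
      Nat.sub_self]
  have hexp : expand p hp.ne_zero (PowerSeries.map σ (A + C c * X ^ n)) =
      expand p hp.ne_zero (PowerSeries.map σ A) + C (σ c) * X ^ (p * n) := by
    rw [map_add, map_add]
    congr 1
    rw [map_mul, map_mul, map_pow, map_pow, map_X, expand_X, map_C, expand_C, ← pow_mul]
  rw [hexp, hk]
  have h2 : n + 1 ≤ p * n := by nlinarith [hp.two_le, Nat.pos_of_ne_zero hn]
  obtain ⟨j, hj⟩ := Nat.exists_eq_add_of_le h2
  have hX : X ∣ D - C ((p : R) * c) * A ^ (p - 1) * H := by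
    rw [X_dvd_iff]
    simp [hcD, hA0, hH0]
  obtain ⟨B, hB⟩ := hX
  obtain ⟨n', rfl⟩ := Nat.exists_eq_succ_of_ne_zero hn
  refine ⟨B + C (σ c) * X ^ j - k * C c ^ 2 * X ^ n' * H, ?_⟩
  have hpC : ((p : ℕ) : R⟦X⟧) = C (p : R) := by simp
  rw [map_mul] at hB
  rw [hj, hpC]
  simp only [Nat.succ_eq_add_one] at *
  linear_combination hD + X ^ (n' + 1) * hB

theorem exists_expand_eq_pow_mul (hp : p.Prime) (σ : R →+* R) (hσ : ∀ x, (p : R) ∣ σ x - x ^ p)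
    {H : R⟦X⟧} (hH0 : constantCoeff H = 1) (hH : ∀ n, n ≠ 0 → (p : R) ∣ coeff n H) :
    ∃ A : R⟦X⟧, constantCoeff A = 1 ∧
      expand p hp.ne_zero (PowerSeries.map σ A) = A ^ p * H := by
  let Q : ℕ → Type _ := fun n => {A : R⟦X⟧ // constantCoeff A = 1 ∧
    X ^ (n + 1) ∣ expand p hp.ne_zero (PowerSeries.map σ A) - A ^ p * H}
  have hstep : ∀ n (A : Q n), ∃ B : Q (n + 1), X ^ (n + 1) ∣ B.1 - A.1 := by
    rintro n ⟨A, hA0, hA⟩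
    obtain ⟨c, hc⟩ := exists_dwork_step hp σ hσ hH0 hH hA0 n.succ_ne_zero hA
    exact ⟨⟨A + C c * X ^ (n + 1), by simp [hA0], hc⟩, by simp⟩
  choose s hs using hstep
  let A0 : Q 0 := ⟨1, by simp, by
    rw [zero_add, pow_one, X_dvd_iff]
    simp [hH0]⟩
  let A : ∀ n, Q n := fun n => Nat.rec A0 (fun n B => s n B) n
  have hA : ∀ n, X ^ (n + 1) ∣ (A (n + 1)).1 - (A n).1 := fun n => hs n (A n)
  have hA' : ∀ n k, X ^ (n + 1) ∣ (A (n + k)).1 - (A n).1 := by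
    intro n k
    induction k with
    | zero => simp
    | succ k ih =>
      have := (pow_dvd_pow X (by omega : n + 1 ≤ n + k + 1)).trans (hA (n + k))
      have h := dvd_add this ih
      rwa [sub_add_sub_cancel] at h
  -- The n-th approximation is final in degrees at most n, so the diagonal coefficients give the
  -- limit.
  let F : R⟦X⟧ := PowerSeries.mk fun n => coeff n (A n).1
  have hF : ∀ n, X ^ (n + 1) ∣ F - (A n).1 := by
    intro n
    rw [X_pow_dvd_iff]
    intro m hm
    have h1 := hA' m (n - m)
    rw [Nat.add_sub_cancel' (by omega), X_pow_dvd_iff] at h1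
    have h2 := h1 m (by omega)
    rw [map_sub] at h2 ⊢
    simp only [F, coeff_mk]
    linear_combination -h2
  have hF0 : constantCoeff F = 1 := by
    rw [← coeff_zero_eq_constantCoeff_apply]
    simp only [F, coeff_mk]
    simp [A, A0]
  refine ⟨F, hF0, ?_⟩
  rw [← sub_eq_zero]
  ext n
  have h3 : X ^ (n + 1) ∣ expand p hp.ne_zero (PowerSeries.map σ F) - F ^ p * H := by
    have h4 : expand p hp.ne_zero (PowerSeries.map σ F) - F ^ p * H =
        expand p hp.ne_zero (PowerSeries.map σ (F - (A n).1)) -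
          (F ^ p - (A n).1 ^ p) * H +
          (expand p hp.ne_zero (PowerSeries.map σ (A n).1) - (A n).1 ^ p * H) := by
      rw [map_sub, map_sub]
      ring
    rw [h4]
    refine dvd_add (dvd_sub ?_ ?_) (A n).2.2
    · obtain ⟨B, hB⟩ := hF n
      rw [hB, map_mul, map_mul, map_pow, map_pow, map_X, expand_X, ← pow_mul]
      exact Dvd.dvd.mul_right (pow_dvd_pow _ (Nat.le_mul_of_pos_left _ hp.pos)) _
    · exact Dvd.dvd.mul_right ((hF n).trans (sub_dvd_pow_sub_pow _ _ _)) _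
  simpa using X_pow_dvd_iff.1 h3 n (by omega)

theorem derivative_expand (hp : p ≠ 0) (A : R⟦X⟧) :
    derivative R (expand p hp A) = expand p hp (derivative R A) * (C (p : R) * X ^ (p - 1)) := by
  rw [expand_apply, derivative_subst (HasSubst.X_pow hp), expand_apply, derivative_pow,
    derivative_X, mul_one]
  simp

/-- The twisted Artin–Hasse series: for a lift `σ` of Frobenius, the series
`exp (∑ σ ^ n (w) X ^ (p ^ n) / p ^ n)` has integral coefficients. -/
theorem exists_twistedArtinHasse [IsDomain R] [CharZero R] (hp : p.Prime) (hu : ∀ n : ℕ, ¬ p ∣ n → IsUnit (n : R))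
    (σ : R →+* R) (hσ : ∀ x, (p : R) ∣ σ x - x ^ p) (w : R) :
    ∃ A : R⟦X⟧, constantCoeff A = 1 ∧
      derivative R A = A * primePowSubOneSeries p fun n => σ^[n] w := by
  obtain ⟨P, hP0, hP', hPd⟩ := exists_expMulSeries (R := R) hp hu
  -- H = exp(-p w X). In the logarithm of the series sought, σ together with X ↦ X^p sends the n-th
  -- term to p times the (n+1)-st, so the twisted series is A^p with the term p w X removed from the
  -- exponent.
  set H := rescale (-w) P with hH
  have hHd : derivative R H = C (-w * p) * H := by
    rw [hH, powerSeries_derivative_rescale, hP', map_mul, map_mul]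
    have : rescale (-w) (C (p : R)) = C (p : R) := by
      simp
    rw [this]
    ring
  obtain ⟨A, hA0, hA⟩ := exists_expand_eq_pow_mul hp σ hσ (H := H)
    (by rw [← coeff_zero_eq_constantCoeff_apply, hH, coeff_rescale]; simp [hP0])
    (fun n hn => by rw [hH, coeff_rescale]; exact Dvd.dvd.mul_left (hPd n hn) _)
  refine ⟨A, hA0, ?_⟩
  have hAu : IsUnit A := by
    rw [isUnit_iff_constantCoeff, hA0]
    exact isUnit_one
  obtain ⟨G, hG⟩ : ∃ G, derivative R A = A * G := by
    obtain ⟨u, rfl⟩ := hAu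
    exact ⟨(u⁻¹ : R⟦X⟧ˣ) * derivative R u, by rw [← mul_assoc, Units.mul_inv, one_mul]⟩
  -- The logarithmic derivative of the functional equation, after cancelling p.
  have hGeq : X ^ (p - 1) * expand p hp.ne_zero (PowerSeries.map σ G) = G - C w := by
    have h1 := congrArg (derivative R) hA
    have hm : derivative R (PowerSeries.map σ A) = PowerSeries.map σ (derivative R A) := by
      ext n
      simp [coeff_derivative]
    rw [derivative_expand, hm, hG, map_mul, map_mul, Derivation.leibniz, derivative_pow, hG, hHd,
      hA, smul_eq_mul, smul_eq_mul] at h1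
    have hne : A ^ p * H * C (p : R) ≠ 0 := by
      rw [← hA]
      intro h0
      have h2 := congrArg (constantCoeff (R := R)) h0
      have h3 : constantCoeff (PowerSeries.map σ A) = 1 := by
        rw [← coeff_zero_eq_constantCoeff_apply, coeff_map, coeff_zero_eq_constantCoeff_apply, hA0,
          map_one]
      rw [map_mul, constantCoeff_expand, h3] at h2
      simp [hp.ne_zero] at h2
    apply mul_left_cancel₀ hne
    have hpC : ((p : ℕ) : R⟦X⟧) = C (p : R) := by simp
    have hAp : A ^ p = A ^ (p - 1) * A := by
      rw [← pow_succ, Nat.sub_add_cancel hp.one_le]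
    rw [hpC, map_mul, map_neg] at h1
    rw [hAp] at h1 ⊢
    linear_combination h1
  set S := primePowSubOneSeries p fun n => σ^[n] w with hS
  have hSeq : X ^ (p - 1) * expand p hp.ne_zero (PowerSeries.map σ S) = S - C w := by
    rw [hS, map_primePowSubOneSeries, primePowSubOneSeries_eq hp fun n => σ^[n] w]
    simp only [Function.iterate_zero, id, add_sub_cancel_left, Function.iterate_succ_apply']
  -- The operator X^{p-1} σ(·)(X^p) raises the order of vanishing from n to at least pn + p - 1 > n,
  -- so the functional equation has only one solution.
  have hdiff : ∀ n, X ^ n ∣ G - S := by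
    intro n
    induction n with
    | zero => simp
    | succ n ih =>
      obtain ⟨B, hB⟩ := ih
      have h3 : G - S = X ^ (p - 1) * expand p hp.ne_zero (PowerSeries.map σ (G - S)) := by
        rw [map_sub, map_sub, mul_sub, hGeq, hSeq]
        ring
      rw [h3, hB, map_mul, map_mul, map_pow, map_pow, map_X, expand_X, ← pow_mul, ← mul_assoc,
        ← pow_add]
      refine Dvd.dvd.mul_right (pow_dvd_pow _ ?_) _
      have := hp.two_le
      have : n ≤ p * n := Nat.le_mul_of_pos_left _ hp.pos
      omega
  have hGS : G - S = 0 := by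
    ext n
    simpa using X_pow_dvd_iff.1 (hdiff (n + 1)) n (by omega)
  rw [hG, sub_eq_zero.1 hGS]

end Dwork
end PowerSeriesIdentities

/-! ### The absolute value and the valuation ring. -/

section AbsoluteValue

variable (p : ℕ) [Fact p.Prime] {E : Type*} [Field E] [Algebra ℚ_[p] E]

theorem absv_nonneg (x : E) : 0 ≤ absv p E x := spectralNorm_nonneg x

@[simp] theorem absv_zero : absv p E 0 = 0 := spectralNorm_zero

@[simp] theorem absv_one : absv p E 1 = 1 := spectralNorm_one

theorem absv_natCast_prime : absv p E (p : E) = (p : ℝ)⁻¹ := by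
  have := spectralNorm_extends (K := ℚ_[p]) (L := E) (p : ℚ_[p])
  simpa using this

variable (E) in
theorem absv_natCast_prime_pos : 0 < absv p E (p : E) := by
  rw [absv_natCast_prime]
  have := (Fact.out : p.Prime).pos
  positivity

variable (E) in
theorem absv_natCast_prime_lt_one : absv p E (p : E) < 1 := by
  rw [absv_natCast_prime]
  exact inv_lt_one_of_one_lt₀ (by exact_mod_cast (Fact.out : p.Prime).one_lt)

variable (E) in
theorem natCast_prime_ne_zero : (p : E) ≠ 0 := fun h => by
  have := absv_natCast_prime_pos p E
  rw [h, absv_zero] at this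
  exact this.false

variable [Algebra.IsAlgebraic ℚ_[p] E]

@[simp] theorem absv_mul (x y : E) : absv p E (x * y) = absv p E x * absv p E y :=
  spectralAlgNorm_mul x y

@[simp] theorem absv_pow (x : E) (n : ℕ) : absv p E (x ^ n) = absv p E x ^ n := by
  induction n with
  | zero => simp
  | succ n ih => rw [pow_succ, absv_mul, ih, pow_succ]

@[simp] theorem absv_neg (x : E) : absv p E (-x) = absv p E x :=
  spectralNorm_neg (Algebra.IsAlgebraic.isAlgebraic x)

theorem absv_sub_comm (x y : E) : absv p E (x - y) = absv p E (y - x) := by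
  rw [← absv_neg, neg_sub]

theorem absv_pos {x : E} (hx : x ≠ 0) : 0 < absv p E x :=
  spectralNorm_zero_lt hx (Algebra.IsAlgebraic.isAlgebraic x)

variable {p} in
theorem eq_zero_of_absv_eq_zero {x : E} (hx : absv p E x = 0) : x = 0 := by
  by_contra h
  exact (absv_pos p h).ne' hx

theorem absv_inv (x : E) : absv p E x⁻¹ = (absv p E x)⁻¹ := by
  rcases eq_or_ne x 0 with rfl | hx
  · simp
  · exact eq_inv_of_mul_eq_one_left (by rw [← absv_mul, inv_mul_cancel₀ hx, absv_one])

theorem absv_div (x y : E) : absv p E (x / y) = absv p E x / absv p E y := by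
  rw [div_eq_mul_inv, absv_mul, absv_inv, div_eq_mul_inv]

theorem absv_add_le (x y : E) : absv p E (x + y) ≤ max (absv p E x) (absv p E y) :=
  isNonarchimedean_spectralNorm x y

theorem absv_sub_le (x y : E) : absv p E (x - y) ≤ max (absv p E x) (absv p E y) := by
  rw [sub_eq_add_neg, ← absv_neg p y]
  exact absv_add_le p _ _

variable {p} in
theorem absv_eq_of_sub_lt {x y : E} (h : absv p E (x - y) < absv p E x) :
    absv p E y = absv p E x := by
  apply le_antisymm
  · have := absv_sub_le p x (x - y)
    rw [sub_sub_cancel, max_eq_left h.le] at this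
    exact this
  · by_contra! hlt
    have := absv_add_le p (x - y) y
    rw [sub_add_cancel] at this
    exact absurd this (not_le.2 (max_lt h hlt))

theorem absv_natCast_le_one (n : ℕ) : absv p E (n : E) ≤ 1 := by
  induction n with
  | zero => simp
  | succ n ih =>
    rw [Nat.cast_succ]
    exact (absv_add_le p _ _).trans (max_le ih (absv_one p).le)

variable {p}

theorem absv_eq_one_of_pow_eq_one {x : E} {n : ℕ} (hn : n ≠ 0) (h : x ^ n = 1) :
    absv p E x = 1 := by
  have h1 : absv p E x ^ n = 1 := by rw [← absv_pow, h, absv_one]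
  exact (pow_eq_one_iff_of_nonneg (absv_nonneg p x) hn).1 h1

theorem absv_sum_le {ι : Type*} (s : Finset ι) (g : ι → E) {C : ℝ} (hC : 0 ≤ C)
    (h : ∀ i ∈ s, absv p E (g i) ≤ C) : absv p E (∑ i ∈ s, g i) ≤ C := by
  classical
  induction s using Finset.induction with
  | empty => simpa using hC
  | insert i s hi ih =>
    rw [Finset.sum_insert hi]
    exact (absv_add_le p _ _).trans (max_le (h i (Finset.mem_insert_self _ _))
      (ih fun j hj => h j (Finset.mem_insert_of_mem hj)))

theorem integers_absv_le (x : integers p E) : absv p E x ≤ 1 := x.2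

theorem integers_isUnit_iff {x : integers p E} : IsUnit x ↔ absv p E x = 1 := by
  constructor
  · intro hu
    obtain ⟨y, hy⟩ := hu.exists_right_inv
    have h1 : absv p E x * absv p E (y : E) = 1 := by
      rw [← absv_mul, show (x : E) * y = 1 from congrArg Subtype.val hy, absv_one]
    refine le_antisymm x.2 ?_
    by_contra! hlt
    have := mul_lt_one_of_nonneg_of_lt_one_left (absv_nonneg p (x : E)) hlt y.2
    exact this.ne h1
  · intro h
    have hx0 : (x : E) ≠ 0 := fun h0 => by rw [h0, absv_zero] at h; exact zero_ne_one h
    exact IsUnit.of_mul_eq_one ⟨(x : E)⁻¹, by rw [mem_integers, absv_inv, h, inv_one]⟩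
      (Subtype.ext (mul_inv_cancel₀ hx0))

theorem integers_mem_maximalIdeal_iff {x : integers p E} :
    x ∈ maximalIdeal (integers p E) ↔ absv p E x < 1 := by
  rw [mem_maximalIdeal, mem_nonunits_iff, integers_isUnit_iff]
  exact ⟨fun h => lt_of_le_of_ne x.2 h, fun h => h.ne⟩

theorem residue_eq_residue_iff {x y : integers p E} :
    residue (integers p E) x = residue (integers p E) y ↔ absv p E ((x : E) - y) < 1 := by
  rw [← sub_eq_zero, ← map_sub, residue_eq_zero_iff, integers_mem_maximalIdeal_iff]
  rfl

theorem residue_eq_zero_iff_absv_lt {x : integers p E} :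
    residue (integers p E) x = 0 ↔ absv p E (x : E) < 1 := by
  rw [residue_eq_zero_iff, integers_mem_maximalIdeal_iff]

theorem integers_dvd_iff {x y : integers p E} : x ∣ y ↔ absv p E y ≤ absv p E x := by
  constructor
  · rintro ⟨z, rfl⟩
    rw [MulMemClass.coe_mul, absv_mul]
    exact mul_le_of_le_one_right (absv_nonneg p _) z.2
  · intro h
    rcases eq_or_ne (x : E) 0 with hx | hx
    · rw [hx, absv_zero] at h
      have : (y : E) = 0 := eq_zero_of_absv_eq_zero (le_antisymm h (absv_nonneg p _))
      have : y = 0 := Subtype.ext this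
      rw [this]
      exact dvd_zero x
    · refine ⟨⟨y / x, ?_⟩, Subtype.ext ?_⟩
      · rw [mem_integers, absv_div]
        exact div_le_one_of_le₀ h (absv_nonneg p _)
      · exact (mul_div_cancel₀ (y : E) hx).symm

end AbsoluteValue

/-! ### Completeness of the ring of integers. -/

section Completeness

variable {p : ℕ} [Fact p.Prime] {E : Type*} [Field E] [Algebra ℚ_[p] E] [FiniteDimensional ℚ_[p] E]

theorem exists_limit_of_absv_sub_le {s : ℕ → E} {r C : ℝ} (hr : r < 1)
    (hs : ∀ n, absv p E (s (n + 1) - s n) ≤ C * r ^ n) :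
    ∃ x : E, Filter.Tendsto (fun n => absv p E (s n - x)) Filter.atTop (𝓝 0) := by
  let : NormedField E := spectralNorm.normedField ℚ_[p] E
  have : CompleteSpace E := spectralNorm.completeSpace ℚ_[p] E
  have hc : CauchySeq s := by
    apply cauchySeq_of_le_geometric r C hr
    intro n
    rw [dist_comm, dist_eq_norm]
    exact hs n
  obtain ⟨x, hx⟩ := cauchySeq_tendsto_of_complete hc
  exact ⟨x, tendsto_iff_norm_sub_tendsto_zero.1 hx⟩

theorem integers_exists_limit {z : integers p E} (hz : absv p E z < 1) {s : ℕ → integers p E}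
    (hs : ∀ n, z ^ n ∣ s (n + 1) - s n) : ∃ x, ∀ n, z ^ n ∣ x - s n := by
  have hs' : ∀ n k, z ^ n ∣ s (n + k) - s n := by
    intro n k
    induction k with
    | zero => simp
    | succ k ih =>
      have h := dvd_add ((pow_dvd_pow z (Nat.le_add_right n k)).trans (hs (n + k))) ih
      rwa [sub_add_sub_cancel] at h
  obtain ⟨x, hx⟩ := exists_limit_of_absv_sub_le (p := p) (s := fun n => (s n : E)) (C := 1) hz
    fun n => by
      have := integers_dvd_iff.1 (hs n)
      simpa using this
  have hlim : ∀ n, absv p E (x - s n) ≤ absv p E z ^ n := by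
    intro n
    by_contra! hc
    have hpos : 0 < absv p E (x - s n) :=
      (pow_nonneg (absv_nonneg p (z : E)) n).trans_lt hc
    obtain ⟨m, hm1, hm2⟩ := ((hx.eventually_lt_const hpos).and
      (Filter.eventually_ge_atTop n)).exists
    obtain ⟨k, rfl⟩ := Nat.exists_eq_add_of_le hm2
    have h1 := integers_dvd_iff.1 (hs' n k)
    rw [SubmonoidClass.coe_pow, absv_pow] at h1
    have h2 : x - s n = (x - s (n + k)) + (s (n + k) - s n) := by ring
    have h3 := absv_add_le p (x - s (n + k)) ((s (n + k) : E) - s n)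
    rw [← h2] at h3
    rcases le_max_iff.1 h3 with h | h
    · rw [absv_sub_comm] at hm1
      exact absurd h (not_le.2 hm1)
    · exact absurd (h.trans h1) (not_le.2 hc)
  have hxO : x ∈ integers p E := by
    rw [mem_integers]
    have h1 := absv_add_le p (x - s 0) (s 0)
    rw [sub_add_cancel] at h1
    refine h1.trans (max_le ?_ (s 0).2)
    simpa using hlim 0
  refine ⟨⟨x, hxO⟩, fun n => integers_dvd_iff.2 ?_⟩
  rw [SubmonoidClass.coe_pow, absv_pow]
  exact hlim n

omit [FiniteDimensional ℚ_[p] E] in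
theorem integers_eq_zero_of_forall_pow_dvd [Algebra.IsAlgebraic ℚ_[p] E] {z x : integers p E}
    (hz : absv p E z < 1) (h : ∀ n, z ^ n ∣ x) : x = 0 := by
  by_contra hx
  have hpos : 0 < absv p E (x : E) := absv_pos p fun h0 => hx (Subtype.ext h0)
  obtain ⟨n, hn⟩ := exists_pow_lt_of_lt_one hpos hz
  have := integers_dvd_iff.1 (h n)
  rw [SubmonoidClass.coe_pow, absv_pow] at this
  exact absurd this (not_le.2 hn)

theorem integers_isAdicComplete {z : integers p E} (hz : absv p E z < 1) :
    IsAdicComplete (Ideal.span {z}) (integers p E) where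
  haus' := by
    intro x hx
    apply integers_eq_zero_of_forall_pow_dvd hz
    intro n
    have := hx n
    rw [smul_eq_mul, Ideal.mul_top, Ideal.span_singleton_pow, SModEq.zero,
      Ideal.mem_span_singleton] at this
    exact this
  prec' := by
    intro s hs
    simp only [smul_eq_mul, Ideal.mul_top, Ideal.span_singleton_pow, SModEq.sub_mem,
      Ideal.mem_span_singleton] at hs ⊢
    obtain ⟨x, hx⟩ := integers_exists_limit hz (s := s) fun n => by
      rw [← dvd_neg, neg_sub]
      exact hs n.le_succ
    exact ⟨x, fun n => by rw [← dvd_neg, neg_sub]; exact hx n⟩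

instance : Fact (¬ IsUnit ((p : ℕ) : integers p E)) := ⟨fun h => by
  rw [integers_isUnit_iff] at h
  exact (absv_natCast_prime_lt_one p E).ne (by simpa using h)⟩

/-- Completeness at p is what Fontaine's map θ and Hensel's lemma require. -/
instance : IsAdicComplete (Ideal.span {((p : ℕ) : integers p E)}) (integers p E) :=
  integers_isAdicComplete (by simpa using absv_natCast_prime_lt_one p E)

end Completeness

/-! ### Finiteness of the residue field. -/

section Residue

variable (p : ℕ) [Fact p.Prime] {E : Type*} [Field E] [Algebra ℚ_[p] E]
  [Algebra.IsAlgebraic ℚ_[p] E]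

/-- Divide a relation by a coefficient of largest norm: the coefficients become p-adic integers, one
of them 1, and reducing them modulo p gives a nontrivial relation between the residues. -/
theorem linearIndependent_of_residue {ι : Type*} [Fintype ι] (v : ι → integers p E)
    (hv : LinearIndependent (ZMod p) fun i => residue (integers p E) (v i)) :
    LinearIndependent ℚ_[p] fun i => (v i : E) := by
  rw [Fintype.linearIndependent_iff]
  intro g hg
  by_contra! hc
  obtain ⟨i₁, hi₁⟩ := hc
  have : Nonempty ι := ⟨i₁⟩
  obtain ⟨i₀, hi₀⟩ := Finite.exists_max fun i => ‖g i‖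
  have hg0 : g i₀ ≠ 0 := by
    intro h0
    have := hi₀ i₁
    rw [h0, norm_zero] at this
    exact hi₁ (norm_le_zero_iff.1 this)
  have hle : ∀ i, ‖g i / g i₀‖ ≤ 1 := fun i => by
    rw [norm_div]
    exact div_le_one_of_le₀ (hi₀ i) (norm_nonneg _)
  have hy : ∀ i, ∃ y : ℤ_[p], (y : ℚ_[p]) = g i / g i₀ := fun i => ⟨⟨_, hle i⟩, rfl⟩
  choose y hy using hy
  choose n hn hn' using fun i => PadicInt.exists_mem_range (y i)
  have hn'' : ∀ i, ‖g i / g i₀ - n i‖ < 1 := fun i => by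
    have := hn' i
    rw [IsLocalRing.mem_maximalIdeal, PadicInt.mem_nonunits] at this
    rw [PadicInt.norm_def, PadicInt.coe_sub, PadicInt.coe_natCast, hy] at this
    exact this
  have hsum : ∑ i, (n i : ZMod p) • residue (integers p E) (v i) = 0 := by
    have h1 : ∑ i, (n i : ZMod p) • residue (integers p E) (v i) =
        residue (integers p E) (∑ i, (n i : integers p E) * v i) := by
      rw [map_sum]
      refine Finset.sum_congr rfl fun i _ => ?_
      rw [map_mul, map_natCast, Nat.cast_smul_eq_nsmul, nsmul_eq_mul]
    rw [h1, residue_eq_zero_iff_absv_lt]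
    have h2 : ((∑ i, (n i : integers p E) * v i : integers p E) : E) =
        ∑ i, -(algebraMap ℚ_[p] E (g i / g i₀ - n i) * v i) := by
      have h3 : ∑ i, algebraMap ℚ_[p] E (g i / g i₀) * (v i : E) = 0 := by
        have : ∑ i, algebraMap ℚ_[p] E (g i / g i₀) * (v i : E) =
            algebraMap ℚ_[p] E (g i₀)⁻¹ * ∑ i, g i • (v i : E) := by
          rw [Finset.mul_sum]
          refine Finset.sum_congr rfl fun i _ => ?_
          rw [Algebra.smul_def, div_eq_inv_mul, map_mul, mul_assoc]
        rw [this, hg, mul_zero]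
      rw [AddSubmonoidClass.coe_finsetSum, ← sub_zero (∑ i, _), ← h3, ← Finset.sum_sub_distrib]
      refine Finset.sum_congr rfl fun i _ => ?_
      rw [map_sub, map_natCast]
      push_cast
      ring
    rw [h2]
    obtain ⟨j, hj⟩ := Finite.exists_max fun i => ‖g i / g i₀ - n i‖
    refine (absv_sum_le (C := ‖g j / g i₀ - n j‖) _ _ (norm_nonneg _) fun i _ => ?_).trans_lt
      (hn'' j)
    rw [absv_neg, absv_mul]
    have h4 : absv p E (algebraMap ℚ_[p] E (g i / g i₀ - n i)) = ‖g i / g i₀ - n i‖ :=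
      spectralNorm_extends _
    rw [h4]
    exact (mul_le_of_le_one_right (norm_nonneg _) (v i).2).trans (hj i)
  have h5 := Fintype.linearIndependent_iff.1 hv _ hsum i₀
  rw [CharP.cast_eq_zero_iff (ZMod p) p] at h5
  have h6 := hn'' i₀
  rw [div_self hg0] at h6
  have h7 : n i₀ = 0 := Nat.eq_zero_of_dvd_of_lt h5 (hn i₀)
  rw [h7] at h6
  simp at h6

variable (E) in
theorem rank_resField_le [FiniteDimensional ℚ_[p] E] :
    Module.rank (ZMod p) (resField p E) ≤ Module.finrank ℚ_[p] E := by
  apply rank_le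
  intro s hs
  choose v hv using fun i : s => residue_surjective (R := integers p E) (i : resField p E)
  have := (linearIndependent_of_residue p v (by simpa only [hv] using hs)).fintype_card_le_finrank
  simpa using this

variable (E) in
instance [FiniteDimensional ℚ_[p] E] : Finite (resField p E) := by
  have : Module.Finite (ZMod p) (resField p E) :=
    Module.rank_lt_aleph0_iff.1 ((rank_resField_le p E).trans_lt Cardinal.natCast_lt_aleph0)
  exact Module.finite_of_finite (ZMod p)

end Residue

/-! ### Teichmüller lifts and the map from Witt vectors to a possibly ramified ring of integers. -/

section Teichmuller

variable {p : ℕ} [Fact p.Prime] {E : Type*} [Field E] [Algebra ℚ_[p] E] [FiniteDimensional ℚ_[p] E]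

/-- A generator t of the ideal (p, x). As t divides p, congruences modulo t improve under p-th
powers. -/
theorem exists_common_divisor {x : integers p E} (hx : absv p E x < 1) :
    ∃ t : integers p E, absv p E t < 1 ∧ t ∣ (p : integers p E) ∧ t ∣ x := by
  rcases le_total (absv p E x) (absv p E (p : E)) with h | h
  · exact ⟨p, by simpa using absv_natCast_prime_lt_one p E, dvd_rfl,
      integers_dvd_iff.2 (by simpa using h)⟩
  · exact ⟨x, hx, integers_dvd_iff.2 (by simpa using h), dvd_rfl⟩

theorem pow_dvd_pow_prime_pow_sub {t x y : integers p E} (ht : t ∣ (p : integers p E))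
    (h : t ∣ x - y) (m : ℕ) : t ^ (m + 1) ∣ x ^ p ^ m - y ^ p ^ m := by
  have := SModEq.pow_pow_add_one (I := Ideal.span {t}) (p := p) (m := m)
    (Ideal.mem_span_singleton.2 ht) (x := x) (y := y)
    (by rw [SModEq.sub_mem, Ideal.mem_span_singleton]; exact h)
  rwa [SModEq.sub_mem, Ideal.span_singleton_pow, Ideal.mem_span_singleton] at this

/-- The power p^{mnj} fixes both x and y, and makes their difference divisible by t^{mnj+1}, for
every j. -/
theorem eq_of_residue_eq_of_pow_eq {x y : integers p E}
    (h : residue (integers p E) x = residue (integers p E) y) {m n : ℕ} (hm : 0 < m) (hn : 0 < n)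
    (hx : x ^ p ^ m = x) (hy : y ^ p ^ n = y) : x = y := by
  obtain ⟨t, ht, htp, htx⟩ := exists_common_divisor (p := p) (x := x - y)
    (residue_eq_residue_iff.1 h)
  have hit : ∀ {z : integers p E} {k : ℕ}, z ^ p ^ k = z → ∀ j, z ^ p ^ (k * j) = z := by
    intro z k hz j
    induction j with
    | zero => simp
    | succ j ih => rw [Nat.mul_succ, pow_add, pow_mul, ih, hz]
  rw [← sub_eq_zero]
  apply integers_eq_zero_of_forall_pow_dvd ht
  intro j
  have h1 := pow_dvd_pow_prime_pow_sub htp htx (m * n * j)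
  rw [mul_assoc, hit hx, mul_left_comm, hit hy] at h1
  refine (pow_dvd_pow t ?_).trans h1
  nlinarith [Nat.mul_pos hm hn]

variable (p E) in
theorem exists_card_resField : ∃ r : ℕ, 0 < r ∧ Nat.card (resField p E) = p ^ r := by
  have := Fintype.ofFinite (resField p E)
  obtain ⟨n, -, hn⟩ := FiniteField.card (resField p E) p
  exact ⟨n, n.pos, by rw [Nat.card_eq_fintype_card, hn]⟩

theorem resField_pow_card (a : resField p E) : a ^ Nat.card (resField p E) = a := by
  have := Fintype.ofFinite (resField p E)
  rw [Nat.card_eq_fintype_card]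
  exact FiniteField.pow_card a

/-- The limit of x^{q^n} for an arbitrary lift x of a, where q is the order of the residue field. -/
theorem exists_teich (a : resField p E) : ∃ z : integers p E,
    residue (integers p E) z = a ∧ z ^ Nat.card (resField p E) = z := by
  obtain ⟨r, hr, hq⟩ := exists_card_resField p E
  obtain ⟨x, rfl⟩ := residue_surjective a
  obtain ⟨t, ht, htp, htx⟩ := exists_common_divisor (p := p)
    (x := x ^ Nat.card (resField p E) - x) (residue_eq_residue_iff.1 (by
      rw [map_pow, resField_pow_card]))
  rw [hq] at htx ⊢
  have hs : ∀ n, t ^ n ∣ x ^ p ^ (r * (n + 1)) - x ^ p ^ (r * n) := by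
    intro n
    have h1 := pow_dvd_pow_prime_pow_sub htp htx (r * n)
    rw [← pow_mul, ← pow_add, ← Nat.add_comm (r * n), ← Nat.mul_succ] at h1
    exact (pow_dvd_pow t (by nlinarith)).trans h1
  obtain ⟨z, hz⟩ := integers_exists_limit ht (s := fun n => x ^ p ^ (r * n)) hs
  refine ⟨z, ?_, ?_⟩
  · have h1 := hz 1
    rw [pow_one] at h1
    rw [mul_one] at h1
    have h2 : residue (integers p E) z = residue (integers p E) (x ^ p ^ r) := by
      rw [residue_eq_residue_iff]
      exact (integers_dvd_iff.1 h1).trans_lt ht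
    rw [h2, map_pow, ← hq, resField_pow_card]
  · rw [← sub_eq_zero]
    apply integers_eq_zero_of_forall_pow_dvd ht
    intro n
    have h1 := (hz n).trans (sub_dvd_pow_sub_pow z (x ^ p ^ (r * n)) (p ^ r))
    rw [← pow_mul, ← pow_add, ← Nat.mul_succ] at h1
    have h2 := (pow_dvd_pow t n.le_succ).trans (hz (n + 1))
    have h3 := dvd_sub h1 h2
    rwa [sub_sub_sub_cancel_right] at h3

theorem teich_spec (a : resField p E) : residue (integers p E) (teich p E a) = a ∧
    ∃ m : ℕ, 0 < m ∧ teich p E a ^ p ^ m = teich p E a := by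
  obtain ⟨r, hr, hq⟩ := exists_card_resField p E
  obtain ⟨z, hz⟩ := exists_teich a
  rw [hq] at hz
  exact Classical.epsilon_spec (p := fun z : integers p E =>
    residue (integers p E) z = a ∧ ∃ m : ℕ, 0 < m ∧ z ^ p ^ m = z) ⟨z, hz.1, r, hr, hz.2⟩

@[simp] theorem residue_teich (a : resField p E) : residue (integers p E) (teich p E a) = a :=
  (teich_spec a).1

theorem teich_eq {a : resField p E} {z : integers p E} (hz : residue (integers p E) z = a)
    {m : ℕ} (hm : 0 < m) (h : z ^ p ^ m = z) : teich p E a = z := by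
  obtain ⟨n, hn, hn'⟩ := (teich_spec a).2
  exact eq_of_residue_eq_of_pow_eq (by rw [residue_teich, hz]) hn hm hn' h

theorem teich_pow_card (a : resField p E) :
    teich p E a ^ Nat.card (resField p E) = teich p E a := by
  obtain ⟨r, hr, hq⟩ := exists_card_resField p E
  obtain ⟨z, hz, hz'⟩ := exists_teich a
  rw [teich_eq hz hr (by rw [← hq, hz']), hz']

variable (p E) in
/-- The Teichmüller lift as a homomorphism. -/
def teichHom : resField p E →*₀ integers p E where
  toFun := teich p E
  map_zero' := teich_eq (map_zero _) one_pos (zero_pow (by simp [(Fact.out : p.Prime).ne_zero]))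
  map_one' := teich_eq (map_one _) one_pos (one_pow _)
  map_mul' a b := by
    obtain ⟨r, hr, hq⟩ := exists_card_resField p E
    refine teich_eq (by simp) hr ?_
    rw [mul_pow, ← hq, teich_pow_card, teich_pow_card]

@[simp] theorem teich_zero : teich p E 0 = 0 := map_zero (teichHom p E)

@[simp] theorem teich_one : teich p E 1 = 1 := map_one (teichHom p E)

@[simp] theorem teich_mul (a b : resField p E) : teich p E (a * b) = teich p E a * teich p E b :=
  map_mul (teichHom p E) a b

@[simp] theorem teich_pow (a : resField p E) (n : ℕ) : teich p E (a ^ n) = teich p E a ^ n :=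
  map_pow (teichHom p E) a n

theorem exists_pow_dvd_prime {x : integers p E} (hx : absv p E x < 1) :
    ∃ n, ∀ m, n ≤ m → (p : integers p E) ∣ x ^ m := by
  obtain ⟨n, hn⟩ := exists_pow_lt_of_lt_one (absv_natCast_prime_pos p E) hx
  refine ⟨n, fun m hm => (integers_dvd_iff.2 ?_ : _ ∣ x ^ n).trans (pow_dvd_pow x hm)⟩
  simpa using hn.le

/-- The congruence holds modulo p, not only modulo the maximal ideal. In characteristic p a high
power of q-Frobenius is additive and fixes the three Teichmüller lifts, while it kills the
discrepancy w, which is topologically nilpotent. -/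
theorem dvd_teich_add_sub (a b : resField p E) :
    (p : integers p E) ∣ teich p E (a + b) - (teich p E a + teich p E b) := by
  obtain ⟨r, hr, hq⟩ := exists_card_resField p E
  set w := teich p E (a + b) - (teich p E a + teich p E b) with hw
  have hw1 : absv p E (w : E) < 1 := by
    rw [← residue_eq_zero_iff_absv_lt, hw]
    simp
  obtain ⟨n, hn⟩ := exists_pow_dvd_prime hw1
  have hpn : n ≤ p ^ (r * n) := by
    have h1 := Nat.lt_pow_self (n := n) (Fact.out : p.Prime).one_lt
    exact h1.le.trans (Nat.pow_le_pow_right (Fact.out : p.Prime).pos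
      (Nat.le_mul_of_pos_left _ hr))
  have hit : ∀ c : resField p E, ∀ j, teich p E c ^ p ^ (r * j) = teich p E c := by
    intro c j
    induction j with
    | zero => simp
    | succ j ih => rw [Nat.mul_succ, pow_add, pow_mul, ih, ← hq, teich_pow_card]
  set q := Ideal.Quotient.mk (Ideal.span {((p : ℕ) : integers p E)}) with hqdef
  have hdvd : ∀ x : integers p E, (p : integers p E) ∣ x ↔ q x = 0 := fun x => by
    rw [Ideal.Quotient.eq_zero_iff_mem, Ideal.mem_span_singleton]
  have hch : CharP (integers p E ⧸ Ideal.span {((p : ℕ) : integers p E)}) p :=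
    inferInstanceAs (CharP (ModP (integers p E) p) p)
  have h1 : teich p E (a + b) = w + (teich p E a + teich p E b) := by rw [hw]; ring
  have h2 := congrArg (fun z => q (z ^ p ^ (r * n))) h1
  simp only [hit] at h2
  rw [map_pow, map_add, map_add, add_pow_char_pow, add_pow_char_pow, ← map_pow, ← map_pow,
    ← map_pow, hit, hit, (hdvd _).1 (hn _ hpn), zero_add] at h2
  rw [hdvd, hw, map_sub, h2, map_add, sub_self]

variable (p E) in
/-- The section `l → 𝒪 / p` of the projection to the residue field given by the Teichmüller
lift. -/
def teichModP : resField p E →+* ModP (integers p E) p where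
  toFun a := Ideal.Quotient.mk _ (teich p E a)
  map_zero' := by simp
  map_one' := by simp
  map_mul' a b := by simp
  map_add' a b := by
    rw [← map_add, Ideal.Quotient.eq, Ideal.mem_span_singleton]
    exact dvd_teich_add_sub a b

instance : PerfectRing (resField p E) p := PerfectRing.ofFiniteOfIsReduced p _

variable (p E) in
/-- The homomorphism from the residue field to the tilt. -/
def resFieldToTilt : resField p E →+* PreTilt (integers p E) p :=
  Perfection.lift p (resField p E) (ModP (integers p E) p) (teichModP p E)

theorem coeff_zero_resFieldToTilt (a : resField p E) :
    PreTilt.coeff 0 (resFieldToTilt p E a) = Ideal.Quotient.mk _ (teich p E a) := by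
  have := (Perfection.lift p (resField p E) (ModP (integers p E) p)).symm_apply_apply
    (teichModP p E)
  exact DFunLike.congr_fun this a

/-- The untilt is congruent to [a] mod p and fixed by the q-th power, which characterizes [a]. Hence
θ sends Teichmüller representatives to Teichmüller lifts. -/
theorem untilt_resFieldToTilt (a : resField p E) :
    PreTilt.untilt (resFieldToTilt p E a) = teich p E a := by
  obtain ⟨r, hr, hq⟩ := exists_card_resField p E
  symm
  refine teich_eq ?_ hr ?_
  · have h := PreTilt.mk_untilt_eq_coeff_zero (resFieldToTilt p E a)
    rw [coeff_zero_resFieldToTilt, Ideal.Quotient.eq, Ideal.mem_span_singleton] at h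
    refine Eq.trans (residue_eq_residue_iff.2 ?_) (residue_teich a)
    have h2 := integers_dvd_iff.1 h
    exact h2.trans_lt (by simpa using absv_natCast_prime_lt_one p E)
  · rw [← map_pow, ← map_pow, ← hq, resField_pow_card]

variable (p E) in
/-- The homomorphism from the Witt vectors of the residue field to the ring of integers. -/
def wittToIntegers : WittVector p (resField p E) →+* integers p E :=
  (WittVector.fontaineTheta (integers p E) p).comp (WittVector.map (resFieldToTilt p E))

theorem wittToIntegers_teichmuller (a : resField p E) :
    wittToIntegers p E (WittVector.teichmuller p a) = teich p E a := by
  rw [wittToIntegers, RingHom.comp_apply, WittVector.map_teichmuller,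
    WittVector.fontaineTheta_teichmuller, untilt_resFieldToTilt]

end Teichmuller

/-! ### Evaluating integral power series in the open unit disc. -/

section Evaluation

open PowerSeries

variable {p : ℕ} [Fact p.Prime] {E : Type*} [Field E] [Algebra ℚ_[p] E] [FiniteDimensional ℚ_[p] E]

/-- The value at z is the remainder on division by X - z, and the n-th coefficient of the quotient
is the tail Σ_{i>n} a_i z^{i-n-1}. Defined this way, evaluation is a ring homomorphism with no
further convergence argument. The tails are found by dividing by powers of z, so z = 0 is separate.
-/
theorem exists_X_sub_C_dvd {z : integers p E} (hz : absv p E z < 1) (A : (integers p E)⟦X⟧) :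
    ∃ x, X - C z ∣ A - C x := by
  rcases eq_or_ne z 0 with rfl | hz0
  · refine ⟨constantCoeff A, ?_⟩
    rw [map_zero, sub_zero, X_dvd_iff]
    simp
  obtain ⟨x, hx⟩ := integers_exists_limit hz
    (s := fun n => ∑ i ∈ Finset.range n, coeff i A * z ^ i) fun n => by
      rw [Finset.sum_range_succ, add_sub_cancel_left]
      exact dvd_mul_left _ _
  choose B hB using hx
  refine ⟨x, PowerSeries.mk fun n => B (n + 1), PowerSeries.ext fun n => ?_⟩
  have h1 := hB (n + 1)
  rw [Finset.sum_range_succ] at h1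
  rw [sub_mul, map_sub, map_sub, coeff_C_mul, coeff_C, coeff_mk]
  rcases n with _ | n
  · rw [coeff_zero_X_mul]
    simp only [Finset.range_zero, Finset.sum_empty, pow_zero, mul_one, zero_add, pow_one,
      if_true] at h1 ⊢
    linear_combination -h1
  · rw [coeff_succ_X_mul, coeff_mk, if_neg n.succ_ne_zero, sub_zero]
    apply mul_left_cancel₀ (pow_ne_zero (n + 1) hz0)
    have h2 := hB (n + 1)
    rw [pow_succ z (n + 1)] at h1
    linear_combination h2 - h1

/-- The coefficients of the quotient satisfy b_n = z b_{n+1}, so b_0 is divisible by every power of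
z. -/
theorem eq_zero_of_X_sub_C_dvd {z x : integers p E} (hz : absv p E z < 1)
    (h : X - C z ∣ C x) : x = 0 := by
  obtain ⟨B, hB⟩ := h
  rw [sub_mul] at hB
  have h0 : x = -(z * coeff 0 B) := by
    have := congrArg (coeff 0) hB
    rw [map_sub, coeff_zero_X_mul, coeff_C_mul, coeff_C, if_pos rfl, zero_sub] at this
    exact this
  have hs : ∀ n, coeff n B = z * coeff (n + 1) B := fun n => by
    have := congrArg (coeff (n + 1)) hB
    rw [map_sub, coeff_succ_X_mul, coeff_C_mul, coeff_C, if_neg n.succ_ne_zero] at this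
    exact (sub_eq_zero.1 this.symm)
  have hn : ∀ n, coeff 0 B = z ^ n * coeff n B := by
    intro n
    induction n with
    | zero => simp
    | succ n ih => rw [ih, hs n, pow_succ]; ring
  apply integers_eq_zero_of_forall_pow_dvd hz
  intro n
  rw [h0, hn n, dvd_neg]
  exact Dvd.dvd.mul_left (dvd_mul_right _ _) _

theorem eq_of_X_sub_C_dvd {z x y : integers p E} (hz : absv p E z < 1) {A : (integers p E)⟦X⟧}
    (hx : X - C z ∣ A - C x) (hy : X - C z ∣ A - C y) : x = y := by
  rw [← sub_eq_zero]
  apply eq_zero_of_X_sub_C_dvd hz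
  have := dvd_sub hy hx
  rwa [sub_sub_sub_cancel_left, ← map_sub] at this

/-- Evaluation of power series over `𝒪` at `z ∈ 𝒪`, `|z| < 1`. -/
def evalHom (z : integers p E) (hz : absv p E z < 1) : (integers p E)⟦X⟧ →+* integers p E where
  toFun A := (exists_X_sub_C_dvd hz A).choose
  map_zero' := eq_of_X_sub_C_dvd hz (exists_X_sub_C_dvd hz 0).choose_spec (by simp)
  map_one' := eq_of_X_sub_C_dvd hz (exists_X_sub_C_dvd hz 1).choose_spec (by simp)
  map_add' A B := by
    refine eq_of_X_sub_C_dvd hz (exists_X_sub_C_dvd hz _).choose_spec ?_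
    have := dvd_add (exists_X_sub_C_dvd hz A).choose_spec (exists_X_sub_C_dvd hz B).choose_spec
    rwa [← add_sub_add_comm, ← map_add] at this
  map_mul' A B := by
    refine eq_of_X_sub_C_dvd hz (exists_X_sub_C_dvd hz _).choose_spec ?_
    set a := (exists_X_sub_C_dvd hz A).choose
    set b := (exists_X_sub_C_dvd hz B).choose
    have h : A * B - C (a * b) = (A - C a) * B + C a * (B - C b) := by rw [map_mul]; ring
    rw [h]
    exact dvd_add (Dvd.dvd.mul_right (exists_X_sub_C_dvd hz A).choose_spec _)
      (Dvd.dvd.mul_left (exists_X_sub_C_dvd hz B).choose_spec _)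

variable {z : integers p E} (hz : absv p E z < 1)

theorem X_sub_C_dvd_sub_evalHom (A : (integers p E)⟦X⟧) : X - C z ∣ A - C (evalHom z hz A) :=
  (exists_X_sub_C_dvd hz A).choose_spec

theorem evalHom_eq_of_dvd {A : (integers p E)⟦X⟧} {x : integers p E} (h : X - C z ∣ A - C x) :
    evalHom z hz A = x :=
  eq_of_X_sub_C_dvd hz (X_sub_C_dvd_sub_evalHom hz A) h

@[simp] theorem evalHom_C (x : integers p E) : evalHom z hz (C x) = x :=
  evalHom_eq_of_dvd hz (by simp)

@[simp] theorem evalHom_X : evalHom z hz X = z := evalHom_eq_of_dvd hz dvd_rfl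

theorem dvd_evalHom {A : (integers p E)⟦X⟧} (hA : constantCoeff A = 0) : z ∣ evalHom z hz A := by
  obtain ⟨B, rfl⟩ := X_dvd_iff.2 hA
  rw [map_mul, evalHom_X]
  exact dvd_mul_right _ _

include hz in
theorem absv_lt_one_of_dvd {x : integers p E} (h : z ∣ x) : absv p E x < 1 :=
  (integers_dvd_iff.1 h).trans_lt hz

theorem evalHom_subst {f : (integers p E)⟦X⟧} (hf : constantCoeff f = 0)
    (A : (integers p E)⟦X⟧) :
    evalHom z hz (A.subst f) =
      evalHom (evalHom z hz f) (absv_lt_one_of_dvd hz (dvd_evalHom hz hf)) A := by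
  have hs : HasSubst f := HasSubst.of_constantCoeff_zero' hf
  apply evalHom_eq_of_dvd
  obtain ⟨B, hB⟩ := X_sub_C_dvd_sub_evalHom (absv_lt_one_of_dvd hz (dvd_evalHom hz hf)) A
  have hC : ∀ c : integers p E, (C c : (integers p E)⟦X⟧).subst f = C c := fun c =>
    subst_C c
  have h := congrArg (fun D => D.subst f) hB
  rw [subst_sub hs, subst_mul hs, subst_sub hs, subst_X hs, hC, hC] at h
  rw [h]
  exact Dvd.dvd.mul_right (X_sub_C_dvd_sub_evalHom hz f) _

theorem powerSeries_rescale_C {R : Type*} [CommRing R] (a c : R) : rescale a (C c) = C c := by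
  ext n
  rw [coeff_rescale, coeff_C]
  split_ifs with h
  · rw [h, pow_zero, one_mul]
  · rw [mul_zero]

theorem evalHom_rescale (x : integers p E) (hxz : absv p E (x * z : integers p E) < 1)
    (A : (integers p E)⟦X⟧) : evalHom z hz (rescale x A) = evalHom (x * z) hxz A := by
  apply evalHom_eq_of_dvd
  obtain ⟨B, hB⟩ := X_sub_C_dvd_sub_evalHom hxz A
  have h := congrArg (rescale x) hB
  have hC : ∀ c : integers p E, rescale x (C c) = C c := powerSeries_rescale_C x
  rw [map_sub, map_mul, map_sub, rescale_X, hC, hC, map_mul, ← mul_sub, mul_assoc,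
    mul_left_comm] at h
  rw [h]
  exact dvd_mul_right _ _

theorem evalHom_expand {n : ℕ} (hn : n ≠ 0) (hzn : absv p E (z ^ n : integers p E) < 1)
    (A : (integers p E)⟦X⟧) : evalHom z hz (expand n hn A) = evalHom (z ^ n) hzn A := by
  apply evalHom_eq_of_dvd
  obtain ⟨B, hB⟩ := X_sub_C_dvd_sub_evalHom hzn A
  have h := congrArg (expand n hn) hB
  rw [map_sub, map_mul, map_sub, expand_X, expand_C, expand_C, map_pow] at h
  rw [h]
  exact Dvd.dvd.mul_right (sub_dvd_pow_sub_pow _ _ _) _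

theorem pow_dvd_evalHom_sub_sum (A : (integers p E)⟦X⟧) (n : ℕ) :
    z ^ n ∣ evalHom z hz A - ∑ i ∈ Finset.range n, coeff i A * z ^ i := by
  have h : X ^ n ∣ A - ∑ i ∈ Finset.range n, C (coeff i A) * X ^ i := by
    rw [X_pow_dvd_iff]
    intro m hm
    rw [map_sub, map_sum, Finset.sum_eq_single m]
    · rw [coeff_C_mul, coeff_X_pow_self, mul_one, sub_self]
    · intro b _ hb
      rw [coeff_C_mul, coeff_X_pow, if_neg hb.symm, mul_zero]
    · intro h
      exact absurd (Finset.mem_range.2 hm) h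
  obtain ⟨B, hB⟩ := h
  have h2 := congrArg (evalHom z hz) hB
  rw [map_sub, map_mul, map_pow, evalHom_X, map_sum] at h2
  simp only [map_mul, map_pow, evalHom_X, evalHom_C] at h2
  exact ⟨_, h2⟩

theorem primePowSeries_eq_X_mul {R : Type*} [CommRing R] (p : ℕ) (c : ℕ → R) :
    primePowSeries p c = X * primePowSubOneSeries p c := by
  ext n
  rcases n with _ | n
  · rw [coeff_zero_X_mul, coeff_zero_eq_constantCoeff_apply, constantCoeff_primePowSeries]
  · rw [coeff_succ_X_mul, coeff_primePowSubOneSeries]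

theorem primePowSeries_eq {R : Type*} [CommRing R] {p : ℕ} (hp : p.Prime) (c : ℕ → R) :
    primePowSeries p c =
      C (c 0) * X + expand p hp.ne_zero (primePowSeries p fun n => c (n + 1)) := by
  rw [primePowSeries_eq_X_mul, primePowSubOneSeries_eq hp, primePowSeries_eq_X_mul, map_mul,
    expand_X, mul_add, ← mul_assoc, ← pow_succ', Nat.sub_add_cancel hp.one_le, mul_comm X]

/-- Splitting off the first term leaves a series of the same kind evaluated at z^p. -/
theorem pow_dvd_evalHom_primePowSeries_sub (c : ℕ → integers p E) (n : ℕ) :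
    z ^ p ^ n ∣ evalHom z hz (primePowSeries p c) - ∑ k ∈ Finset.range n, c k * z ^ p ^ k := by
  induction n generalizing z c with
  | zero => simpa using dvd_evalHom hz (constantCoeff_primePowSeries p c)
  | succ n ih =>
    have hp : p.Prime := Fact.out
    have hzp : absv p E (z ^ p : integers p E) < 1 :=
      absv_lt_one_of_dvd hz (dvd_pow_self z hp.ne_zero)
    rw [primePowSeries_eq hp, map_add, map_mul, evalHom_C, evalHom_X, evalHom_expand hz _ hzp,
      Finset.sum_range_succ', pow_zero, pow_one, add_comm (c 0 * z), add_sub_add_right_eq_sub,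
      pow_succ', pow_mul]
    have h := ih hzp fun n => c (n + 1)
    simp only [← pow_mul, ← pow_succ'] at h ⊢
    exact h

end Evaluation

/-! ### The Artin–Hasse series has p-adically integral coefficients. -/

section Series

open PowerSeries

variable (p : ℕ) [Fact p.Prime]

theorem padicInt_dvd_sub_pow (x : ℤ_[p]) : (p : ℤ_[p]) ∣ x - x ^ p := by
  rw [← Ideal.mem_span_singleton, ← PadicInt.maximalIdeal_eq_span_p, ← PadicInt.ker_toZMod,
    RingHom.mem_ker, map_sub, map_pow, ZMod.pow_card, sub_self]

theorem padicInt_isUnit_natCast {n : ℕ} (hn : ¬ p ∣ n) : IsUnit (n : ℤ_[p]) := by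
  rw [PadicInt.isUnit_iff]
  refine le_antisymm (PadicInt.norm_le_one _) ?_
  by_contra! h
  rw [PadicInt.norm_lt_one_iff_dvd] at h
  have h2 : ((n : ℤ) : ℤ_[p]) = (n : ℤ_[p]) := by simp
  rw [← h2, ← pow_one (p : ℤ_[p])] at h
  have h3 := (PadicInt.pow_p_dvd_int_iff 1 (n : ℤ)).1 h
  rw [pow_one] at h3
  exact hn (by exact_mod_cast h3)

theorem exists_padicArtinHasse : ∃ A : ℤ_[p]⟦X⟧, constantCoeff A = 1 ∧
    derivative _ A = A * primePowSubOneSeries p fun _ => 1 := by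
  obtain ⟨A, h0, h1⟩ := exists_twistedArtinHasse (R := ℤ_[p]) (Fact.out : p.Prime)
    (fun n hn => padicInt_isUnit_natCast p hn) (RingHom.id _) (padicInt_dvd_sub_pow p) 1
  refine ⟨A, h0, ?_⟩
  rw [h1]
  congr 2
  ext n
  rw [RingHom.coe_id, Function.iterate_id, id]

/-- The Artin–Hasse exponential with coefficients in `ℤ_p`. -/
def padicArtinHasse : ℤ_[p]⟦X⟧ := (exists_padicArtinHasse p).choose

theorem constantCoeff_padicArtinHasse : constantCoeff (padicArtinHasse p) = 1 :=
  (exists_padicArtinHasse p).choose_spec.1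

theorem derivative_padicArtinHasse :
    derivative _ (padicArtinHasse p) = padicArtinHasse p * primePowSubOneSeries p fun _ => 1 :=
  (exists_padicArtinHasse p).choose_spec.2

theorem derivative_map {R S : Type*} [CommRing R] [CommRing S] (g : R →+* S) (A : R⟦X⟧) :
    derivative S (PowerSeries.map g A) = PowerSeries.map g (derivative R A) := by
  ext n
  simp [coeff_derivative]

theorem derivative_artinHasse :
    derivative _ (artinHasse p) = artinHasse p * primePowSubOneSeries p fun _ => 1 := by
  have hp : p.Prime := Fact.out
  have hL : artinHasseLog p = primePowSeries p fun n => ((p : ℚ) ^ n)⁻¹ := by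
    ext m
    simp only [artinHasseLog, primePowSeries, coeff_mk]
    by_cases h : ∃ n, m = p ^ n
    · obtain ⟨n, rfl⟩ := h
      rw [if_pos ⟨n, rfl⟩, Nat.log_pow hp.one_lt, if_pos rfl, Nat.cast_pow]
    · rw [if_neg h, if_neg fun h' => h ⟨_, h'⟩]
  rw [artinHasse, derivative_subst (hasSubst_artinHasseLog p), derivative_exp, hL,
    derivative_primePowSeries]
  congr 2
  ext n
  exact mul_inv_cancel₀ (pow_ne_zero n (by exact_mod_cast hp.ne_zero))

theorem constantCoeff_artinHasse (p : ℕ) : constantCoeff (artinHasse p) = 1 := by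
  have hc : constantCoeff (artinHasseLog p) = 0 := by
    rw [← coeff_zero_eq_constantCoeff_apply]
    simp only [artinHasseLog, coeff_mk]
    split_ifs <;> simp
  have h1 : exp ℚ = C 1 + (exp ℚ - 1) := by simp
  have hs := hasSubst_artinHasseLog p
  have h2 : (C (1 : ℚ)).subst (artinHasseLog p) = C (1 : ℚ) := subst_C _
  have h3 : constantCoeff ((exp ℚ - 1).subst (artinHasseLog p)) = 0 :=
    constantCoeff_subst_eq_zero hc _ (by simp)
  rw [artinHasse, h1, subst_add hs, map_add, h2, h3, constantCoeff_C, add_zero]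

theorem map_padicArtinHasse :
    PowerSeries.map PadicInt.Coe.ringHom (padicArtinHasse p) =
      PowerSeries.map (algebraMap ℚ ℚ_[p]) (artinHasse p) := by
  apply powerSeries_eq_of_derivative_eq_mul (c := primePowSubOneSeries p fun _ => 1)
  · rw [derivative_map, derivative_padicArtinHasse, map_mul, map_primePowSubOneSeries, map_one]
  · rw [derivative_map, derivative_artinHasse, map_mul, map_primePowSubOneSeries, map_one]
  · rw [← coeff_zero_eq_constantCoeff_apply, ← coeff_zero_eq_constantCoeff_apply, coeff_map,
      coeff_map, coeff_zero_eq_constantCoeff_apply, coeff_zero_eq_constantCoeff_apply,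
      constantCoeff_padicArtinHasse, constantCoeff_artinHasse, map_one, map_one]

end Series

/-! ### Values of E and of exp(p ·), and the identities between them. -/

section SeriesUnits

open PowerSeries

variable (p : ℕ) [Fact p.Prime] {E : Type*} [Field E] [Algebra ℚ_[p] E] [FiniteDimensional ℚ_[p] E]

instance integers_charZero : CharZero (integers p E) := by
  have : CharZero E := charZero_of_injective_algebraMap (algebraMap ℚ_[p] E).injective
  exact ⟨fun a b h => Nat.cast_injective (R := E) (by simpa using congrArg Subtype.val h)⟩

variable (E) in
/-- The structure map `ℤ_p → 𝒪`. -/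
def padicIntToIntegers : ℤ_[p] →+* integers p E :=
  ((algebraMap ℚ_[p] E).comp PadicInt.Coe.ringHom).codRestrict (integers p E).toSubring fun x => by
    change absv p E _ ≤ 1
    have : absv p E (algebraMap ℚ_[p] E (x : ℚ_[p])) = ‖(x : ℚ_[p])‖ := spectralNorm_extends _
    exact this.le.trans x.2

theorem coe_padicIntToIntegers (x : ℤ_[p]) :
    (padicIntToIntegers p E x : E) = algebraMap ℚ_[p] E (x : ℚ_[p]) := rfl

variable (E) in
theorem integers_isUnit_natCast {n : ℕ} (hn : ¬ p ∣ n) : IsUnit (n : integers p E) := by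
  simpa using (padicInt_isUnit_natCast p hn).map (padicIntToIntegers p E)

variable (E) in
/-- The Artin–Hasse exponential with coefficients in `𝒪`. -/
def ahSeries : (integers p E)⟦X⟧ := PowerSeries.map (padicIntToIntegers p E) (padicArtinHasse p)

theorem coe_coeff_ahSeries (n : ℕ) :
    ((coeff n (ahSeries p E) : integers p E) : E) = ((coeff n (artinHasse p) : ℚ) : E) := by
  have h := congrArg (fun A => algebraMap ℚ_[p] E (coeff n A)) (map_padicArtinHasse p)
  simp only [coeff_map] at h
  rw [ahSeries, coeff_map, coe_padicIntToIntegers]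
  refine h.trans ?_
  simp

theorem constantCoeff_ahSeries : constantCoeff (ahSeries p E) = 1 := by
  rw [ahSeries, ← coeff_zero_eq_constantCoeff_apply, coeff_map, coeff_zero_eq_constantCoeff_apply,
    constantCoeff_padicArtinHasse, map_one]

theorem derivative_ahSeries :
    derivative _ (ahSeries p E) = ahSeries p E * primePowSubOneSeries p fun _ => 1 := by
  rw [ahSeries, derivative_map, derivative_padicArtinHasse, map_mul, map_primePowSubOneSeries,
    map_one]

variable (E) in
/-- The series `exp (p X)` with coefficients in `𝒪`. -/
def expSeries : (integers p E)⟦X⟧ :=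
  (exists_expMulSeries (Fact.out : p.Prime) fun _ hn => integers_isUnit_natCast p E hn).choose

theorem constantCoeff_expSeries : constantCoeff (expSeries p E) = 1 :=
  (exists_expMulSeries (Fact.out : p.Prime) fun _ hn =>
    integers_isUnit_natCast p E hn).choose_spec.1

theorem derivative_expSeries :
    derivative _ (expSeries p E) = expSeries p E * C (p : integers p E) :=
  (exists_expMulSeries (Fact.out : p.Prime) fun _ hn =>
    integers_isUnit_natCast p E hn).choose_spec.2.1

variable {p} {z : integers p E} (hz : absv p E z < 1)

theorem isUnit_evalHom {A : (integers p E)⟦X⟧} (hA : constantCoeff A = 1) :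
    IsUnit (evalHom z hz A) := by
  refine RingHom.isUnit_map _ ?_
  rw [PowerSeries.isUnit_iff_constantCoeff, hA]
  exact isUnit_one

open Classical in
/-- The value `E(z)` of the Artin–Hasse exponential (equal to `1` if `|z| = 1`). -/
def ahUnit (z : integers p E) : (integers p E)ˣ :=
  if hz : absv p E z < 1 then (isUnit_evalHom hz (constantCoeff_ahSeries p)).unit else 1

open Classical in
/-- The value `exp (p z)` (equal to `1` if `|z| = 1`). -/
def expUnit (z : integers p E) : (integers p E)ˣ :=
  if hz : absv p E z < 1 then (isUnit_evalHom hz (constantCoeff_expSeries p)).unit else 1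

theorem coe_ahUnit : (ahUnit z : integers p E) = evalHom z hz (ahSeries p E) := by
  rw [ahUnit, dif_pos hz, IsUnit.unit_spec]

theorem coe_expUnit : (expUnit z : integers p E) = evalHom z hz (expSeries p E) := by
  rw [expUnit, dif_pos hz, IsUnit.unit_spec]

include hz in
-- The choice in `ahValue` is harmless: the partial sums converge to the algebraically defined
-- value, and limits are unique.
theorem ahValue_eq_ahUnit : ahValue p E z = ahUnit z := by
  have hlim : ∀ w : (integers p E)ˣ, w = ahUnit z ↔
      Filter.Tendsto (fun N : ℕ => absv p E (((w : integers p E) : E) -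
        ∑ n ∈ Finset.range N, ((coeff n (artinHasse p) : ℚ) : E) * (z : E) ^ n))
        Filter.atTop (𝓝 0) := by
    have h0 : Filter.Tendsto (fun N : ℕ => absv p E (((ahUnit z : integers p E) : E) -
        ∑ n ∈ Finset.range N, ((coeff n (artinHasse p) : ℚ) : E) * (z : E) ^ n))
        Filter.atTop (𝓝 0) := by
      refine squeeze_zero (fun _ => absv_nonneg p _) (fun N => ?_)
        (tendsto_pow_atTop_nhds_zero_of_lt_one (absv_nonneg p (z : E)) hz)
      have h := integers_dvd_iff.1 (pow_dvd_evalHom_sub_sum hz (ahSeries p E) N)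
      rw [← coe_ahUnit hz, SubmonoidClass.coe_pow, absv_pow] at h
      refine le_trans (le_of_eq ?_) h
      congr 1
      push_cast
      congr 1
      exact Finset.sum_congr rfl fun n _ => by rw [coe_coeff_ahSeries]
    intro w
    refine ⟨fun h => h ▸ h0, fun h => ?_⟩
    have h1 := h.max h0
    rw [max_self] at h1
    have h2 : absv p E (((w : integers p E) : E) - (ahUnit z : integers p E)) ≤ 0 := by
      refine ge_of_tendsto' h1 fun N => ?_
      refine le_trans (le_of_eq ?_) (absv_sub_le p _ _)
      congr 1
      ring
    have h3 := eq_zero_of_absv_eq_zero (le_antisymm h2 (absv_nonneg p _))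
    exact Units.ext (Subtype.ext (sub_eq_zero.1 h3))
  rw [ahValue]
  refine (hlim _).2 (Classical.epsilon_spec (p := fun w : (integers p E)ˣ =>
    Filter.Tendsto (fun N : ℕ => absv p E (((w : integers p E) : E) -
      ∑ n ∈ Finset.range N, ((coeff n (artinHasse p) : ℚ) : E) * (z : E) ^ n))
      Filter.atTop (𝓝 0)) ⟨ahUnit z, (hlim _).1 rfl⟩)

theorem derivative_rescale_expSeries (x : integers p E) :
    derivative _ (rescale x (expSeries p E)) = rescale x (expSeries p E) * C (x * p) := by
  rw [powerSeries_derivative_rescale, derivative_expSeries, map_mul, powerSeries_rescale_C,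
    map_mul]
  ring

theorem constantCoeff_rescale {R : Type*} [CommRing R] (a : R) (A : R⟦X⟧) :
    constantCoeff (rescale a A) = constantCoeff A := by
  rw [← coeff_zero_eq_constantCoeff_apply, coeff_rescale, pow_zero, one_mul,
    coeff_zero_eq_constantCoeff_apply]

theorem derivative_rescale_ahSeries (x : integers p E) :
    derivative _ (rescale x (ahSeries p E)) =
      rescale x (ahSeries p E) * primePowSubOneSeries p fun n => x ^ p ^ n := by
  rw [powerSeries_derivative_rescale, derivative_ahSeries, map_mul, mul_left_comm,
    rescale_primePowSubOneSeries]
  simp only [mul_one]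

theorem constantCoeff_expSeries_subst {f : (integers p E)⟦X⟧} (hf : constantCoeff f = 0) :
    constantCoeff ((expSeries p E).subst f) = 1 := by
  have hs : HasSubst f := HasSubst.of_constantCoeff_zero' hf
  have h1 : expSeries p E = C 1 + (expSeries p E - C 1) := by simp
  have h2 : (C (1 : integers p E)).subst f = C (1 : integers p E) := subst_C _
  have h3 : constantCoeff ((expSeries p E - C 1).subst f) = 0 :=
    constantCoeff_subst_eq_zero hf _ (by simp [constantCoeff_expSeries])
  rw [h1, subst_add hs, map_add, h2, h3, constantCoeff_C, add_zero]

theorem derivative_expSeries_subst {f : (integers p E)⟦X⟧} (hf : constantCoeff f = 0) :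
    derivative _ ((expSeries p E).subst f) =
      (expSeries p E).subst f * (C (p : integers p E) * derivative _ f) := by
  have hs : HasSubst f := HasSubst.of_constantCoeff_zero' hf
  have h2 : (C (p : integers p E)).subst f = C (p : integers p E) := subst_C _
  rw [derivative_subst hs, derivative_expSeries, subst_mul hs, h2, mul_assoc]

/-- Evaluation is in one variable only, so x and y are written as multiples of a common t, and the
identity exp(pxT) exp(pyT) = exp(p(x+y)T) is evaluated at T = t. -/
theorem expUnit_add {x y : integers p E} (hx : absv p E x < 1) (hy : absv p E y < 1) :
    expUnit (x + y) = expUnit x * expUnit y := by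
  obtain ⟨t, ht, hdx, hdy⟩ : ∃ t : integers p E, absv p E t < 1 ∧ t ∣ x ∧ t ∣ y := by
    rcases le_total (absv p E x) (absv p E y) with h | h
    · exact ⟨y, hy, integers_dvd_iff.2 h, dvd_rfl⟩
    · exact ⟨x, hx, dvd_rfl, integers_dvd_iff.2 h⟩
  obtain ⟨x, rfl⟩ := hdx
  obtain ⟨y, rfl⟩ := hdy
  have hxy : absv p E (t * x + t * y : integers p E) < 1 :=
    absv_lt_one_of_dvd ht (dvd_add (dvd_mul_right _ _) (dvd_mul_right _ _))
  have h : rescale (x + y) (expSeries p E) =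
      rescale x (expSeries p E) * rescale y (expSeries p E) := by
    apply powerSeries_eq_of_derivative_eq_mul (derivative_rescale_expSeries (x + y))
    · rw [Derivation.leibniz, derivative_rescale_expSeries, derivative_rescale_expSeries,
        smul_eq_mul, smul_eq_mul, add_mul, map_add]
      ring
    · rw [map_mul, constantCoeff_rescale, constantCoeff_rescale, constantCoeff_rescale,
        constantCoeff_expSeries, mul_one]
  have h2 := congrArg (evalHom t ht) h
  have e1 : t * x + t * y = (x + y) * t := by ring
  rw [e1, mul_comm t x, mul_comm t y]
  rw [e1] at hxy
  rw [mul_comm t x] at hx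
  rw [mul_comm t y] at hy
  rw [map_mul, evalHom_rescale ht _ hxy, evalHom_rescale ht _ hx, evalHom_rescale ht _ hy,
    ← coe_expUnit, ← coe_expUnit, ← coe_expUnit, ← Units.val_mul] at h2
  exact Units.ext h2

include hz in
-- With L(X) = Σ X^{p^n}/p^n one has p L(X) = p X + L(X^p).
theorem ahUnit_pow : ahUnit z ^ p = ahUnit (z ^ p) * expUnit z := by
  have hp : p.Prime := Fact.out
  have hzp : absv p E (z ^ p : integers p E) < 1 :=
    absv_lt_one_of_dvd hz (dvd_pow_self z hp.ne_zero)
  have h : ahSeries p E ^ p = expand p hp.ne_zero (ahSeries p E) * expSeries p E := by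
    have hS := primePowSubOneSeries_eq hp fun _ => (1 : integers p E)
    apply powerSeries_eq_of_derivative_eq_mul
      (c := C (p : integers p E) * primePowSubOneSeries p fun _ => 1)
    · rw [derivative_pow, derivative_ahSeries]
      have : ((p : ℕ) : (integers p E)⟦X⟧) = C (p : integers p E) := by simp
      rw [this]
      have hAp : ahSeries p E ^ p = ahSeries p E ^ (p - 1) * ahSeries p E := by
        rw [← pow_succ, Nat.sub_add_cancel hp.one_le]
      rw [hAp]
      ring
    · rw [Derivation.leibniz, derivative_expSeries, derivative_expand, derivative_ahSeries,
        map_mul, smul_eq_mul, smul_eq_mul]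
      set T := expand p hp.ne_zero (primePowSubOneSeries p fun _ => (1 : integers p E))
      rw [hS, map_one]
      ring
    · rw [map_mul, map_pow, constantCoeff_expand, constantCoeff_ahSeries, constantCoeff_expSeries,
        one_pow, one_mul]
  have h2 := congrArg (evalHom z hz) h
  rw [map_pow, map_mul, evalHom_expand hz _ hzp, ← coe_ahUnit, ← coe_ahUnit, ← coe_expUnit,
    ← Units.val_mul, ← Units.val_pow_eq_pow_val] at h2
  exact Units.ext h2

include hz in
-- L(pX) = Σ p^{p^n - n} X^{p^n}, and p^n - n ≥ 1, so one factor p can be taken out of the whole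
-- exponent.
theorem ahUnit_prime_mul : ahUnit ((p : integers p E) * z) =
    expUnit (evalHom z hz (primePowSeries p fun n => (p : integers p E) ^ (p ^ n - n - 1))) := by
  have hp : p.Prime := Fact.out
  have hpz : absv p E ((p : integers p E) * z : integers p E) < 1 :=
    absv_lt_one_of_dvd hz (dvd_mul_left _ _)
  set f := primePowSeries p fun n => (p : integers p E) ^ (p ^ n - n - 1) with hf
  have hf0 : constantCoeff f = 0 := constantCoeff_primePowSeries _ _
  have h : rescale (p : integers p E) (ahSeries p E) = (expSeries p E).subst f := by
    apply powerSeries_eq_of_derivative_eq_mul (derivative_rescale_ahSeries _)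
    · rw [derivative_expSeries_subst hf0, hf, derivative_primePowSeries,
        ← primePowSubOneSeries_mul_left]
      congr 2
      ext n
      rw [← mul_assoc, ← pow_succ', ← pow_add]
      congr 2
      have := Nat.lt_pow_self (n := n) hp.one_lt
      omega
    · rw [constantCoeff_rescale, constantCoeff_ahSeries, constantCoeff_expSeries_subst hf0]
  have h2 := congrArg (evalHom z hz) h
  rw [evalHom_rescale hz _ hpz, evalHom_subst hz hf0, ← coe_ahUnit, ← coe_expUnit] at h2
  exact Units.ext h2

include hz in
-- L(zy) - L(z) = Σ z^{p^n} (y^{p^n} - 1)/p^n = p Σ c_n z^{p^n}: a principal unit factor in the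
-- argument only contributes values of exp(p ·).
theorem ahUnit_mul {y : integers p E} {c : ℕ → integers p E}
    (hc : ∀ n, y ^ p ^ n = 1 + (p : integers p E) ^ (n + 1) * c n) :
    ahUnit (z * y) = ahUnit z * expUnit (evalHom z hz (primePowSeries p c)) := by
  have hp : p.Prime := Fact.out
  have hzy : absv p E (y * z : integers p E) < 1 := absv_lt_one_of_dvd hz (dvd_mul_left _ _)
  set f := primePowSeries p c with hf
  have hf0 : constantCoeff f = 0 := constantCoeff_primePowSeries _ _
  have h : rescale y (ahSeries p E) = ahSeries p E * (expSeries p E).subst f := by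
    apply powerSeries_eq_of_derivative_eq_mul (derivative_rescale_ahSeries _)
    · rw [Derivation.leibniz, derivative_expSeries_subst hf0, hf, derivative_primePowSeries,
        ← primePowSubOneSeries_mul_left, derivative_ahSeries, smul_eq_mul, smul_eq_mul]
      have : (fun n => y ^ p ^ n) =
          fun n => 1 + (p : integers p E) * ((p : integers p E) ^ n * c n) := by
        ext n
        rw [hc, pow_succ]
        push_cast
        ring
      rw [this, primePowSubOneSeries_add]
      ring
    · rw [map_mul, constantCoeff_rescale, constantCoeff_ahSeries,
        constantCoeff_expSeries_subst hf0, mul_one]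
  have h2 := congrArg (evalHom z hz) h
  rw [evalHom_rescale hz _ hzy, map_mul, evalHom_subst hz hf0, ← coe_ahUnit, ← coe_expUnit,
    ← coe_ahUnit, ← Units.val_mul, mul_comm y z] at h2
  exact Units.ext h2

end SeriesUnits

/-! ### Additivity of a ↦ E([a] z) modulo p-th powers. -/

section Additivity

open PowerSeries

variable {p : ℕ} [Fact p.Prime] {E : Type*} [Field E] [Algebra ℚ_[p] E] [FiniteDimensional ℚ_[p] E]

theorem witt_isUnit_natCast {k : Type*} [Field k] [CharP k p] {n : ℕ}
    (hn : ¬ p ∣ n) : IsUnit (n : WittVector p k) := by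
  apply WittVector.isUnit_of_coeff_zero_ne_zero
  have : (WittVector.constantCoeff (n : WittVector p k) : k) = n := map_natCast _ n
  intro h
  have h2 : (n : k) = 0 := this.symm.trans h
  rw [CharP.cast_eq_zero_iff k p] at h2
  exact hn h2

instance witt_charZero {k : Type*} [Field k] [CharP k p] : CharZero (WittVector p k) := by
  refine charZero_of_inj_zero fun n hn => ?_
  by_contra h0
  obtain ⟨v, m, hm, rfl⟩ := Nat.exists_eq_pow_mul_and_not_dvd h0 p (Fact.out : p.Prime).ne_one
  rw [Nat.cast_mul, Nat.cast_pow] at hn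
  rcases mul_eq_zero.1 hn with h | h
  · exact WittVector.p_nonzero p k (eq_zero_of_pow_eq_zero h)
  · exact (witt_isUnit_natCast (p := p) (k := k) hm).ne_zero h

theorem witt_dvd_iff {k : Type*} [CommRing k] [CharP k p] [PerfectRing k p]
    (x : WittVector p k) : (p : WittVector p k) ∣ x ↔ WittVector.constantCoeff x = 0 := by
  rw [← Ideal.mem_span_singleton, WittVector.mem_span_p_iff_coeff_zero_eq_zero]
  rfl

theorem exists_wittArtinHasse (w : WittVector p (resField p E)) :
    ∃ A : (integers p E)⟦X⟧, constantCoeff A = 1 ∧ derivative _ A = A * primePowSubOneSeries p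
      fun n => wittToIntegers p E (WittVector.frobenius^[n] w) := by
  obtain ⟨A, h0, h1⟩ := exists_twistedArtinHasse (R := WittVector p (resField p E))
    (Fact.out : p.Prime) (fun n hn => witt_isUnit_natCast hn) WittVector.frobenius
    (fun x => by
      rw [witt_dvd_iff, map_sub, map_pow, sub_eq_zero]
      exact WittVector.coeff_frobenius_charP p x 0) w
  refine ⟨PowerSeries.map (wittToIntegers p E) A, ?_, ?_⟩
  · rw [← coeff_zero_eq_constantCoeff_apply, coeff_map, coeff_zero_eq_constantCoeff_apply, h0,
      map_one]
  · rw [derivative_map, h1, map_mul, map_primePowSubOneSeries]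

theorem wittToIntegers_iterate_frobenius_teichmuller (a : resField p E) (n : ℕ) :
    wittToIntegers p E (WittVector.frobenius^[n] (WittVector.teichmuller p a)) =
      teich p E a ^ p ^ n := by
  have h : WittVector.frobenius^[n] (WittVector.teichmuller p a) =
      WittVector.teichmuller p (a ^ p ^ n) := by
    induction n with
    | zero => simp
    | succ n ih =>
      rw [Function.iterate_succ_apply', ih, WittVector.frobenius_eq_map_frobenius,
        WittVector.map_teichmuller, frobenius_def, ← pow_mul, pow_succ]
  rw [h, wittToIntegers_teichmuller, teich_pow]

/-- In the Witt vectors [a] + [b] - [a+b] = p w. The Frobenius conjugates of this identity give the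
exponents, so η is the value of exp(Σ F^n(w) X^{p^n}/p^n), which is integral by the twisted
Artin–Hasse lemma. -/
theorem exists_ahUnit_teich_add {z : integers p E} (hz : absv p E z < 1) (a b : resField p E) :
    ∃ η : (integers p E)ˣ, ahUnit (teich p E a * z) * ahUnit (teich p E b * z) =
      ahUnit (teich p E (a + b) * z) * η ^ p := by
  obtain ⟨w, hw⟩ : (p : WittVector p (resField p E)) ∣ WittVector.teichmuller p a +
      WittVector.teichmuller p b - WittVector.teichmuller p (a + b) := by
    rw [witt_dvd_iff, map_sub, map_add]
    have : ∀ c : resField p E, WittVector.constantCoeff (WittVector.teichmuller p c) = c :=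
      fun c => WittVector.teichmuller_coeff_zero p c
    rw [this, this, this, sub_self]
  obtain ⟨A, hA0, hA⟩ := exists_wittArtinHasse w
  have hlt : ∀ c : resField p E, absv p E (teich p E c * z : integers p E) < 1 := fun c =>
    absv_lt_one_of_dvd hz (dvd_mul_left _ _)
  refine ⟨(isUnit_evalHom hz hA0).unit, ?_⟩
  have hfp : ∀ n : ℕ, WittVector.frobenius^[n] (p : WittVector p (resField p E)) = p := by
    intro n
    induction n with
    | zero => rfl
    | succ n ih => rw [Function.iterate_succ_apply, map_natCast, ih]
  have h : rescale (teich p E a) (ahSeries p E) * rescale (teich p E b) (ahSeries p E) =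
      rescale (teich p E (a + b)) (ahSeries p E) * A ^ p := by
    apply powerSeries_eq_of_derivative_eq_mul (c := primePowSubOneSeries p fun n =>
      teich p E a ^ p ^ n + teich p E b ^ p ^ n)
    · rw [Derivation.leibniz, derivative_rescale_ahSeries, derivative_rescale_ahSeries,
        primePowSubOneSeries_add, smul_eq_mul, smul_eq_mul]
      ring
    · have h1 : (fun n => teich p E a ^ p ^ n + teich p E b ^ p ^ n) = fun n =>
          teich p E (a + b) ^ p ^ n +
            (p : integers p E) * wittToIntegers p E (WittVector.frobenius^[n] w) := by
        ext n
        congr 1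
        have h2 := congrArg (fun x => wittToIntegers p E (WittVector.frobenius^[n] x)) hw
        simp only [iterate_map_sub, iterate_map_add, map_sub, map_add,
          wittToIntegers_iterate_frobenius_teichmuller, iterate_map_mul, map_mul, hfp,
          map_natCast] at h2
        linear_combination h2
      rw [h1, primePowSubOneSeries_add, primePowSubOneSeries_mul_left, Derivation.leibniz,
        derivative_rescale_ahSeries, derivative_pow, hA, smul_eq_mul, smul_eq_mul]
      have : ((p : ℕ) : (integers p E)⟦X⟧) = C (p : integers p E) := by simp
      rw [this]
      have hAp : A ^ p = A ^ (p - 1) * A := by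
        rw [← pow_succ, Nat.sub_add_cancel (Fact.out : p.Prime).one_le]
      rw [hAp]
      ring
    · rw [map_mul, map_mul, constantCoeff_rescale, constantCoeff_rescale, constantCoeff_rescale,
        map_pow, hA0, one_pow, constantCoeff_ahSeries, mul_one]
  have h2 := congrArg (evalHom z hz) h
  rw [map_mul, map_mul, map_pow, evalHom_rescale hz _ (hlt _), evalHom_rescale hz _ (hlt _),
    evalHom_rescale hz _ (hlt _), ← coe_ahUnit, ← coe_ahUnit, ← coe_ahUnit] at h2
  exact Units.ext h2

end Additivity

/-! ### Classes in the units tensored with F. -/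

section UnitClasses

open PowerSeries

variable {p : ℕ} [Fact p.Prime] {E : Type*} [Field E] [Algebra ℚ_[p] E] [FiniteDimensional ℚ_[p] E]
variable (F : Type*) [Field F]

/-- The class of a unit in `𝒪^× ⊗ F`. -/
def cls (u : (integers p E)ˣ) : unitTensor p E F := (1 : F) ⊗ₜ[ℤ] Additive.ofMul u

theorem cls_mul (u v : (integers p E)ˣ) : cls F (u * v) = cls F u + cls F v := by
  rw [cls, ofMul_mul, TensorProduct.tmul_add]
  rfl

theorem cls_pow (u : (integers p E)ˣ) (n : ℕ) : cls F (u ^ n) = (n : F) • cls F u := by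
  induction n with
  | zero => simp [cls]
  | succ n ih => rw [pow_succ, cls_mul, ih, Nat.cast_succ, add_smul, one_smul]

/-- The class of `exp (p z)` in `𝒪^× ⊗ F`. -/
def expCls (z : integers p E) : unitTensor p E F := cls F (expUnit z)

theorem expCls_add {x y : integers p E} (hx : absv p E x < 1) (hy : absv p E y < 1) :
    expCls F (x + y) = expCls F x + expCls F y := by
  rw [expCls, expUnit_add hx hy, cls_mul]
  rfl

theorem absv_add_lt_one {x y : integers p E} (hx : absv p E x < 1) (hy : absv p E y < 1) :
    absv p E (x + y : integers p E) < 1 :=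
  (absv_add_le p (x : E) y).trans_lt (max_lt hx hy)

theorem expCls_zero : expCls F (0 : integers p E) = 0 := by
  have h : absv p E ((0 : integers p E) : E) < 1 := by simp
  have := expCls_add F h h
  rw [add_zero] at this
  exact left_eq_add.1 this

theorem expCls_sum {ι : Type*} (s : Finset ι) (g : ι → integers p E)
    (hg : ∀ i ∈ s, absv p E (g i) < 1) :
    expCls F (∑ i ∈ s, g i) = ∑ i ∈ s, expCls F (g i) := by
  classical
  induction s using Finset.induction with
  | empty => simp [expCls_zero]
  | insert i s hi ih =>
    rw [Finset.sum_insert hi, Finset.sum_insert hi, expCls_add F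
      (hg i (Finset.mem_insert_self _ _)), ih fun j hj => hg j (Finset.mem_insert_of_mem hj)]
    have := Finset.sum_induction g (fun x => absv p E (x : E) < 1)
      (fun _ _ => absv_add_lt_one) (by simp) (s := s)
      fun j hj => hg j (Finset.mem_insert_of_mem hj)
    exact this

theorem absv_mul_lt_one_right {x : integers p E} (y : integers p E) (hx : absv p E x < 1) :
    absv p E (y * x : integers p E) < 1 :=
  absv_lt_one_of_dvd hx (dvd_mul_left _ _)

theorem expCls_natCast_mul {x : integers p E} (hx : absv p E x < 1) (n : ℕ) :
    expCls F ((n : integers p E) * x) = (n : F) • expCls F x := by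
  induction n with
  | zero => simp [expCls_zero]
  | succ n ih =>
    rw [Nat.cast_succ, add_mul, one_mul, expCls_add F (absv_mul_lt_one_right _ hx) hx, ih,
      Nat.cast_succ, add_smul, one_smul]

variable [CharP F p]

theorem cls_pow_prime (u : (integers p E)ˣ) : cls F (u ^ p) = 0 := by
  rw [cls_pow, CharP.cast_eq_zero, zero_smul]

theorem expCls_prime_mul {x : integers p E} (hx : absv p E x < 1) :
    expCls F ((p : integers p E) * x) = 0 := by
  rw [expCls_natCast_mul F hx, CharP.cast_eq_zero, zero_smul]

theorem expCls_eq_zero_of_absv_lt_prime {x : integers p E} (hx : absv p E x < absv p E (p : E)) :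
    expCls F x = 0 := by
  obtain ⟨y, rfl⟩ : (p : integers p E) ∣ x := integers_dvd_iff.2 (by simpa using hx.le)
  apply expCls_prime_mul
  rw [MulMemClass.coe_mul, absv_mul] at hx
  have h := absv_natCast_prime_pos p E
  exact lt_of_mul_lt_mul_left (by simpa using hx) h.le

theorem expCls_congr {x y d : integers p E} (hx : absv p E x < 1) (hd : absv p E d < 1)
    (h : y = x + (p : integers p E) * d) : expCls F y = expCls F x := by
  rw [h, expCls_add F hx (absv_mul_lt_one_right _ hd), expCls_prime_mul F hd, add_zero]

theorem expCls_eq_neg {z : integers p E} (hz : absv p E z < 1) :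
    expCls F z = -cls F (ahUnit (z ^ p)) := by
  have h := congrArg (cls F) (ahUnit_pow hz)
  rw [cls_pow_prime, cls_mul] at h
  rw [eq_neg_iff_add_eq_zero, h, add_comm]
  rfl

/-- In the expansion of E(pz) the exponent p^n - n - 1 of p is 0 for n = 0, p - 2 for n = 1, and
positive for n ≥ 2, where the terms become p-th powers. The coefficient p^{p-2} is nonzero in F only
for p = 2. -/
theorem cls_ahUnit_prime_mul {z : integers p E} (hz : absv p E z < 1) :
    cls F (ahUnit ((p : integers p E) * z)) =
      expCls F z + ((p ^ (p - 2) : ℕ) : F) • expCls F (z ^ p) := by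
  have hp : p.Prime := Fact.out
  have h2 := hp.two_le
  have hzp : absv p E (z ^ p : integers p E) < 1 :=
    absv_lt_one_of_dvd hz (dvd_pow_self z hp.ne_zero)
  have hzpp : absv p E ((z ^ p) ^ p : integers p E) < 1 :=
    absv_lt_one_of_dvd hzp (dvd_pow_self _ hp.ne_zero)
  have h : evalHom z hz (primePowSeries p fun n => (p : integers p E) ^ (p ^ n - n - 1)) =
      (z + ((p ^ (p - 2) : ℕ) : integers p E) * z ^ p) + (p : integers p E) *
        evalHom _ hzpp (primePowSeries p fun n => (p : integers p E) ^ (p ^ (n + 2) - n - 4)) := by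
    have e3 : (primePowSeries p fun n => (p : integers p E) ^ (p ^ (n + 1 + 1) - (n + 1 + 1) - 1)) =
        C (p : integers p E) *
          primePowSeries p fun n => (p : integers p E) ^ (p ^ (n + 2) - n - 4) := by
      ext1 m
      simp only [primePowSeries, coeff_C_mul, coeff_mk]
      split_ifs
      · rw [← pow_succ']
        congr 1
        generalize Nat.log p m = k
        have h5 : 2 ^ (k + 2) ≤ p ^ (k + 2) := Nat.pow_le_pow_left h2 _
        have h6 : k < 2 ^ k := Nat.lt_two_pow_self
        have h7 : 2 ^ (k + 2) = 4 * 2 ^ k := by rw [pow_add]; ring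
        rw [show k + 1 + 1 = k + 2 from rfl]
        omega
      · rw [mul_zero]
    rw [primePowSeries_eq hp, map_add, map_mul, evalHom_C, evalHom_X, evalHom_expand hz _ hzp,
      primePowSeries_eq hp, map_add, map_mul, evalHom_C, evalHom_X, evalHom_expand hzp _ hzpp, e3,
      map_mul, evalHom_C]
    have e0 : p ^ 0 - 0 - 1 = 0 := by simp
    have e1 : p ^ (0 + 1) - (0 + 1) - 1 = p - 2 := by rw [zero_add, pow_one]; omega
    rw [e0, e1, pow_zero, one_mul]
    push_cast
    ring
  have hr : absv p E (evalHom _ hzpp (primePowSeries p fun n =>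
      (p : integers p E) ^ (p ^ (n + 2) - n - 4)) : integers p E) < 1 :=
    absv_lt_one_of_dvd hzpp (dvd_evalHom hzpp (constantCoeff_primePowSeries _ _))
  rw [ahUnit_prime_mul hz]
  change expCls F _ = _
  rw [expCls_congr F (absv_add_lt_one hz (absv_mul_lt_one_right _ hzp)) hr h,
    expCls_add F hz (absv_mul_lt_one_right _ hzp), expCls_natCast_mul F hzp]

/-- Units close to `1` are `p`-th powers. -/
theorem expCls_eq_zero {x : integers p E} (hx : absv p E x ^ (p - 1) < absv p E (p : E)) :
    expCls F x = 0 := by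
  have hp : p.Prime := Fact.out
  have hp1 : p - 1 ≠ 0 := by have := hp.two_le; omega
  have hP := absv_natCast_prime_pos p E
  have hP1 := absv_natCast_prime_lt_one p E
  obtain ⟨c, hc0, hc1, hc⟩ : ∃ c : ℝ, 0 < c ∧ c < 1 ∧
      absv p E x ^ (p - 1) ≤ c * absv p E (p : E) := by
    -- The contraction factor; the maximum with 1/2 keeps it positive when x = 0.
    refine ⟨max (absv p E x ^ (p - 1) / absv p E (p : E)) (1 / 2), ?_, ?_, ?_⟩
    · exact lt_max_of_lt_right (by norm_num)
    · exact max_lt ((div_lt_one hP).2 hx) (by norm_num)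
    · rw [← div_le_iff₀ hP]
      exact le_max_left _ _
  -- The class of exp(px) is minus that of E(x^p); writing x^p = p y turns it into the classes of
  -- exp(py) and exp(p y^p), with |y| ≤ c |x|. After k such steps the argument is smaller than p,
  -- where exp(p ·) is visibly a p-th power.
  have key : ∀ k : ℕ, ∀ x : integers p E, absv p E x ^ (p - 1) ≤ c * absv p E (p : E) →
      absv p E x * c ^ k < absv p E (p : E) → expCls F x = 0 := by
    intro k
    induction k with
    | zero =>
      intro x _ h
      exact expCls_eq_zero_of_absv_lt_prime F (by simpa using h)
    | succ k ih =>
      intro x h1 h2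
      have hx1 : absv p E x < 1 := by
        by_contra! h
        have h3 : (1 : ℝ) ≤ absv p E x ^ (p - 1) := one_le_pow₀ h
        nlinarith
      have hpow : absv p E (x : E) ^ p = absv p E x ^ (p - 1) * absv p E x := by
        rw [← pow_succ, Nat.sub_add_cancel hp.one_le]
      have hx0 := absv_nonneg p (x : E)
      obtain ⟨y, hy⟩ : (p : integers p E) ∣ x ^ p := by
        rw [integers_dvd_iff, SubmonoidClass.coe_pow, absv_pow, hpow]
        have h4 : absv p E x ^ (p - 1) ≤ absv p E (p : E) := h1.trans (by nlinarith)
        calc _ ≤ absv p E (p : E) * 1 := by gcongr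
          _ = _ := by simp
      have hyabs : absv p E (p : E) * absv p E (y : E) = absv p E x ^ (p - 1) * absv p E x := by
        rw [← hpow, ← absv_pow, ← absv_mul]
        congr 1
        simpa using (congrArg Subtype.val hy).symm
      have hy0 := absv_nonneg p (y : E)
      have hyx : absv p E (y : E) ≤ c * absv p E x := by
        have : absv p E (p : E) * absv p E (y : E) ≤ absv p E (p : E) * (c * absv p E x) := by
          rw [hyabs]
          nlinarith
        exact le_of_mul_le_mul_left this hP
      have hyx' : absv p E (y : E) ≤ absv p E x := hyx.trans (by nlinarith)
      have hy1 : absv p E (y : E) < 1 := hyx'.trans_lt hx1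
      have hmono : ∀ w : integers p E, absv p E w ≤ absv p E (y : E) → expCls F w = 0 := by
        intro w hw
        have hw0 := absv_nonneg p (w : E)
        refine ih w ((pow_le_pow_left₀ hw0 (hw.trans hyx') _).trans h1) (lt_of_le_of_lt ?_ h2)
        calc absv p E (w : E) * c ^ k ≤ (c * absv p E x) * c ^ k := by
              gcongr
              exact hw.trans hyx
          _ = _ := by rw [pow_succ]; ring
      rw [expCls_eq_neg F hx1, hy, cls_ahUnit_prime_mul F hy1, hmono y le_rfl, hmono (y ^ p) ?_]
      · simp
      · rw [SubmonoidClass.coe_pow, absv_pow]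
        exact pow_le_of_le_one hy0 hy1.le hp.ne_zero
  obtain ⟨k, hk⟩ := exists_pow_lt_of_lt_one hP hc1
  refine key k x hc (lt_of_le_of_lt ?_ hk)
  exact mul_le_of_le_one_left (by positivity) x.2

/-- The tail beyond n has absolute value less than |p| and contributes a p-th power. -/
theorem expCls_evalHom_primePowSeries {z : integers p E} (hz : absv p E z < 1)
    (c : ℕ → integers p E) {n : ℕ} (hn : absv p E (z ^ p ^ n : integers p E) < absv p E (p : E)) :
    expCls F (evalHom z hz (primePowSeries p c)) =
      ∑ k ∈ Finset.range n, expCls F (c k * z ^ p ^ k) := by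
  have hlt : ∀ k, absv p E (c k * z ^ p ^ k : integers p E) < 1 := fun k =>
    absv_mul_lt_one_right _ (absv_lt_one_of_dvd hz
      (dvd_pow_self z (pow_ne_zero _ (Fact.out : p.Prime).ne_zero)))
  have h1 := (integers_dvd_iff.1 (pow_dvd_evalHom_primePowSeries_sub hz c n)).trans_lt hn
  have h2 : evalHom z hz (primePowSeries p c) = ∑ k ∈ Finset.range n, c k * z ^ p ^ k +
      (evalHom z hz (primePowSeries p c) - ∑ k ∈ Finset.range n, c k * z ^ p ^ k) := by ring
  rw [h2, expCls_add F, expCls_eq_zero_of_absv_lt_prime F h1, add_zero, expCls_sum F]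
  · exact fun k _ => hlt k
  · exact Finset.sum_induction _ (fun x : integers p E => absv p E (x : E) < 1)
      (fun _ _ => absv_add_lt_one) (by simp) fun k _ => hlt k
  · exact h1.trans (absv_natCast_prime_lt_one p E)

end UnitClasses

/-! ### Linear extensions to l ⊗ F of E([a] z) and exp(p [a] z). -/

section TensorExtension

variable {p : ℕ} [Fact p.Prime] {E : Type*} [Field E] [Algebra ℚ_[p] E] [FiniteDimensional ℚ_[p] E]
variable {F : Type*} [Field F]

/-- Two `F`-linear maps on `F ⊗ l` agreeing on the elements `1 ⊗ a` are equal. -/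
theorem resTensor_ext {V : Type*} [AddCommGroup V] [Module F V] {g h : resTensor p E F →ₗ[F] V}
    (H : ∀ a : resField p E, g ((1 : F) ⊗ₜ a) = h ((1 : F) ⊗ₜ a)) : g = h := by
  refine LinearMap.ext fun x => ?_
  induction x using TensorProduct.induction_on with
  | zero => simp
  | tmul b a =>
    have : b ⊗ₜ[ℤ] a = b • ((1 : F) ⊗ₜ[ℤ] a) := by rw [TensorProduct.smul_tmul', smul_eq_mul, mul_one]
    rw [this, map_smul, map_smul, H]
  | add x y hx hy => rw [map_add, map_add, hx, hy]

/-- The `F`-linear extension to `F ⊗ l` of an additive map on `l`. -/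
def linExt {V : Type*} [AddCommGroup V] [Module F V] (ψ : resField p E →+ V) :
    resTensor p E F →ₗ[F] V :=
  TensorProduct.AlgebraTensorModule.lift
    ((LinearMap.lsmul F (resField p E →ₗ[ℤ] V)).flip ψ.toIntLinearMap)

@[simp] theorem linExt_one_tmul {V : Type*} [AddCommGroup V] [Module F V] (ψ : resField p E →+ V)
    (a : resField p E) : linExt ψ ((1 : F) ⊗ₜ[ℤ] a) = ψ a := by
  simp [linExt]

variable (F) in
/-- The map on `F ⊗ l` induced by an additive map on `l`. -/
def tensorMap (h : resField p E →+ resField p E) : resTensor p E F →ₗ[F] resTensor p E F :=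
  TensorProduct.AlgebraTensorModule.map LinearMap.id h.toIntLinearMap

@[simp] theorem tensorMap_tmul (h : resField p E →+ resField p E) (b : F) (a : resField p E) :
    tensorMap F h (b ⊗ₜ[ℤ] a) = b ⊗ₜ[ℤ] h a := rfl

theorem tensorMap_tensorMap (h h' : resField p E →+ resField p E) (x : resTensor p E F) :
    tensorMap F h (tensorMap F h' x) = tensorMap F (h.comp h') x :=
  LinearMap.congr_fun (resTensor_ext (g := (tensorMap F h).comp (tensorMap F h'))
    (h := tensorMap F (h.comp h')) fun _ => rfl) x

theorem tensorMap_comm {h₁ h₂ h₃ h₄ : resField p E →+ resField p E}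
    (H : ∀ a, h₁ (h₂ a) = h₃ (h₄ a)) (x : resTensor p E F) :
    tensorMap F h₁ (tensorMap F h₂ x) = tensorMap F h₃ (tensorMap F h₄ x) := by
  rw [tensorMap_tensorMap, tensorMap_tensorMap]
  congr 2
  exact AddMonoidHom.ext H

theorem tensorMap_eq_self {h : resField p E →+ resField p E} (H : ∀ a, h a = a)
    (x : resTensor p E F) : tensorMap F h x = x :=
  LinearMap.congr_fun (resTensor_ext (h := LinearMap.id) fun a => by
    rw [tensorMap_tmul, H, LinearMap.id_apply]) x

variable (F) in
/-- Multiplication by `1 ⊗ v` on `F ⊗ l`. -/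
abbrev mulTensor (v : resField p E) : resTensor p E F →ₗ[F] resTensor p E F :=
  tensorMap F (AddMonoidHom.mulLeft v)

theorem one_tmul_mul_eq (v : resField p E) (x : resTensor p E F) :
    ((1 : F) ⊗ₜ[ℤ] v) * x = mulTensor F v x := by
  induction x using TensorProduct.induction_on with
  | zero => rw [mul_zero, map_zero]
  | tmul b a => rw [tensorMap_tmul, Algebra.TensorProduct.tmul_mul_tmul, one_mul]; rfl
  | add x y hx hy => rw [mul_add, map_add, hx, hy]

variable (p E F) in
/-- The Frobenius of `l` acting on `F ⊗ l`. -/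
abbrev frobTensor : resTensor p E F →ₗ[F] resTensor p E F :=
  tensorMap F (frobenius (resField p E) p).toAddMonoidHom

theorem frobTensor_one_tmul (a : resField p E) :
    frobTensor p E F ((1 : F) ⊗ₜ[ℤ] a) = (1 : F) ⊗ₜ[ℤ] (a ^ p) := rfl

theorem frobTensor_iterate_one_tmul (a : resField p E) (k : ℕ) :
    (frobTensor p E F)^[k] ((1 : F) ⊗ₜ[ℤ] a) = (1 : F) ⊗ₜ[ℤ] (a ^ p ^ k) := by
  induction k with
  | zero => simp
  | succ k ih => rw [Function.iterate_succ_apply', ih, frobTensor_one_tmul, pow_succ, pow_mul]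

variable [CharP F p]

open Classical in
variable (F) in
/-- The linear extension of `a ↦ exp (p [a] z)`. -/
def expLin (z : integers p E) : resTensor p E F →ₗ[F] unitTensor p E F :=
  if hz : absv p E z < 1 then
    linExt
      { toFun := fun a => expCls F (teich p E a * z)
        map_zero' := by rw [teich_zero, zero_mul, expCls_zero]
        map_add' := fun a b => by
          -- Additivity: [a+b] and [a] + [b] agree mod p, and changing the argument of exp(p ·) by a
          -- multiple p x with |x| < 1 changes the value by a p-th power.
          obtain ⟨d, hd⟩ := dvd_teich_add_sub a b
          rw [← expCls_add F (absv_mul_lt_one_right _ hz) (absv_mul_lt_one_right _ hz)]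
          refine expCls_congr F (d := d * z) (absv_add_lt_one (absv_mul_lt_one_right _ hz)
            (absv_mul_lt_one_right _ hz)) (absv_mul_lt_one_right _ hz) ?_
          linear_combination z * hd }
  else 0

open Classical in
variable (F) in
/-- The linear extension of `a ↦ E([a] z)`. -/
def epsLin (z : integers p E) : resTensor p E F →ₗ[F] unitTensor p E F :=
  if hz : absv p E z < 1 then
    linExt
      { toFun := fun a => cls F (ahUnit (teich p E a * z))
        map_zero' := by
          obtain ⟨η, h⟩ := exists_ahUnit_teich_add hz (0 : resField p E) 0
          have h2 := congrArg (cls F) h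
          rw [cls_mul, cls_mul, cls_pow_prime, add_zero, add_zero] at h2
          exact left_eq_add.1 h2.symm
        map_add' := fun a b => by
          obtain ⟨η, h⟩ := exists_ahUnit_teich_add hz a b
          have h2 := congrArg (cls F) h
          rw [cls_mul, cls_mul, cls_pow_prime, add_zero] at h2
          exact h2.symm }
  else 0

variable {z : integers p E} (hz : absv p E z < 1)
include hz

theorem expLin_one_tmul (a : resField p E) :
    expLin F z ((1 : F) ⊗ₜ[ℤ] a) = expCls F (teich p E a * z) := by
  rw [expLin, dif_pos hz]
  simp

theorem epsLin_one_tmul (a : resField p E) :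
    epsLin F z ((1 : F) ⊗ₜ[ℤ] a) = cls F (ahUnit (teich p E a * z)) := by
  rw [epsLin, dif_pos hz]
  simp

/-- The span of the generators is the full graph of a linear map; this existence and uniqueness give
`eps` its intended value. -/
theorem mem_epsGraph_iff (x : resTensor p E F) (u : unitTensor p E F) :
    (x, u) ∈ epsGraph p E F (z : E) ↔ u = epsLin F z x := by
  have hval : ∀ a : resField p E, (1 : F) ⊗ₜ[ℤ] Additive.ofMul
      (ahValue p E ((teich p E a : E) * (z : E))) = epsLin F z ((1 : F) ⊗ₜ[ℤ] a) := fun a => by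
    rw [epsLin_one_tmul hz, cls, ← ahValue_eq_ahUnit (absv_mul_lt_one_right _ hz)]
    rfl
  constructor
  · intro h
    have hle : epsGraph p E F (z : E) ≤ (epsLin F z).graph := by
      rw [epsGraph, Submodule.span_le]
      rintro _ ⟨a, rfl⟩
      exact (LinearMap.mem_graph_iff (f := epsLin F z) _).2 (hval a)
    exact (LinearMap.mem_graph_iff (f := epsLin F z) _).1 (hle h)
  · rintro rfl
    induction x using TensorProduct.induction_on with
    | zero => rw [map_zero]; exact zero_mem _
    | tmul b a =>
      have : b ⊗ₜ[ℤ] a = b • ((1 : F) ⊗ₜ[ℤ] a) := by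
        rw [TensorProduct.smul_tmul', smul_eq_mul, mul_one]
      rw [this, map_smul, ← Prod.smul_mk]
      apply Submodule.smul_mem
      rw [← hval]
      exact Submodule.subset_span ⟨a, rfl⟩
    | add x y hx hy => rw [map_add, ← Prod.mk_add_mk]; exact add_mem hx hy

theorem eps_eq_epsLin (x : resTensor p E F) : eps p E F (z : E) x = epsLin F z x := by
  have h : ∃ u, (x, u) ∈ epsGraph p E F (z : E) := ⟨_, (mem_epsGraph_iff hz x _).2 rfl⟩
  exact (mem_epsGraph_iff hz x _).1 (Classical.epsilon_spec h)

theorem absv_pow_lt_one {n : ℕ} (hn : n ≠ 0) : absv p E (z ^ n : integers p E) < 1 :=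
  absv_lt_one_of_dvd hz (dvd_pow_self z hn)

theorem absv_pow_prime_pow_lt_one (n : ℕ) : absv p E (z ^ p ^ n : integers p E) < 1 :=
  absv_pow_lt_one hz (pow_ne_zero _ (Fact.out : p.Prime).ne_zero)

theorem epsLin_pow_frobTensor (x : resTensor p E F) :
    epsLin F (z ^ p) (frobTensor p E F x) = -expLin F z x := by
  have : (epsLin F (z ^ p)).comp (frobTensor p E F) = -expLin F z :=
    resTensor_ext fun a => by
      simp only [LinearMap.comp_apply, frobTensor_one_tmul,
        LinearMap.neg_apply]
      rw [epsLin_one_tmul (absv_pow_lt_one hz (Fact.out : p.Prime).ne_zero), expLin_one_tmul hz,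
        expCls_eq_neg F (absv_mul_lt_one_right _ hz), neg_neg, teich_pow, mul_pow]
  exact LinearMap.congr_fun this x

theorem epsLin_prime_mul (x : resTensor p E F) :
    epsLin F ((p : integers p E) * z) x =
      expLin F z x + ((p ^ (p - 2) : ℕ) : F) • expLin F (z ^ p) (frobTensor p E F x) := by
  have : epsLin F ((p : integers p E) * z) = expLin F z +
      ((p ^ (p - 2) : ℕ) : F) • (expLin F (z ^ p)).comp (frobTensor p E F) :=
    resTensor_ext fun a => by
      simp only [LinearMap.comp_apply, frobTensor_one_tmul,
        LinearMap.add_apply, LinearMap.smul_apply]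
      rw [epsLin_one_tmul (absv_mul_lt_one_right _ hz), expLin_one_tmul hz,
        expLin_one_tmul (absv_pow_lt_one hz (Fact.out : p.Prime).ne_zero), mul_left_comm,
        cls_ahUnit_prime_mul F (absv_mul_lt_one_right _ hz), teich_pow, mul_pow]
  exact LinearMap.congr_fun this x

theorem epsLin_teich_mul (v : resField p E) (x : resTensor p E F) :
    epsLin F (teich p E v * z) x = epsLin F z (mulTensor F v x) := by
  have : epsLin F (teich p E v * z) =
      (epsLin F z).comp (mulTensor F v) :=
    resTensor_ext fun a => by
      simp only [LinearMap.comp_apply, tensorMap_tmul, AddMonoidHom.coe_mulLeft]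
      rw [epsLin_one_tmul (absv_mul_lt_one_right _ hz), epsLin_one_tmul hz, teich_mul, ← mul_assoc,
        mul_comm (teich p E a)]
  exact LinearMap.congr_fun this x

theorem expLin_teich_mul (v : resField p E) (x : resTensor p E F) :
    expLin F (teich p E v * z) x = expLin F z (mulTensor F v x) := by
  have : expLin F (teich p E v * z) =
      (expLin F z).comp (mulTensor F v) :=
    resTensor_ext fun a => by
      simp only [LinearMap.comp_apply, tensorMap_tmul, AddMonoidHom.coe_mulLeft]
      rw [expLin_one_tmul (absv_mul_lt_one_right _ hz), expLin_one_tmul hz, teich_mul, ← mul_assoc,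
        mul_comm (teich p E a)]
  exact LinearMap.congr_fun this x

theorem expLin_congr {w d : integers p E} (hd : absv p E d < 1)
    (h : w = z + (p : integers p E) * d) : expLin F w = expLin F z := by
  have hw : absv p E w < 1 := by
    rw [h]
    exact absv_add_lt_one hz (absv_mul_lt_one_right _ hd)
  refine resTensor_ext fun a => ?_
  rw [expLin_one_tmul hw, expLin_one_tmul hz]
  refine expCls_congr F (d := teich p E a * d) (absv_mul_lt_one_right _ hz)
    (absv_mul_lt_one_right _ hd) ?_
  rw [h]
  ring

theorem expLin_eq_zero (h : absv p E z ^ (p - 1) < absv p E (p : E)) : expLin F z = 0 := by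
  refine resTensor_ext fun a => ?_
  rw [expLin_one_tmul hz, expCls_eq_zero F, LinearMap.zero_apply]
  refine lt_of_le_of_lt (pow_le_pow_left₀ (absv_nonneg p _) ?_ _) h
  rw [MulMemClass.coe_mul, absv_mul]
  exact mul_le_of_le_one_left (absv_nonneg p _) (teich p E a).2

/-- The coefficients c_k matter only mod p and may be replaced by Teichmüller lifts. The k-th term
then involves [a]^{p^k}, that is, the k-th iterate of Frobenius on l. -/
theorem epsLin_mul {y : integers p E} {c : ℕ → integers p E} {ζ : ℕ → resField p E}
    (hy : ∀ n, y ^ p ^ n = 1 + (p : integers p E) ^ (n + 1) * c n)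
    (hc : ∀ n, (p : integers p E) ∣ c n - teich p E (ζ n)) {n : ℕ}
    (hn : absv p E (z ^ p ^ n : integers p E) < absv p E (p : E)) (x : resTensor p E F) :
    epsLin F (z * y) x = epsLin F z x + ∑ k ∈ Finset.range n,
      expLin F (z ^ p ^ k) (mulTensor F (ζ k) ((frobTensor p E F)^[k] x)) := by
  have hzy : absv p E (z * y : integers p E) < 1 := absv_lt_one_of_dvd hz (dvd_mul_right _ _)
  have : epsLin F (z * y) = epsLin F z + ∑ k ∈ Finset.range n,
      (expLin F (z ^ p ^ k)).comp ((mulTensor F (ζ k)).comp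
        (frobTensor p E F ^ k)) :=
    resTensor_ext fun a => by
      simp only [LinearMap.add_apply, LinearMap.sum_apply, LinearMap.comp_apply,
        Module.End.pow_apply]
      have hlt : absv p E (teich p E a * z : integers p E) < 1 := absv_mul_lt_one_right _ hz
      rw [epsLin_one_tmul hzy, epsLin_one_tmul hz, ← mul_assoc, ahUnit_mul hlt hy, cls_mul]
      congr 1
      change expCls F _ = _
      rw [expCls_evalHom_primePowSeries F hlt c (n := n)]
      · refine Finset.sum_congr rfl fun k _ => ?_
        have hk := absv_pow_prime_pow_lt_one hz k
        rw [frobTensor_iterate_one_tmul, tensorMap_tmul,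
          AddMonoidHom.coe_mulLeft, expLin_one_tmul hk, teich_mul, teich_pow]
        obtain ⟨d, hd⟩ := hc k
        refine expCls_congr F (d := d * teich p E a ^ p ^ k * z ^ p ^ k)
          (absv_mul_lt_one_right _ hk) (absv_mul_lt_one_right _ hk) ?_
        rw [mul_pow]
        linear_combination (teich p E a ^ p ^ k * z ^ p ^ k) * hd
      · refine lt_of_le_of_lt ?_ hn
        rw [mul_pow, MulMemClass.coe_mul, absv_mul]
        exact mul_le_of_le_one_left (absv_nonneg p _) (teich p E a ^ p ^ n).2
  have h := LinearMap.congr_fun this x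
  simpa [Module.End.pow_apply] using h

end TensorExtension

/-! ### Unramified extensions of the p-adic numbers. -/

section UnramifiedOverPadic

variable {p : ℕ} [Fact p.Prime] {E : Type*} [Field E] [Algebra ℚ_[p] E]

theorem absv_algebraMap_padic (x : ℚ_[p]) : absv p E (algebraMap ℚ_[p] E x) = ‖x‖ :=
  spectralNorm_extends x

theorem padic_norm_le_of_lt_one {x : ℚ_[p]} (hx : ‖x‖ < 1) : ‖x‖ ≤ (p : ℝ)⁻¹ := by
  have h := (PadicInt.norm_le_pow_iff_norm_lt_pow_add_one (p := p) ⟨x, hx.le⟩ (-1)).2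
    (by simpa using hx)
  simpa using h

theorem isUniformizer_prime_of_isUnramified (h : IsUnramified p ℚ_[p] E) :
    IsUniformizer p (p : E) := by
  refine ⟨natCast_prime_ne_zero p E, absv_natCast_prime_lt_one p E, fun y hy => ?_⟩
  obtain ⟨x, hx⟩ := h y
  rw [absv_algebraMap_padic] at hx
  rw [hx, absv_natCast_prime]
  exact padic_norm_le_of_lt_one (hx ▸ hy)

variable [FiniteDimensional ℚ_[p] E]

theorem exists_eq_teich_add (h : IsUniformizer p (p : E)) (x : integers p E) :
    ∃ y : integers p E, x = teich p E (residue _ x) + (p : integers p E) * y := by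
  have h1 : absv p E (x - teich p E (residue _ x) : integers p E) < 1 := by
    rw [← residue_eq_zero_iff_absv_lt, map_sub, residue_teich, sub_self]
  obtain ⟨y, hy⟩ : (p : integers p E) ∣ x - teich p E (residue _ x) :=
    integers_dvd_iff.2 (by simpa using h.2.2 _ h1)
  exact ⟨y, by rw [← hy]; ring⟩

theorem prime_dvd_of_residue_eq_zero (h : IsUniformizer p (p : E)) {x : integers p E}
    (hx : residue _ x = 0) : (p : integers p E) ∣ x :=
  integers_dvd_iff.2 (by simpa using h.2.2 _ (residue_eq_zero_iff_absv_lt.1 hx))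

/-- Reduction of linear relations gives one inequality. For the other, the span of Teichmüller lifts
of a basis of the residue field approximates every integer by powers of p; being finite-dimensional
it is closed, so it is all of E. -/
theorem card_resField (h : IsUniformizer p (p : E)) :
    Nat.card (resField p E) = p ^ Module.finrank ℚ_[p] E := by
  have hfin : Module.Finite (ZMod p) (resField p E) := Module.Finite.of_finite
  rw [Module.natCard_eq_pow_finrank (K := ZMod p), Nat.card_zmod]
  congr 1
  refine le_antisymm ?_ ?_
  · have := rank_resField_le p E
    rw [← Module.finrank_eq_rank] at this
    exact_mod_cast this
  let v := Module.finBasis (ZMod p) (resField p E)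
  let S : Submodule ℚ_[p] E := Submodule.span ℚ_[p] (Set.range fun i => (teich p E (v i) : E))
  have hS : Module.finrank ℚ_[p] S ≤ Module.finrank (ZMod p) (resField p E) :=
    (finrank_range_le_card _).trans (by simp)
  suffices htop : S = ⊤ by rwa [htop, finrank_top] at hS
  have hstep : ∀ y : integers p E, ∃ s ∈ S, ∃ z : integers p E,
      (y : E) = s + (p : E) * z := by
    intro y
    let s : integers p E := ∑ i, ((v.repr (residue _ y) i).val : integers p E) * teich p E (v i)
    obtain ⟨z, hz⟩ := prime_dvd_of_residue_eq_zero h (x := y - s) (by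
      rw [map_sub, sub_eq_zero, map_sum]
      conv_lhs => rw [← v.sum_repr (residue _ y)]
      refine Finset.sum_congr rfl fun i _ => ?_
      rw [map_mul, map_natCast, residue_teich, Algebra.smul_def]
      congr 1
      conv_lhs => rw [← ZMod.natCast_zmod_val (v.repr (residue _ y) i)]
      exact map_natCast _ _)
    refine ⟨s, ?_, z, ?_⟩
    · have : (s : E) = ∑ i, ((v.repr (residue _ y) i).val : ℚ_[p]) • (teich p E (v i) : E) := by
        simp [s, Algebra.smul_def, -ZMod.natCast_val]
      rw [this]
      exact Submodule.sum_mem _ fun i _ => Submodule.smul_mem _ _ (Submodule.subset_span ⟨i, rfl⟩)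
    · have := congrArg Subtype.val hz
      push_cast at this
      linear_combination this
  have happrox : ∀ (n : ℕ) (y : integers p E), ∃ s ∈ S, absv p E ((y : E) - s) ≤
      (p : ℝ)⁻¹ ^ n := by
    intro n
    induction n with
    | zero => exact fun y => ⟨0, zero_mem _, by simpa using integers_absv_le y⟩
    | succ n ih =>
      intro y
      obtain ⟨s, hs, z, hz⟩ := hstep y
      obtain ⟨t, ht, hzt⟩ := ih z
      refine ⟨s + (p : ℚ_[p]) • t, add_mem hs (S.smul_mem _ ht), ?_⟩
      have : (y : E) - (s + (p : ℚ_[p]) • t) = p * (z - t) := by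
        rw [hz, Algebra.smul_def, map_natCast]
        ring
      rw [this, absv_mul, absv_natCast_prime, pow_succ']
      gcongr
  let : NormedField E := spectralNorm.normedField ℚ_[p] E
  let : NormedSpace ℚ_[p] E := spectralNorm.normedSpace ℚ_[p] E
  have hclosed : IsClosed (S : Set E) := S.closed_of_finiteDimensional
  have hp1 : (p : ℝ)⁻¹ < 1 :=
    inv_lt_one_of_one_lt₀ (by exact_mod_cast (Fact.out : p.Prime).one_lt)
  have hint : ∀ y : integers p E, (y : E) ∈ S := by
    intro y
    have : (y : E) ∈ closure (S : Set E) := by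
      rw [Metric.mem_closure_iff]
      intro ε hε
      obtain ⟨n, hn⟩ := exists_pow_lt_of_lt_one hε hp1
      obtain ⟨s, hs, h⟩ := happrox n y
      refine ⟨s, hs, ?_⟩
      rw [dist_eq_norm]
      exact h.trans_lt hn
    rwa [hclosed.closure_eq] at this
  rw [eq_top_iff]
  rintro x -
  obtain ⟨n, hn⟩ := pow_unbounded_of_one_lt (absv p E x)
    (show (1 : ℝ) < p by exact_mod_cast (Fact.out : p.Prime).one_lt)
  have hx : absv p E ((p : E) ^ n * x) ≤ 1 := by
    rw [absv_mul, absv_pow, absv_natCast_prime, inv_pow]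
    rw [inv_mul_le_one₀ (by have := (Fact.out : p.Prime).pos; positivity)]
    exact hn.le
  have := hint ⟨_, hx⟩
  have h2 := S.smul_mem ((p : ℚ_[p]) ^ n)⁻¹ this
  rwa [Algebra.smul_def, map_inv₀, map_pow, map_natCast,
    inv_mul_cancel_left₀ (pow_ne_zero _ (natCast_prime_ne_zero p E))] at h2

end UnramifiedOverPadic

/-! ### Teichmüller lifts under embeddings. -/

section BaseChange

variable {p : ℕ} [Fact p.Prime] {K : Type*} [Field K] [Algebra ℚ_[p] K] [FiniteDimensional ℚ_[p] K]
  {E : Type*} [Field E] [Algebra ℚ_[p] E]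

theorem resMap_residue [Algebra.IsAlgebraic ℚ_[p] E] (φ : K →ₐ[ℚ_[p]] E) (x : integers p K) :
    resMap p φ (residue _ x) = residue _ (intMap p φ x) := rfl

theorem intMap_teich [FiniteDimensional ℚ_[p] E] (φ : K →ₐ[ℚ_[p]] E) (c : resField p K) :
    intMap p φ (teich p K c) = teich p E (resMap p φ c) := by
  obtain ⟨m, hm, h⟩ := (teich_spec c).2
  refine (teich_eq ?_ hm ?_).symm
  · rw [← resMap_residue, residue_teich]
  · rw [← map_pow, h]

theorem teich_injective : Function.Injective (teich p K) := fun a b h => by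
  rw [← residue_teich a, h, residue_teich]

/-- All roots of unity of order prime to `p` dividing `|k^×|` are Teichmüller lifts from `K`. -/
theorem exists_eq_teich_of_pow_eq_one (φ : K →ₐ[ℚ_[p]] E) {z : E}
    (hz : z ^ (Nat.card (resField p K) - 1) = 1) :
    ∃ c : resField p K, c ≠ 0 ∧ z = φ (teich p K c) := by
  classical
  obtain ⟨g, hg⟩ := IsCyclic.exists_generator (α := (resField p K)ˣ)
  have hcard : orderOf g = Nat.card (resField p K) - 1 := by
    rw [orderOf_eq_card_of_forall_mem_zpowers hg, Nat.card_units]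
  have hpos : 0 < Nat.card (resField p K) - 1 := by rw [← hcard]; exact orderOf_pos g
  let ι : (resField p K)ˣ →* E :=
    ((φ : K →* E).comp ((integers p K).subtype : integers p K →* K)).comp
      ((teichHom p K : resField p K →* integers p K).comp (Units.coeHom _))
  have hι : Function.Injective ι := fun a b h =>
    Units.ext (teich_injective (Subtype.ext (φ.injective h)))
  -- The lift of a generator of the residue field's unit group is a primitive root of unity of full
  -- order, so its powers exhaust the solutions in E.
  have hprim : IsPrimitiveRoot (ι g) (Nat.card (resField p K) - 1) := by
    rw [← hcard]
    exact (IsPrimitiveRoot.orderOf g).map_of_injective hι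
  have := NeZero.of_pos hpos
  obtain ⟨i, -, hi⟩ := hprim.eq_pow_of_pow_eq_one hz
  refine ⟨(g ^ i : (resField p K)ˣ), Units.ne_zero _, ?_⟩
  rw [← hi, ← map_pow]
  rfl

end BaseChange

/-! ### Kummer characters. -/

section Kummer

variable {p : ℕ} [Fact p.Prime] {K : Type*} [Field K] [Algebra ℚ_[p] K] [FiniteDimensional ℚ_[p] K]
  {E : Type*} [Field E] [Algebra K E]

theorem kummerChar_eq {x : E} (hx : x ≠ 0) {g : E ≃ₐ[K] E} {ζ : integers p K}
    (h : g x = algebraMap K E (ζ : K) * x) : kummerChar p K x g = residue _ ζ := by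
  have hex : ∃ ζ : integers p K, g x = algebraMap K E (ζ : K) * x := ⟨ζ, h⟩
  have h2 := Classical.epsilon_spec hex
  rw [kummerChar]
  congr 1
  apply Subtype.ext
  apply (algebraMap K E).injective
  exact mul_right_cancel₀ hx (h2.symm.trans h)

variable (p K) in
theorem card_resField_sub_one_pos : 0 < Nat.card (resField p K) - 1 := by
  rw [← Nat.card_units]
  exact Nat.card_pos

variable (p) in
-- g(x)/x is an e-th root of unity and e divides |k^×|, so it is a Teichmüller lift from K; this
-- justifies the choice made in `kummerChar`.
theorem kummerChar_spec {x : E} (hx : x ≠ 0) {e : ℕ} (he : e ∣ Nat.card (resField p K) - 1)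
    (hxe : ∃ c : K, algebraMap K E c = x ^ e) (g : E ≃ₐ[K] E) :
    kummerChar p K x g ≠ 0 ∧ g x = algebraMap K E (teich p K (kummerChar p K x g) : K) * x ∧
      kummerChar p K x g ^ e = 1 := by
  have hroot : (g x / x) ^ e = 1 := by
    obtain ⟨c, hc⟩ := hxe
    rw [div_pow, ← map_pow, ← hc, AlgEquiv.commutes, div_self]
    rw [hc]
    exact pow_ne_zero _ hx
  let : Algebra ℚ_[p] E := ((algebraMap K E).comp (algebraMap ℚ_[p] K)).toAlgebra
  let φ : K →ₐ[ℚ_[p]] E := { algebraMap K E with commutes' := fun _ => rfl }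
  obtain ⟨c, hc0, hc⟩ := exists_eq_teich_of_pow_eq_one φ (z := g x / x) (by
    obtain ⟨d, hd⟩ := he
    rw [hd, pow_mul, hroot, one_pow])
  have hg : g x = algebraMap K E (teich p K c : K) * x := by
    rw [div_eq_iff hx] at hc
    exact hc
  have hk : kummerChar p K x g = c := by rw [kummerChar_eq hx hg, residue_teich]
  rw [hk]
  refine ⟨hc0, hg, ?_⟩
  rw [hc] at hroot
  apply teich_injective
  rw [teich_pow, teich_one]
  apply Subtype.ext
  apply φ.injective
  change φ ((teich p K c : K) ^ e) = φ 1
  rw [map_pow, hroot, map_one]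

end Kummer

/-! ### Comparison of two tame uniformizers. -/

section Uniformizers

variable {p : ℕ} [Fact p.Prime] {K : Type*} [Field K] [Algebra ℚ_[p] K] [FiniteDimensional ℚ_[p] K]
  {M : Type*} [Field M] [Algebra ℚ_[p] M] [FiniteDimensional ℚ_[p] M]

theorem coprime_of_dvd_card_sub_one {e : ℕ} (he : e ∣ Nat.card (resField p K) - 1) :
    e.Coprime p := by
  obtain ⟨r, hr, hq⟩ := exists_card_resField p K
  rw [Nat.coprime_comm, Nat.Prime.coprime_iff_not_dvd Fact.out]
  intro h
  have h1 : p ∣ Nat.card (resField p K) - 1 := h.trans he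
  have h2 : p ∣ Nat.card (resField p K) := by rw [hq]; exact dvd_pow_self p hr.ne'
  have h3 := card_resField_sub_one_pos p K
  have h4 := (Nat.dvd_sub_iff_right (by omega) h2).1 h1
  exact (Fact.out : p.Prime).one_lt.ne' (Nat.dvd_one.1 h4)

/-- Hensel's lemma for Y^e - u at 1, where the derivative e is a unit. -/
theorem exists_root_near_one (hK : IsUniformizer p (p : K)) {e : ℕ} (he : e.Coprime p)
    {u : integers p K} (hu : residue _ u = 1) :
    ∃ y : integers p K, y ^ e = u ∧ (p : integers p K) ∣ y - 1 := by
  have he0 : e ≠ 0 := by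
    rintro rfl
    rw [Nat.coprime_zero_left] at he
    exact (Fact.out : p.Prime).one_lt.ne' he
  have hdvd : (p : integers p K) ∣ u - 1 :=
    prime_dvd_of_residue_eq_zero hK (by rw [map_sub, hu, map_one, sub_self])
  obtain ⟨y, hy, hy1⟩ := HenselianRing.is_henselian (R := integers p K)
    (I := Ideal.span {(p : integers p K)})
    (Polynomial.X ^ e - Polynomial.C u) (Polynomial.monic_X_pow_sub_C u he0) 1
    (by
      rw [Ideal.mem_span_singleton]
      simp only [Polynomial.eval_sub, Polynomial.eval_pow, Polynomial.eval_X, one_pow,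
        Polynomial.eval_C]
      rw [← neg_sub, dvd_neg]
      exact hdvd)
    (by
      apply IsUnit.map
      simp only [Polynomial.derivative_sub, Polynomial.derivative_X_pow, Polynomial.derivative_C,
        sub_zero, Polynomial.eval_mul, Polynomial.eval_C, Polynomial.eval_pow, Polynomial.eval_X,
        one_pow, mul_one]
      apply integers_isUnit_natCast
      rwa [← Nat.Prime.coprime_iff_not_dvd Fact.out, Nat.coprime_comm])
  refine ⟨y, ?_, Ideal.mem_span_singleton.1 hy1⟩
  rw [Polynomial.IsRoot.def, Polynomial.eval_sub, Polynomial.eval_pow, Polynomial.eval_X,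
    Polynomial.eval_C, sub_eq_zero] at hy
  exact hy

/-- A principal unit of `M` with a power of exponent prime to `p` in `K` lies in `K`. -/
theorem exists_eq_intMap_of_pow_eq (hK : IsUniformizer p (p : K)) (φ : K →ₐ[ℚ_[p]] M) {e : ℕ}
    (he : e ∣ Nat.card (resField p K) - 1) {y : integers p M} (hy : residue _ y = 1)
    {u : integers p K} (hu : y ^ e = intMap p φ u) :
    ∃ y₀ : integers p K, y = intMap p φ y₀ ∧ (p : integers p K) ∣ y₀ - 1 := by
  have hu1 : residue _ u = 1 := by
    apply (resMap p φ).injective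
    rw [resMap_residue, ← hu, map_pow, hy, one_pow, map_one]
  obtain ⟨y₀, hy₀, h1⟩ := exists_root_near_one hK (coprime_of_dvd_card_sub_one he) hu1
  refine ⟨y₀, ?_, h1⟩
  have hres₀ : residue _ y₀ = 1 := by
    rw [← sub_eq_zero, ← map_one (residue _), ← map_sub, residue_eq_zero_iff_absv_lt]
    refine (integers_dvd_iff.1 h1).trans_lt ?_
    simpa using absv_natCast_prime_lt_one p K
  obtain ⟨z₀, hz₀⟩ : IsUnit (intMap p φ y₀) := by
    apply IsUnit.map
    rw [integers_isUnit_iff]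
    by_contra hne
    have hlt : absv p K y₀ < 1 := lt_of_le_of_ne (integers_absv_le y₀) hne
    rw [← residue_eq_zero_iff_absv_lt, hres₀] at hlt
    exact one_ne_zero hlt
  obtain ⟨r, hr, hq⟩ := exists_card_resField p K
  -- The quotient of the two e-th roots is an e-th root of unity with residue 1, hence equal to 1.
  set t : integers p M := y * (z₀⁻¹ : (integers p M)ˣ) with ht
  have hyt : y = t * intMap p φ y₀ := by rw [← hz₀, ht, mul_assoc, Units.inv_mul, mul_one]
  have hte : t ^ e = 1 := by
    rw [ht, mul_pow, hu, ← hy₀, map_pow, ← hz₀, ← mul_pow, Units.mul_inv, one_pow]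
  have htq : t ^ p ^ r = t := by
    rw [← hq]
    obtain ⟨d, hd⟩ := he
    have h2 := card_resField_sub_one_pos p K
    have h3 : Nat.card (resField p K) = e * d + 1 := by omega
    rw [h3, pow_succ, pow_mul, hte, one_pow, one_mul]
  have htr : residue _ t = 1 := by
    have := congrArg (residue _) hyt
    rw [map_mul, hy, ← resMap_residue, hres₀, map_one, mul_one] at this
    exact this.symm
  have : t = 1 := eq_of_residue_eq_of_pow_eq (by rw [htr, map_one]) hr one_pos htq (one_pow _)
  rw [hyt, this, one_mul]

omit [FiniteDimensional ℚ_[p] M] in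
theorem absv_eq_of_isUniformizer {x y : M} (hx : IsUniformizer p x) (hy : IsUniformizer p y) :
    absv p M x = absv p M y :=
  le_antisymm (hy.2.2 _ hx.2.1) (hx.2.2 _ hy.2.1)

/-- Take a to be the residue of η = π'/π. As η^e lies in K, so does the e-th power of the principal
unit η/[a], and hence η/[a] itself. -/
theorem exists_uniformizer_eq (hK : IsUniformizer p (p : K)) (φ : K →ₐ[ℚ_[p]] M) {e : ℕ}
    (he : e ∣ Nat.card (resField p K) - 1) {π π' : M} (hπ : IsUniformizer p π)
    (hπe : ∃ c : K, φ c = π ^ e) (hπ' : IsUniformizer p π') (hπe' : ∃ c : K, φ c = π' ^ e) :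
    ∃ (a : resField p M) (y : integers p K), a ≠ 0 ∧ (p : integers p K) ∣ y - 1 ∧
      π' = teich p M a * π * φ y ∧ ∃ c : resField p K, a ^ e = resMap p φ c := by
  have habs : absv p M (π' / π) = 1 := by
    rw [absv_div, absv_eq_of_isUniformizer hπ' hπ, div_self (absv_pos p hπ.1).ne']
  obtain ⟨c, hc⟩ := hπe
  obtain ⟨c', hc'⟩ := hπe'
  let η : integers p M := ⟨π' / π, habs.le⟩
  have hη : IsUnit η := integers_isUnit_iff.2 habs
  have hηe : φ (c' / c) = (π' / π) ^ e := by rw [map_div₀, hc, hc', div_pow]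
  let u : integers p K := ⟨c' / c, by
    rw [mem_integers, ← absv_map p φ, hηe, absv_pow, habs, one_pow]⟩
  have hu : η ^ e = intMap p φ u := Subtype.ext hηe.symm
  set a := residue _ η with ha
  have ha0 : a ≠ 0 := (hη.map (residue _)).ne_zero
  have hae : a ^ e = resMap p φ (residue _ u) := by rw [ha, ← map_pow, hu, resMap_residue]
  obtain ⟨t, ht⟩ : IsUnit (teich p M a) := ha0.isUnit.map (teichHom p M)
  have hu0 : residue _ u ≠ 0 := by
    intro h
    rw [h, map_zero] at hae
    exact pow_ne_zero _ ha0 hae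
  obtain ⟨s, hs⟩ : IsUnit (teich p K (residue _ u)) := hu0.isUnit.map (teichHom p K)
  have hty : (t⁻¹ : (integers p M)ˣ) * teich p M a = (1 : integers p M) := by
    rw [← ht, Units.inv_mul]
  obtain ⟨y, hy, hy1⟩ := exists_eq_intMap_of_pow_eq hK φ he
    (y := (t⁻¹ : (integers p M)ˣ) * η) (u := u * (s⁻¹ : (integers p K)ˣ)) (by
      have := congrArg (residue _) hty
      rwa [map_mul, residue_teich, map_one, ha, ← map_mul] at this) (by
      have h1 : (t : integers p M) ^ e = intMap p φ (s : integers p K) := by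
        rw [ht, hs, intMap_teich, ← teich_pow, hae]
      have h2 : ((t⁻¹ : (integers p M)ˣ) : integers p M) ^ e =
          intMap p φ (s⁻¹ : (integers p K)ˣ) := by
        have h3 : intMap p φ (s : integers p K) * intMap p φ (s⁻¹ : (integers p K)ˣ) = 1 := by
          rw [← map_mul, Units.mul_inv, map_one]
        have h4 : (t : integers p M) ^ e * ((t⁻¹ : (integers p M)ˣ) : integers p M) ^ e = 1 := by
          rw [← mul_pow, Units.mul_inv, one_pow]
        rw [h1] at h4
        exact (mul_right_injective₀ (left_ne_zero_of_mul_eq_one h3)) (h4.trans h3.symm)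
      rw [mul_pow, hu, h2, map_mul, mul_comm])
  refine ⟨a, y, ha0, hy1, ?_, _, hae⟩
  have h5 : (t : integers p M) * intMap p φ y = η := by
    rw [← hy, ← mul_assoc, Units.mul_inv, one_mul]
  have h6 := congrArg Subtype.val h5
  have hπ0 := hπ.1
  rw [ht] at h6
  change (teich p M a : M) * φ y = π' / π at h6
  field_simp at h6
  linear_combination -h6

end Uniformizers

/-! ### The value group of the field generated by roots of unity of order prime to p. -/

section TameRoots

variable (p : ℕ) [Fact p.Prime] (C : Type*) [Field C] [Algebra ℚ_[p] C]

/-- The ring generated by the roots of unity of order prime to `p`. -/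
def tameRing (p : ℕ) (C : Type*) [Field C] : Subring C := Subring.closure {t : C | ∃ r : ℕ, 0 < r ∧ t ^ p ^ r = t}

variable {p C}

omit [Fact p.Prime] [Algebra ℚ_[p] C] in
theorem mem_tameRing_of_pow_eq {t : C} {r : ℕ} (hr : 0 < r) (ht : t ^ p ^ r = t) :
    t ∈ tameRing p C := Subring.subset_closure ⟨r, hr, ht⟩

variable [Algebra.IsAlgebraic ℚ_[p] C]

theorem absv_le_one_of_pow_eq {t : C} {r : ℕ} (hr : 0 < r) (ht : t ^ p ^ r = t) :
    absv p C t ≤ 1 := by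
  by_contra! h
  have h1 : absv p C t ^ p ^ r = absv p C t := by rw [← absv_pow, ht]
  have h2 : absv p C t ^ 1 < absv p C t ^ p ^ r :=
    pow_lt_pow_right₀ h (Nat.one_lt_pow hr.ne' (Fact.out : p.Prime).one_lt)
  rw [pow_one, h1] at h2
  exact h2.false

theorem absv_le_one_of_mem_tameRing {y : C} (hy : y ∈ tameRing p C) : absv p C y ≤ 1 := by
  have : tameRing p C ≤ (integers p C).toSubring := by
    rw [tameRing, Subring.closure_le]
    rintro t ⟨r, hr, ht⟩
    exact absv_le_one_of_pow_eq hr ht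
  exact this hy

/-- Such roots of unity are Teichmüller lifts in any finite extension containing them, hence come
from Witt vectors. Allowing every larger E lets sums and products be treated in one field. -/
theorem exists_witt_of_mem_tameRing {y : C} (hy : y ∈ tameRing p C) :
    ∃ E₀ : IntermediateField ℚ_[p] C, FiniteDimensional ℚ_[p] E₀ ∧
      ∀ (E : IntermediateField ℚ_[p] C) [FiniteDimensional ℚ_[p] E], E₀ ≤ E →
        ∃ w : WittVector p (resField p E), ((wittToIntegers p E w : E) : C) = y := by
  induction hy using Subring.closure_induction with
  | mem t ht =>
    obtain ⟨r, hr, ht⟩ := ht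
    refine ⟨IntermediateField.adjoin ℚ_[p] {t}, IntermediateField.adjoin.finiteDimensional
      (Algebra.IsAlgebraic.isAlgebraic t).isIntegral, fun E _ hE => ?_⟩
    let t' : E := ⟨t, hE (IntermediateField.mem_adjoin_simple_self _ t)⟩
    have ht' : t' ^ p ^ r = t' := Subtype.ext ht
    let u : integers p E := ⟨t', absv_le_one_of_pow_eq hr ht'⟩
    refine ⟨WittVector.teichmuller p (residue _ u), ?_⟩
    rw [wittToIntegers_teichmuller, teich_eq (z := u) rfl hr (Subtype.ext ht')]
  | zero => exact ⟨⊥, inferInstance, fun E _ _ => ⟨0, by simp⟩⟩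
  | one => exact ⟨⊥, inferInstance, fun E _ _ => ⟨1, by simp⟩⟩
  | add x y _ _ hx hy =>
    obtain ⟨E₁, h₁, H₁⟩ := hx
    obtain ⟨E₂, h₂, H₂⟩ := hy
    refine ⟨E₁ ⊔ E₂, inferInstance, fun E _ hE => ?_⟩
    obtain ⟨w₁, rfl⟩ := H₁ E (le_sup_left.trans hE)
    obtain ⟨w₂, rfl⟩ := H₂ E (le_sup_right.trans hE)
    exact ⟨w₁ + w₂, by simp⟩
  | neg x _ hx =>
    obtain ⟨E₁, h₁, H₁⟩ := hx
    refine ⟨E₁, h₁, fun E _ hE => ?_⟩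
    obtain ⟨w₁, rfl⟩ := H₁ E hE
    exact ⟨-w₁, by simp⟩
  | mul x y _ _ hx hy =>
    obtain ⟨E₁, h₁, H₁⟩ := hx
    obtain ⟨E₂, h₂, H₂⟩ := hy
    refine ⟨E₁ ⊔ E₂, inferInstance, fun E _ hE => ?_⟩
    obtain ⟨w₁, rfl⟩ := H₁ E (le_sup_left.trans hE)
    obtain ⟨w₂, rfl⟩ := H₂ E (le_sup_right.trans hE)
    exact ⟨w₁ * w₂, by simp⟩

theorem absv_of_mem_tameRing {y : C} (hy : y ∈ tameRing p C) (h0 : y ≠ 0) :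
    ∃ n : ℕ, absv p C y = (p : ℝ)⁻¹ ^ n := by
  obtain ⟨E, hE, H⟩ := exists_witt_of_mem_tameRing hy
  obtain ⟨w, rfl⟩ := H E le_rfl
  have hw : w ≠ 0 := by
    rintro rfl
    simp at h0
  obtain ⟨n, b, hb, rfl⟩ := WittVector.exists_eq_pow_p_mul w hw
  refine ⟨n, ?_⟩
  have hu : IsUnit (wittToIntegers p E b) :=
    (WittVector.isUnit_of_coeff_zero_ne_zero b hb).map _
  rw [integers_isUnit_iff] at hu
  have hφ := absv_map p E.val ((wittToIntegers p E ((p : WittVector p _) ^ n * b) : E))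
  rw [← absv_natCast_prime p (E := E)]
  refine hφ.trans ?_
  rw [map_mul, map_pow, map_natCast, MulMemClass.coe_mul, absv_mul, hu, mul_one,
    SubmonoidClass.coe_pow, absv_pow]
  simp

theorem exists_mem_tameRing_absv_sub_le {E : Type*} [Field E] [Algebra ℚ_[p] E]
    [FiniteDimensional ℚ_[p] E] (hE : IsUniformizer p (p : E)) (ψ : E →ₐ[ℚ_[p]] C) (n : ℕ) :
    ∀ x : integers p E, ∃ y ∈ tameRing p C, absv p C (ψ x - y) ≤ (p : ℝ)⁻¹ ^ n := by
  induction n with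
  | zero =>
    intro x
    refine ⟨0, zero_mem _, ?_⟩
    rw [sub_zero, absv_map, pow_zero]
    exact x.2
  | succ n ih =>
    intro x
    obtain ⟨z, hz⟩ := exists_eq_teich_add hE x
    obtain ⟨y, hy, h⟩ := ih z
    obtain ⟨r, hr, ht⟩ := (teich_spec (residue _ x)).2
    refine ⟨ψ (teich p E (residue _ x)) + p * y, add_mem (mem_tameRing_of_pow_eq hr ?_)
      (mul_mem (natCast_mem _ p) hy), ?_⟩
    · rw [← map_pow]
      exact congrArg (fun a : integers p E => ψ a) ht
    · have : ψ x - (ψ (teich p E (residue _ x)) + p * y) = p * (ψ z - y) := by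
        have h2 : ψ x = ψ (teich p E (residue _ x) + p * z) := congrArg ψ (congrArg Subtype.val hz)
        rw [h2, map_add, map_mul, map_natCast]
        ring
      rw [this, absv_mul, absv_natCast_prime, pow_succ']
      gcongr

theorem exists_absv_prime_pow_mul_le_one {E : Type*} [Field E] [Algebra ℚ_[p] E]
    [Algebra.IsAlgebraic ℚ_[p] E] (x : E) : ∃ m : ℕ, absv p E ((p : E) ^ m * x) ≤ 1 := by
  have hp : (1 : ℝ) < p := by exact_mod_cast (Fact.out : p.Prime).one_lt
  obtain ⟨n, hn⟩ := pow_unbounded_of_one_lt (absv p E x) hp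
  refine ⟨n, ?_⟩
  rw [absv_mul, absv_pow, absv_natCast_prime, inv_pow, inv_mul_le_one₀ (by positivity)]
  exact hn.le

variable {K : Type*} [Field K] [Algebra ℚ_[p] K] [FiniteDimensional ℚ_[p] K] [Algebra K C]
  [IsScalarTower ℚ_[p] K C]

variable (p C K) in
/-- The extension of `K` generated by the roots of unity of order prime to `p`. -/
def tameRootsField : IntermediateField K C :=
  IntermediateField.adjoin K {t : C | ∃ r : ℕ, 0 < r ∧ t ^ p ^ r = t}

/-- Elements of K are only limits of elements of the tame ring. Approximation is enough, since it
determines the absolute value of a nonzero element. -/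
theorem exists_approx_of_mem_tameRootsField [Algebra.IsAlgebraic K C]
    (hK : IsUniformizer p (p : K)) {x : C} (hx : x ∈ tameRootsField p C K) :
    ∃ m : ℕ, ∀ n : ℕ, ∃ y ∈ tameRing p C, absv p C ((p : C) ^ m * x - y) ≤ (p : ℝ)⁻¹ ^ n := by
  have hp1 : (p : ℝ)⁻¹ ≤ 1 := inv_le_one_of_one_le₀
    (by exact_mod_cast (Fact.out : p.Prime).one_le)
  have hpm : ∀ m : ℕ, absv p C ((p : C) ^ m) ≤ 1 := fun m => by
    have := absv_natCast_le_one p (E := C) (p ^ m)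
    rwa [Nat.cast_pow] at this
  have hx' : x ∈ Algebra.adjoin K {t : C | ∃ r : ℕ, 0 < r ∧ t ^ p ^ r = t} := by
    rw [← IntermediateField.adjoin_toSubalgebra]
    exact hx
  clear hx
  induction hx' using Algebra.adjoin_induction with
  | mem t ht =>
    obtain ⟨r, hr, ht⟩ := ht
    refine ⟨0, fun n => ⟨t, mem_tameRing_of_pow_eq hr ht, ?_⟩⟩
    rw [pow_zero, one_mul, sub_self, absv_zero]
    positivity
  | algebraMap c =>
    obtain ⟨m, hm⟩ := exists_absv_prime_pow_mul_le_one (p := p) c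
    refine ⟨m, fun n => ?_⟩
    obtain ⟨y, hy, h⟩ := exists_mem_tameRing_absv_sub_le hK (IsScalarTower.toAlgHom ℚ_[p] K C) n
      ⟨_, hm⟩
    refine ⟨y, hy, ?_⟩
    simpa using h
  | add x x' h h' hx hx' =>
    obtain ⟨m, H⟩ := hx
    obtain ⟨m', H'⟩ := hx'
    refine ⟨m + m', fun n => ?_⟩
    obtain ⟨y, hy, hxy⟩ := H n
    obtain ⟨y', hy', hxy'⟩ := H' n
    refine ⟨(p : C) ^ m' * y + (p : C) ^ m * y', add_mem
      (mul_mem (pow_mem (natCast_mem _ p) _) hy) (mul_mem (pow_mem (natCast_mem _ p) _) hy'), ?_⟩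
    have : (p : C) ^ (m + m') * (x + x') - ((p : C) ^ m' * y + (p : C) ^ m * y') =
      (p : C) ^ m' * ((p : C) ^ m * x - y) + (p : C) ^ m * ((p : C) ^ m' * x' - y') := by ring
    rw [this]
    refine (absv_add_le p _ _).trans (max_le ?_ ?_)
    · rw [absv_mul]
      exact (mul_le_of_le_one_left (absv_nonneg p _) (hpm _)).trans hxy
    · rw [absv_mul]
      exact (mul_le_of_le_one_left (absv_nonneg p _) (hpm _)).trans hxy'
  | mul x x' h h' hx hx' =>
    obtain ⟨m, H⟩ := hx
    obtain ⟨m', H'⟩ := hx'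
    have hle : absv p C ((p : C) ^ m * x) ≤ 1 := by
      obtain ⟨y, hy, hxy⟩ := H 0
      have := absv_add_le p ((p : C) ^ m * x - y) y
      rw [sub_add_cancel] at this
      exact this.trans (max_le (by simpa using hxy) (absv_le_one_of_mem_tameRing hy))
    refine ⟨m + m', fun n => ?_⟩
    obtain ⟨y, hy, hxy⟩ := H n
    obtain ⟨y', hy', hxy'⟩ := H' n
    refine ⟨y * y', mul_mem hy hy', ?_⟩
    have : (p : C) ^ (m + m') * (x * x') - y * y' =
      ((p : C) ^ m * x) * ((p : C) ^ m' * x' - y') + y' * ((p : C) ^ m * x - y) := by ring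
    rw [this]
    refine (absv_add_le p _ _).trans (max_le ?_ ?_)
    · rw [absv_mul]
      exact (mul_le_of_le_one_left (absv_nonneg p _) hle).trans hxy'
    · rw [absv_mul]
      exact (mul_le_of_le_one_left (absv_nonneg p _) (absv_le_one_of_mem_tameRing hy')).trans hxy

/-- The value group of the field generated by roots of unity of order prime to `p` is that
of `ℚ_p`. -/
theorem absv_of_mem_tameRootsField [Algebra.IsAlgebraic K C] (hK : IsUniformizer p (p : K)) {x : C}
    (hx : x ∈ tameRootsField p C K) (h0 : x ≠ 0) :
    ∃ m n : ℕ, (p : ℝ)⁻¹ ^ m * absv p C x = (p : ℝ)⁻¹ ^ n := by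
  obtain ⟨m, H⟩ := exists_approx_of_mem_tameRootsField hK hx
  have h1 : (p : C) ^ m * x ≠ 0 := mul_ne_zero (pow_ne_zero _ (natCast_prime_ne_zero p C)) h0
  obtain ⟨n, hn⟩ := exists_pow_lt_of_lt_one (absv_pos p h1)
    (inv_lt_one_of_one_lt₀ (by exact_mod_cast (Fact.out : p.Prime).one_lt) : (p : ℝ)⁻¹ < 1)
  obtain ⟨y, hy, h⟩ := H n
  have heq := absv_eq_of_sub_lt (h.trans_lt hn)
  have hy0 : y ≠ 0 := by
    rintro rfl
    rw [absv_zero] at heq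
    exact (absv_pos p h1).ne heq
  obtain ⟨k, hk⟩ := absv_of_mem_tameRing hy hy0
  refine ⟨m, k, ?_⟩
  rw [← hk, heq, absv_mul, absv_pow, absv_natCast_prime]

theorem absv_multiset_prod {s : Multiset C} {c : ℝ} (h : ∀ r ∈ s, absv p C r = c) :
    absv p C s.prod = c ^ Multiset.card s := by
  induction s using Multiset.induction_on with
  | empty => simp
  | cons a s ih =>
    rw [Multiset.prod_cons, absv_mul, ih fun r hr => h r (Multiset.mem_cons_of_mem hr),
      h a (Multiset.mem_cons_self a s), Multiset.card_cons, pow_succ']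

/-- All conjugates have absolute value |ϖ|, so the constant term of a minimal polynomial of degree n
has absolute value |ϖ|^n. It must be an integral power of |p| = |ϖ|^N, so N divides n. -/
theorem minpoly_tameRootsField [IsAlgClosure K C] (hK : IsUniformizer p (p : K)) {N : ℕ}
    (hN : 0 < N) {ϖ : C} (hϖ : ϖ ^ N = -(p : C)) :
    minpoly (tameRootsField p C K) ϖ =
      Polynomial.X ^ N + Polynomial.C (p : tameRootsField p C K) := by
  have hC : IsAlgClosed C := IsAlgClosure.isAlgClosed K
  have halg : Algebra.IsAlgebraic K C := IsAlgClosure.isAlgebraic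
  have hint : IsIntegral (tameRootsField p C K) ϖ :=
    ((Algebra.IsAlgebraic.isAlgebraic (R := K) ϖ).isIntegral).tower_top
  have hmonic := minpoly.monic hint
  have hXN : (Polynomial.X ^ N + Polynomial.C (p : tameRootsField p C K)).Monic :=
    Polynomial.monic_X_pow_add_C _ hN.ne'
  have hdvd : minpoly (tameRootsField p C K) ϖ ∣
      Polynomial.X ^ N + Polynomial.C (p : tameRootsField p C K) := by
    apply minpoly.dvd
    simp [hϖ]
  have hp1 : (p : ℝ)⁻¹ < 1 :=
    inv_lt_one_of_one_lt₀ (by exact_mod_cast (Fact.out : p.Prime).one_lt)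
  have hp0 : 0 < (p : ℝ)⁻¹ := inv_pos.2 (by exact_mod_cast (Fact.out : p.Prime).pos)
  have habs : ∀ r : C, r ^ N = -(p : C) → absv p C r ^ N = (p : ℝ)⁻¹ := fun r hr => by
    rw [← absv_pow, hr, absv_neg, absv_natCast_prime]
  set Q := (minpoly (tameRootsField p C K) ϖ).map (algebraMap _ C) with hQ
  have hroots : ∀ r ∈ Q.roots, absv p C r = absv p C ϖ := by
    intro r hr
    have h1 := Polynomial.isRoot_of_mem_roots hr
    have h2 := Polynomial.IsRoot.dvd h1 (Polynomial.map_dvd (algebraMap _ C) hdvd)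
    have h3 : r ^ N = -(p : C) := by
      rw [← sub_eq_zero, sub_neg_eq_add]
      simpa using h2
    have h4 := (habs r h3).trans (habs ϖ hϖ).symm
    exact (pow_left_inj₀ (absv_nonneg p _) (absv_nonneg p _) hN.ne').1 h4
  have hcoeff := (IsAlgClosed.splits Q).coeff_zero_eq_prod_roots_of_monic (hmonic.map _)
  have hdeg : Q.roots.card = (minpoly (tameRootsField p C K) ϖ).natDegree := by
    rw [← (IsAlgClosed.splits Q).natDegree_eq_card_roots, hQ, Polynomial.natDegree_map]
  set n := (minpoly (tameRootsField p C K) ϖ).natDegree with hn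
  have hval : absv p C (Q.coeff 0) = absv p C ϖ ^ n := by
    rw [hcoeff, absv_mul, absv_pow, absv_neg, absv_one, one_pow, one_mul,
      absv_multiset_prod hroots, hdeg]
  have hn0 : 0 < n := minpoly.natDegree_pos hint
  have hρ0 : 0 < absv p C ϖ := by
    apply absv_pos
    rintro rfl
    rw [zero_pow hN.ne'] at hϖ
    exact natCast_prime_ne_zero p C (neg_eq_zero.1 hϖ.symm)
  have hρ1 : absv p C ϖ < 1 := by
    by_contra! h
    have := one_le_pow₀ (n := N) h
    rw [habs ϖ hϖ] at this
    exact absurd this (not_le.2 hp1)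
  obtain ⟨a, b, hab⟩ := absv_of_mem_tameRootsField hK (x := Q.coeff 0)
    (by rw [hQ, Polynomial.coeff_map]; exact ((minpoly (tameRootsField p C K) ϖ).coeff 0).2)
    (by
      intro h
      rw [h, absv_zero] at hval
      exact (pow_pos hρ0 n).ne hval)
  rw [hval, ← habs ϖ hϖ, ← pow_mul, ← pow_mul, ← pow_add] at hab
  have hexp := pow_right_injective₀ hρ0 hρ1.ne hab
  have hNn : N ∣ n := (Nat.dvd_add_right (Dvd.intro a rfl)).1 ⟨b, hexp⟩
  refine (Polynomial.eq_of_monic_of_dvd_of_natDegree_le hmonic hXN hdvd ?_).symm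
  rw [Polynomial.natDegree_X_pow_add_C]
  exact Nat.le_of_dvd hn0 hNn

end TameRoots

/-! ### Inertia, and the exponent of a tame character of Gal(M/K). -/

section Inertia

variable {p : ℕ} [Fact p.Prime] {C : Type*} [Field C] [Algebra ℚ_[p] C]
  [Algebra.IsAlgebraic ℚ_[p] C]
  {K : Type*} [Field K] [Algebra ℚ_[p] K] [Algebra K C] [IsScalarTower ℚ_[p] K C]

omit [Algebra.IsAlgebraic ℚ_[p] C] in
theorem absv_algEquiv (g : C ≃ₐ[K] C) (x : C) : absv p C (g x) = absv p C x :=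
  absv_map p (g.restrictScalars ℚ_[p] : C →ₐ[ℚ_[p]] C) x

omit [Algebra ℚ_[p] K] [IsScalarTower ℚ_[p] K C] in
-- t and g(t) are Teichmüller lifts with the same residue.
theorem IsInertial.apply_eq_of_pow_eq {g : C ≃ₐ[K] C} (hg : IsInertial p K C g) {t : C} {r : ℕ}
    (hr : 0 < r) (ht : t ^ p ^ r = t) : g t = t := by
  let E := IntermediateField.adjoin ℚ_[p] {t, g t}
  have : FiniteDimensional ℚ_[p] E := IntermediateField.finiteDimensional_adjoin fun x _ =>
    (Algebra.IsAlgebraic.isAlgebraic x).isIntegral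
  have hgt : g t ^ p ^ r = g t := by rw [← map_pow, ht]
  have htE : t ∈ E := IntermediateField.subset_adjoin _ _ (by simp)
  have hgtE : g t ∈ E := IntermediateField.subset_adjoin _ _ (by simp)
  let t₁ : E := ⟨t, htE⟩
  let t₂ : E := ⟨g t, hgtE⟩
  let u₁ : integers p E := ⟨t₁, absv_le_one_of_pow_eq hr (Subtype.ext ht)⟩
  let u₂ : integers p E := ⟨t₂, absv_le_one_of_pow_eq hr (Subtype.ext hgt)⟩
  have h : u₂ = u₁ := by
    refine eq_of_residue_eq_of_pow_eq ?_ hr hr (Subtype.ext (Subtype.ext hgt))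
      (Subtype.ext (Subtype.ext ht))
    rw [residue_eq_residue_iff, ← absv_map p E.val, map_sub]
    exact hg t (absv_le_one_of_pow_eq hr ht)
  exact congrArg (fun u : integers p E => ((u : E) : C)) h

omit [Algebra ℚ_[p] K] [IsScalarTower ℚ_[p] K C] in
theorem IsInertial.apply_eq_of_mem_tameRing {g : C ≃ₐ[K] C} (hg : IsInertial p K C g) {y : C}
    (hy : y ∈ tameRing p C) : g y = y := by
  have : tameRing p C ≤ RingHom.eqLocus (g : C →+* C) (RingHom.id C) := by
    rw [tameRing, Subring.closure_le]
    rintro t ⟨r, hr, ht⟩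
    exact hg.apply_eq_of_pow_eq hr ht
  exact this hy

/-- Inertia acts trivially on unramified extensions of `ℚ_p`. -/
theorem IsInertial.apply_eq {g : C ≃ₐ[K] C} (hg : IsInertial p K C g) {E : Type*} [Field E]
    [Algebra ℚ_[p] E] [FiniteDimensional ℚ_[p] E] (hE : IsUniformizer p (p : E))
    (ψ : E →ₐ[ℚ_[p]] C) (x : E) : g (ψ x) = ψ x := by
  obtain ⟨m, hm⟩ := exists_absv_prime_pow_mul_le_one (p := p) x
  have h : ∀ z : integers p E, g (ψ z) = ψ z := by
    intro z
    rw [← sub_eq_zero]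
    apply eq_zero_of_absv_eq_zero (p := p)
    refine le_antisymm (le_of_forall_pos_lt_add fun ε hε => ?_) (absv_nonneg p _)
    obtain ⟨n, hn⟩ := exists_pow_lt_of_lt_one hε
      (inv_lt_one_of_one_lt₀ (by exact_mod_cast (Fact.out : p.Prime).one_lt) : (p : ℝ)⁻¹ < 1)
    obtain ⟨y, hy, hzy⟩ := exists_mem_tameRing_absv_sub_le hE ψ n z
    have h1 : g (ψ z) - ψ z = g (ψ z - y) - (ψ z - y) := by
      rw [map_sub, hg.apply_eq_of_mem_tameRing hy]
      ring
    rw [zero_add, h1]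
    refine (absv_sub_le p _ _).trans_lt (max_lt ?_ (hzy.trans_lt hn))
    rw [absv_algEquiv]
    exact hzy.trans_lt hn
  have h2 := h ⟨_, hm⟩
  simp only [map_mul, map_pow, map_natCast] at h2
  exact mul_left_cancel₀ (pow_ne_zero _ (natCast_prime_ne_zero p C)) h2

/-- Every integer is a Teichmüller lift plus an element of the maximal ideal. -/
theorem isInertial_of_fixes {g : C ≃ₐ[K] C} (hg : ∀ t : C, ∀ r : ℕ, 0 < r → t ^ p ^ r = t → g t = t) :
    IsInertial p K C g := by
  intro x hx
  let E := IntermediateField.adjoin ℚ_[p] {x}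
  have : FiniteDimensional ℚ_[p] E := IntermediateField.adjoin.finiteDimensional
    (Algebra.IsAlgebraic.isAlgebraic x).isIntegral
  let x₁ : E := ⟨x, IntermediateField.mem_adjoin_simple_self _ x⟩
  let u : integers p E := ⟨x₁, (absv_map p E.val x₁).symm.le.trans hx⟩
  obtain ⟨r, hr, ht⟩ := (teich_spec (residue _ u)).2
  set t : C := ((teich p E (residue _ u) : E) : C) with htdef
  have htt : t ^ p ^ r = t := congrArg (fun u : integers p E => ((u : E) : C)) ht
  have hlt : absv p C (x - t) < 1 := by
    have h : absv p E ((u : E) - teich p E (residue _ u)) < 1 := by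
      rw [← residue_eq_residue_iff, residue_teich]
    rw [← absv_map p E.val] at h
    simpa using h
  have h1 : g x - x = g (x - t) - (x - t) := by
    rw [map_sub, hg t r hr htt]
    ring
  rw [h1]
  refine (absv_sub_le p _ _).trans_lt (max_lt ?_ hlt)
  rw [absv_algEquiv]
  exact hlt

variable [FiniteDimensional ℚ_[p] K]

/-- The fundamental character is surjective on inertia. -/
theorem exists_isInertial_apply_eq [IsAlgClosure K C] (hK : IsUniformizer p (p : K)) {N : ℕ}
    (hN : 0 < N) {ϖ ϖ' : C} (hϖ : ϖ ^ N = -(p : C)) (hϖ' : ϖ' ^ N = -(p : C)) :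
    ∃ g : C ≃ₐ[K] C, IsInertial p K C g ∧ g ϖ = ϖ' := by
  have hC : IsAlgClosed C := IsAlgClosure.isAlgClosed K
  have halg : Algebra.IsAlgebraic K C := IsAlgClosure.isAlgebraic
  have hconj : IsConjRoot (tameRootsField p C K) ϖ' ϖ := by
    rw [IsConjRoot, minpoly_tameRootsField hK hN hϖ, minpoly_tameRootsField hK hN hϖ']
  obtain ⟨σ, hσ⟩ := isConjRoot_iff_exists_algEquiv.1 hconj
  refine ⟨σ.restrictScalars K, isInertial_of_fixes fun t r hr ht => ?_, hσ⟩
  exact σ.commutes (⟨t, IntermediateField.subset_adjoin _ _ ⟨r, hr, ht⟩⟩ : tameRootsField p C K)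

/-- The exponent of a tame character trivial on `G_M`. -/
theorem dvd_mul_of_forall_inertial [IsAlgClosure K C] (hK : IsUniformizer p (p : K))
    {M : Type*} [Field M] [Algebra ℚ_[p] M] [FiniteDimensional ℚ_[p] M] [Algebra K M]
    [IsScalarTower ℚ_[p] K M] [Algebra M C] [IsScalarTower K M C]
    (L : IntermediateField K M) (hL : IsUnramified p K L)
    {e : ℕ} (he : e ∣ Nat.card (resField p K) - 1) {π : M} (hπ : π ≠ 0)
    (hπe : ∃ c : K, algebraMap K M c = π ^ e) (hM : IntermediateField.adjoin L {π} = ⊤)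
    {F : Type*} [Field F] (τ₀ : resField p K →+* F) (χ : (C ≃ₐ[K] C) →* Fˣ)
    (hχM : ∀ g : C ≃ₐ[K] C, (∀ x : M, g (algebraMap M C x) = algebraMap M C x) → χ g = 1) {n₀ : ℕ}
    (hχ : ∀ ϖ : C, ϖ ^ (Nat.card (resField p K) - 1) = -(p : C) → ∀ g : C ≃ₐ[K] C,
      IsInertial p K C g → (χ g : F) = τ₀ (kummerChar p K ϖ g) ^ n₀) :
    Nat.card (resField p K) - 1 ∣ e * n₀ := by
  classical
  have hC : IsAlgClosed C := IsAlgClosure.isAlgClosed K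
  have hN := card_resField_sub_one_pos p K
  set N := Nat.card (resField p K) - 1 with hNdef
  obtain ⟨ϖ, hϖ⟩ := IsAlgClosed.exists_pow_nat_eq (-(p : C)) hN
  have hϖ0 : ϖ ≠ 0 := by
    rintro rfl
    rw [zero_pow hN.ne'] at hϖ
    exact natCast_prime_ne_zero p C (neg_eq_zero.1 hϖ.symm)
  obtain ⟨c, hc⟩ := IsCyclic.exists_generator (α := (resField p K)ˣ)
  have hord : orderOf (c : resField p K) = N := by
    rw [orderOf_units, orderOf_eq_card_of_forall_mem_zpowers hc, Nat.card_units]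
  -- An inertial g on which the fundamental character is a generator c of k^×.
  obtain ⟨g, hg, hgϖ⟩ := exists_isInertial_apply_eq hK hN hϖ
    (ϖ' := algebraMap K C (teich p K (c : resField p K)) * ϖ) (by
      have : (c : resField p K) ^ N = 1 := by rw [← hord, pow_orderOf_eq_one]
      rw [mul_pow, hϖ, ← map_pow, ← SubmonoidClass.coe_pow, ← teich_pow, this, teich_one,
        OneMemClass.coe_one, map_one, one_mul])
  have hkum : kummerChar p K ϖ g = c := by rw [kummerChar_eq hϖ0 hgϖ, residue_teich]
  have hLfin : FiniteDimensional ℚ_[p] L :=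
    FiniteDimensional.of_injective (L.val.restrictScalars ℚ_[p]).toLinearMap L.val.injective
  have hLp : IsUniformizer p (p : L) := by
    refine ⟨natCast_prime_ne_zero p L, absv_natCast_prime_lt_one p L, fun y hy => ?_⟩
    obtain ⟨x, hx⟩ := hL y
    have h1 : absv p L (algebraMap K L x) = absv p K x :=
      absv_map p (IsScalarTower.toAlgHom ℚ_[p] K L) x
    rw [h1] at hx
    rw [hx, absv_natCast_prime, ← absv_natCast_prime p (E := K)]
    exact hK.2.2 _ (hx ▸ hy)
  -- Inertia fixes L, and g(π)/π is an e-th root of unity in K, so g^e is trivial on M. Hence c^{e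
  -- n₀} = 1, while c has order |k^×|.
  have hfix : ∀ x : M, (g ^ e) (algebraMap M C x) = algebraMap M C x := by
    intro x
    have hx : x ∈ IntermediateField.adjoin L {π} := hM ▸ IntermediateField.mem_top
    induction hx using IntermediateField.adjoin_induction with
    | mem y hy =>
      obtain rfl : y = π := hy
      obtain ⟨b, hb⟩ := hπe
      have hy0 : algebraMap M C y ≠ 0 := (map_ne_zero _).2 hπ
      obtain ⟨h0, h1, h2⟩ := kummerChar_spec p (K := K) hy0 he
        ⟨b, by rw [IsScalarTower.algebraMap_apply K M C, hb, map_pow]⟩ g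
      set d := kummerChar p K (algebraMap M C y) g
      have h3 : ∀ n : ℕ, (g ^ n) (algebraMap M C y) =
          algebraMap K C (teich p K (d ^ n) : integers p K) * algebraMap M C y := by
        intro n
        induction n with
        | zero => simp
        | succ n ih =>
          rw [pow_succ, AlgEquiv.mul_apply, h1, map_mul, ih, AlgEquiv.commutes, pow_succ, teich_mul,
            MulMemClass.coe_mul, map_mul]
          ring
      rw [h3, h2, teich_one, OneMemClass.coe_one, map_one, one_mul]
    | algebraMap y =>
      have h1 : ∀ n : ℕ, (g ^ n) (algebraMap M C (algebraMap L M y)) =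
          algebraMap M C (algebraMap L M y) := by
        let ψ : L →ₐ[K] C := (IsScalarTower.toAlgHom K M C).comp L.val
        have h2 := hg.apply_eq hLp (ψ.restrictScalars ℚ_[p]) y
        intro n
        induction n with
        | zero => simp
        | succ n ih => rw [pow_succ, AlgEquiv.mul_apply]; exact (congrArg (g ^ n) h2).trans ih
      exact h1 e
    | add x y _ _ hx hy => rw [map_add, map_add, hx, hy]
    | inv x _ hx => rw [map_inv₀, map_inv₀, hx]
    | mul x y _ _ hx hy => rw [map_mul, map_mul, hx, hy]
  have h1 := hχM _ hfix
  have h2 := hχ ϖ hϖ g hg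
  rw [hkum] at h2
  have h3 : τ₀ ((c : resField p K) ^ (e * n₀)) = 1 := by
    rw [map_pow, mul_comm, pow_mul, ← h2, ← Units.val_pow_eq_pow_val, ← map_pow, h1, Units.val_one]
  rw [← hord]
  apply orderOf_dvd_of_pow_eq_one
  exact τ₀.injective (h3.trans (map_one _).symm)

end Inertia

/-! ### Arithmetic of the exponents e n_i/(p^f - 1). -/

section Digits

variable {p f : ℕ}

/-- n_i and n_{i+1} have the same digits up to a cyclic shift. -/
theorem prime_mul_digitSum (a : ZMod f → ℕ) (i : ZMod f) :
    p * digitSum p a (i + 1) + a i = digitSum p a i + a i * p ^ f := by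
  have h1 := Finset.sum_range_succ (fun j : ℕ => a (i + (j : ZMod f)) * p ^ j) f
  have h2 := Finset.sum_range_succ' (fun j : ℕ => a (i + (j : ZMod f)) * p ^ j) f
  rw [h1] at h2
  simp only [Nat.cast_zero, CharP.cast_eq_zero, add_zero, pow_zero, mul_one] at h2
  rw [digitSum, digitSum, h2, Finset.mul_sum]
  congr 1
  refine Finset.sum_congr rfl fun j _ => ?_
  rw [Nat.cast_succ, pow_succ]
  have : i + 1 + (j : ZMod f) = i + ((j : ZMod f) + 1) := by ring
  rw [this]
  ring

variable [Fact p.Prime]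

theorem natCast_eq_of_zmod [NeZero f] (i : ZMod f) : ∃ n : ℕ, (n : ZMod f) = i :=
  ⟨i.val, ZMod.natCast_zmod_val i⟩

variable {a : ZMod f → ℕ} {e : ℕ}

theorem coprime_prime_pow_sub_one (hf : 0 < f) : (p ^ f - 1).Coprime p := by
  have hp : p.Prime := Fact.out
  rw [Nat.coprime_comm, hp.coprime_iff_not_dvd]
  intro h
  have h1 : 1 < p ^ f := Nat.one_lt_pow hf.ne' hp.one_lt
  have h2 := (Nat.dvd_sub_iff_right h1.le (dvd_pow_self p hf.ne')).1 h
  exact hp.one_lt.ne' (Nat.dvd_one.1 h2)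

/-- p n_{i+1} ≡ n_i mod p^f - 1, where p is invertible. -/
theorem dvd_mul_digitSum (hf : 0 < f) (h0 : p ^ f - 1 ∣ e * digitSum p a 0) (i : ZMod f) :
    p ^ f - 1 ∣ e * digitSum p a i := by
  have : NeZero f := ⟨hf.ne'⟩
  obtain ⟨n, rfl⟩ := natCast_eq_of_zmod i
  induction n with
  | zero => simpa using h0
  | succ n ih =>
    have h1 := prime_mul_digitSum (p := p) a (n : ZMod f)
    have hq : 1 ≤ p ^ f := Nat.one_le_pow _ _ (Fact.out : p.Prime).pos
    have h2 : p * (e * digitSum p a ((n + 1 : ℕ) : ZMod f)) =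
        e * digitSum p a (n : ZMod f) + (p ^ f - 1) * (e * a n) := by
      rw [Nat.cast_succ]
      zify [hq]
      zify at h1
      linear_combination (e : ℤ) * h1
    apply (coprime_prime_pow_sub_one hf).dvd_of_dvd_mul_left
    rw [h2]
    exact dvd_add ih (Dvd.intro _ rfl)

/-- The integers `e n_i / (p ^ f - 1)`. -/
def tameExp (p : ℕ) (e : ℕ) (a : ZMod f → ℕ) (i : ZMod f) : ℕ := e * digitSum p a i / (p ^ f - 1)

variable (hf : 0 < f) (h0 : p ^ f - 1 ∣ e * digitSum p a 0)
include hf h0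

theorem mul_tameExp (i : ZMod f) : (p ^ f - 1) * tameExp p e a i = e * digitSum p a i :=
  Nat.mul_div_cancel' (dvd_mul_digitSum hf h0 i)

theorem prime_mul_tameExp (i : ZMod f) :
    p * tameExp p e a (i + 1) = tameExp p e a i + e * a i := by
  have hq : 1 < p ^ f := Nat.one_lt_pow hf.ne' (Fact.out : p.Prime).one_lt
  have h1 := prime_mul_digitSum (p := p) a i
  have h2 := mul_tameExp hf h0 i
  have h3 := mul_tameExp hf h0 (i + 1)
  apply Nat.eq_of_mul_eq_mul_left (show 0 < p ^ f - 1 by omega)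
  zify [hq.le] at *
  linear_combination p * h3 - h2 + e * h1

omit h0 in
-- Comparison with the case where every digit is 1 and n_i is the geometric sum. This decides on
-- which side of the radius of convergence the exponents lie.
theorem geomSum_le_mul_digitSum (ha : ∀ i, 1 ≤ a i) (i : ZMod f) :
    p ^ f - 1 ≤ (p - 1) * digitSum p a i ∧
      ((∃ j, a j ≠ 1) → p ^ f - 1 < (p - 1) * digitSum p a i) := by
  have hp : p.Prime := Fact.out
  have hp1 : 0 < p - 1 := by have := hp.two_le; omega
  have hgeom : p ^ f - 1 = (p - 1) * ∑ j ∈ Finset.range f, p ^ j := by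
    have h := mul_geom_sum (p : ℤ) f
    zify [hp.one_le, Nat.one_le_pow f p hp.pos]
    exact h.symm
  rw [hgeom]
  have hle : ∀ j ∈ Finset.range f, p ^ j ≤ a (i + (j : ZMod f)) * p ^ j := fun j _ =>
    Nat.le_mul_of_pos_left _ (ha _)
  refine ⟨Nat.mul_le_mul_left _ (Finset.sum_le_sum hle), fun ⟨j, hj⟩ => ?_⟩
  refine Nat.mul_lt_mul_of_pos_left (Finset.sum_lt_sum hle ?_) hp1
  have : NeZero f := ⟨hf.ne'⟩
  refine ⟨(j - i).val, Finset.mem_range.2 (ZMod.val_lt _), ?_⟩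
  rw [ZMod.natCast_zmod_val, add_sub_cancel]
  have h1 := ha j
  exact lt_mul_of_one_lt_left (pow_pos hp.pos _) (by omega)

theorem le_mul_tameExp (he : 0 < e) (ha : ∀ i, 1 ≤ a i) (i : ZMod f) :
    e ≤ (p - 1) * tameExp p e a i ∧ ((∃ j, a j ≠ 1) → e < (p - 1) * tameExp p e a i) := by
  have hq : 1 < p ^ f := Nat.one_lt_pow hf.ne' (Fact.out : p.Prime).one_lt
  have hq' : 0 < p ^ f - 1 := by omega
  have h2 := mul_tameExp hf h0 i
  obtain ⟨h3, h4⟩ := geomSum_le_mul_digitSum (p := p) hf ha i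
  have h5 : (p ^ f - 1) * ((p - 1) * tameExp p e a i) = e * ((p - 1) * digitSum p a i) := by
    rw [mul_left_comm, h2]
    ring
  constructor
  · apply Nat.le_of_mul_le_mul_left _ hq'
    rw [h5, mul_comm _ e]
    exact Nat.mul_le_mul_left e h3
  · intro h
    apply Nat.lt_of_mul_lt_mul_left (a := p ^ f - 1)
    rw [h5, mul_comm _ e]
    exact Nat.mul_lt_mul_of_pos_left (h4 h) he

theorem tameExp_pos (he : 0 < e) (ha : ∀ i, 1 ≤ a i) (i : ZMod f) : 0 < tameExp p e a i := by
  have h := (le_mul_tameExp hf h0 he ha i).1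
  by_contra! h1
  rw [Nat.le_zero.1 h1, mul_zero] at h
  omega

theorem tameExp_add_one_of_eq_prime (he : 0 < e) (ha : ∀ i, 1 ≤ a i) {h : ZMod f} (hh : a h = p) :
    e < tameExp p e a (h + 1) ∧ p * (tameExp p e a (h + 1) - e) = tameExp p e a h := by
  have hp : p.Prime := Fact.out
  have h1 := prime_mul_tameExp hf h0 h
  have h2 := tameExp_pos hf h0 he ha h
  rw [hh] at h1
  have h3 : e < tameExp p e a (h + 1) := by
    apply Nat.lt_of_mul_lt_mul_left (a := p)
    rw [h1, mul_comm p e]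
    omega
  refine ⟨h3, ?_⟩
  rw [Nat.mul_sub, h1, mul_comm p e]
  omega

/-- Subtract p e from p m_{h+1} = m_h + e (p - 1). The bound on m_h makes the natural number
subtractions exact. -/
theorem tameExp_add_one_of_eq_prime_sub_one {h : ZMod f} (hh : a h = p - 1)
    (hlt : e < tameExp p e a h) :
    e < tameExp p e a (h + 1) ∧ p * (tameExp p e a (h + 1) - e) = tameExp p e a h - e := by
  have hp : p.Prime := Fact.out
  have h1 := prime_mul_tameExp hf h0 h
  have h4 : e * (p - 1) + e = p * e := by
    rw [← Nat.mul_succ, Nat.succ_eq_add_one, Nat.sub_add_cancel hp.one_le, mul_comm]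
  rw [hh] at h1
  have h3 : e < tameExp p e a (h + 1) := by
    apply Nat.lt_of_mul_lt_mul_left (a := p)
    rw [h1]
    omega
  refine ⟨h3, ?_⟩
  rw [Nat.mul_sub, h1]
  omega

omit hf h0

/-- f itself lies in the set, since a_{i+f+1} = a_{i+1} = p, so the infimum is attained and is at
most f. -/
theorem shift_spec (hf : 0 < f) {i : ZMod f} (hi : a (i + 1) = p) :
    1 ≤ shift p a i ∧ shift p a i ≤ f ∧ a (i + (shift p a i : ZMod f) + 1) ≠ p - 1 ∧
      ∀ r, 2 ≤ r → r ≤ shift p a i → a (i + (r : ZMod f)) = p - 1 := by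
  have hp : p.Prime := Fact.out
  have hs : shift p a i = sInf {s : ℕ | 1 ≤ s ∧ a (i + (s : ZMod f) + 1) ≠ p - 1} := if_pos hi
  have hfmem : f ∈ {s : ℕ | 1 ≤ s ∧ a (i + (s : ZMod f) + 1) ≠ p - 1} := by
    refine ⟨hf, ?_⟩
    rw [ZMod.natCast_self, add_zero, hi]
    have := hp.two_le
    omega
  have hmem := Nat.sInf_mem ⟨f, hfmem⟩
  rw [← hs] at hmem
  refine ⟨hmem.1, hs ▸ Nat.sInf_le hfmem, hmem.2, fun r hr hrs => ?_⟩
  obtain ⟨r, rfl⟩ : ∃ k, r = k + 1 := ⟨r - 1, by omega⟩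
  by_contra hne
  have : r ∈ {s : ℕ | 1 ≤ s ∧ a (i + (s : ZMod f) + 1) ≠ p - 1} := by
    refine ⟨by omega, ?_⟩
    rwa [Nat.cast_succ, ← add_assoc] at hne
  have h2 := Nat.sInf_le this
  rw [← hs] at h2
  omega

omit [Fact p.Prime] in
theorem nPrime_of_ne {i : ZMod f} (hi : a (i + 1) ≠ p) : shift p a i = 0 ∧
    nPrime p e a i = tameExp p e a (i + 1) := by
  have hs : shift p a i = 0 := if_neg hi
  refine ⟨hs, ?_⟩
  rw [nPrime, if_neg hi, hs, Nat.cast_zero, add_zero, Nat.sub_zero, tameExp]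

omit [Fact p.Prime] in
theorem nPrime_of_eq {i : ZMod f} (hi : a (i + 1) = p) :
    nPrime p e a i = tameExp p e a (i + (shift p a i : ZMod f) + 1) - e := by
  rw [nPrime, if_pos hi, tameExp]

end Digits

/-! ### Reduction of exponential terms to units of dependent pairs. -/

section DependentSpan

variable {p f : ℕ} [Fact p.Prime] {a : ZMod f → ℕ} {e : ℕ}
  {F T U : Type*} [Field F] [AddCommGroup T] [Module F T] [AddCommGroup U] [Module F U]

/-- The formal properties of the maps `ε_{π^n}` and `x ↦ exp (p x π^n)`. -/
structure TameRelations (p : ℕ) {f : ℕ} (e : ℕ) (φ : T →ₗ[F] T) (Eig : ZMod f → Submodule F T)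
    (A P : ℕ → T →ₗ[F] U) : Prop where
  eps_frob : ∀ n, 0 < n → ∀ x, A (p * n) (φ x) = -P n x
  exists_exp_eq : ∀ n, 0 < n → ∀ h, ∀ x ∈ Eig h, ∃ c d : F,
    P n x = c • A (n + e) x + d • P (p * n) (φ x)
  exp_eq_zero : ∀ n, e < (p - 1) * n → P n = 0
  frob_mem : ∀ h, ∀ x ∈ Eig (h + 1), φ x ∈ Eig h
  exists_frob_eq : ∀ h, ∀ x ∈ Eig h, ∃ y ∈ Eig (h + 1), φ y = x

variable {φ : T →ₗ[F] T} {Eig : ZMod f → Submodule F T} {A P : ℕ → T →ₗ[F] U}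
  (R : TameRelations p e φ Eig A P)
  (hf : 0 < f) (he : 0 < e) (h0 : p ^ f - 1 ∣ e * digitSum p a 0) (ha : ∀ i, 1 ≤ a i)
  (hne : ∃ i, a i ≠ p) {i : ZMod f} (hi : a (i + 1) = p) {W : Submodule F U}
  (hW : ∀ j, DependentPair p a i j → a (j + 1) ≠ p → ∀ x ∈ Eig (j + 1),
    A (tameExp p e a (j + 1)) x ∈ W)

include R hf he h0 ha

theorem exp_eq_zero_of_lt (h1 : ∃ j, a j ≠ 1) (h : ZMod f) {n : ℕ} (hn : 0 < n) :
    P (tameExp p e a h * n) = 0 := by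
  apply R.exp_eq_zero
  have := (le_mul_tameExp hf h0 he ha h).2 h1
  calc e < (p - 1) * tameExp p e a h := this
    _ ≤ (p - 1) * (tameExp p e a h * n) :=
      Nat.mul_le_mul_left _ (Nat.le_mul_of_pos_right _ hn)

include hi hW

/-- Induction on the distance r to a digit other than p. If a_{i+t+1} ≠ p, then (i, i+t) is
dependent. If it is p, the element is φ(y) and A at m_{i+t+1} of it is -P(y) at m_{i+t+2} - e, which
is a multiple of A(y) at m_{i+t+2} because P vanishes at m_{i+t+1}. -/
theorem eps_mem_of_chain (r : ℕ) : ∀ t s : ℕ, 1 ≤ s → s ≤ t → t ≤ f →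
    (∀ r : ℕ, 2 ≤ r → r ≤ s → a (i + (r : ZMod f)) = p - 1) →
    (∀ r : ℕ, s + 1 ≤ r → r ≤ t → a (i + (r : ZMod f)) = p) →
    a (i + (t : ZMod f) + 1 + (r : ZMod f)) ≠ p →
    ∀ x ∈ Eig (i + (t : ZMod f) + 1), A (tameExp p e a (i + (t : ZMod f) + 1)) x ∈ W := by
  have hp : p.Prime := Fact.out
  have hone : ∃ j, a j ≠ 1 := ⟨i + 1, by rw [hi]; exact hp.one_lt.ne'⟩
  have hdep : ∀ t s : ℕ, 1 ≤ s → s ≤ t → t ≤ f →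
      (∀ r : ℕ, 2 ≤ r → r ≤ s → a (i + (r : ZMod f)) = p - 1) →
      (∀ r : ℕ, s + 1 ≤ r → r ≤ t → a (i + (r : ZMod f)) = p) →
      a (i + (t : ZMod f) + 1) ≠ p →
      ∀ x ∈ Eig (i + (t : ZMod f) + 1), A (tameExp p e a (i + (t : ZMod f) + 1)) x ∈ W := by
    intro t s hs hst htf h2 h3 hap
    refine hW _ ⟨t, by omega, ?_, rfl, hi, hap, s, hs, hst, h2, h3⟩ hap
    rcases htf.lt_or_eq with h | h
    · omega
    · rw [h, ZMod.natCast_self, add_zero] at hap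
      exact absurd hi hap
  induction r with
  | zero =>
    intro t s hs hst htf h2 h3 hr
    rw [Nat.cast_zero, add_zero] at hr
    exact hdep t s hs hst htf h2 h3 hr
  | succ r ih =>
    intro t s hs hst htf h2 h3 hr x hx
    by_cases hap : a (i + (t : ZMod f) + 1) = p
    · obtain ⟨hlt, heq⟩ := tameExp_add_one_of_eq_prime hf h0 he ha hap
      obtain ⟨y, hy, rfl⟩ := R.exists_frob_eq _ x hx
      rw [← heq, R.eps_frob _ (by omega)]
      apply W.neg_mem
      obtain ⟨c, d, hcd⟩ := R.exists_exp_eq (tameExp p e a (i + (t : ZMod f) + 1 + 1) - e)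
        (by omega) _ y hy
      have hz := exp_eq_zero_of_lt R hf he h0 ha hone (i + (t : ZMod f) + 1) one_pos
      rw [mul_one] at hz
      rw [hcd, heq, hz, LinearMap.zero_apply, smul_zero, add_zero, Nat.sub_add_cancel hlt.le]
      apply W.smul_mem
      have hr' : a (i + (t : ZMod f) + 1 + 1 + (r : ZMod f)) ≠ p := by
        rw [Nat.cast_succ] at hr
        rwa [show i + (t : ZMod f) + 1 + 1 + (r : ZMod f) = i + (t : ZMod f) + 1 + ((r : ZMod f) + 1)
          by ring]
      rcases htf.lt_or_eq with h | h
      · have := ih (t + 1) s hs (by omega) (by omega) h2 (fun r hr hrt => by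
          rcases (Nat.le_succ_iff.1 hrt) with h | h
          · exact h3 r hr h
          · rw [h, Nat.succ_eq_add_one, Nat.cast_succ, ← add_assoc]
            exact hap)
        rw [Nat.cast_succ, ← add_assoc i] at this
        exact this hr' y hy
      -- When t = f the index has come round to i + 1, whose digit is p; the next index is that of t
      -- = 1, and the chain restarts there with s = 1.
      · have := ih 1 1 le_rfl le_rfl hf (fun r hr hr1 => by omega) (fun r hr hr1 => by omega)
        rw [h, ZMod.natCast_self, add_zero] at hr' hy ⊢
        rw [Nat.cast_one] at this
        exact this hr' y hy
    · exact hdep t s hs hst htf h2 h3 hap x hx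

include hne

/-- Induction on t through P_n = c A_{n+e} + d P_{pn} φ at n = m_{i+t+1} - e. The first digit p
sends pn to m_{i+1}, where P vanishes; each later digit p - 1 sends pn to the exponent of the
preceding t. -/
theorem exp_mem_of_le_shift (t : ℕ) (ht : 1 ≤ t) (hts : t ≤ shift p a i) :
    e < tameExp p e a (i + (t : ZMod f) + 1) ∧
    ∀ x ∈ Eig (i + (t : ZMod f) + 1), P (tameExp p e a (i + (t : ZMod f) + 1) - e) x ∈ W := by
  have hp : p.Prime := Fact.out
  have hone : ∃ j, a j ≠ 1 := ⟨i + 1, by rw [hi]; exact hp.one_lt.ne'⟩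
  obtain ⟨-, hsf, -, hs⟩ := shift_spec hf hi
  have hA : ∀ t : ℕ, 1 ≤ t → t ≤ shift p a i → ∀ x ∈ Eig (i + (t : ZMod f) + 1),
      A (tameExp p e a (i + (t : ZMod f) + 1)) x ∈ W := by
    intro t ht hts
    have : NeZero f := ⟨hf.ne'⟩
    obtain ⟨j, hj⟩ := hne
    refine eps_mem_of_chain R hf he h0 ha hi hW (j - (i + (t : ZMod f) + 1)).val t t ht le_rfl
      (hts.trans hsf) (fun r hr hrt => hs r hr (hrt.trans hts)) (fun r h1 h2 => by omega) ?_
    rwa [ZMod.natCast_zmod_val, add_sub_cancel]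
  induction t, ht using Nat.le_induction with
  | base =>
    replace hA := hA 1 le_rfl hts
    rw [Nat.cast_one] at hA ⊢
    obtain ⟨hlt, heq⟩ := tameExp_add_one_of_eq_prime hf h0 he ha hi
    refine ⟨hlt, fun x hx => ?_⟩
    obtain ⟨c, d, hcd⟩ := R.exists_exp_eq (tameExp p e a (i + 1 + 1) - e) (by omega) _ x hx
    have hz := exp_eq_zero_of_lt R hf he h0 ha hone (i + 1) one_pos
    rw [mul_one] at hz
    rw [hcd, heq, hz, LinearMap.zero_apply, smul_zero, add_zero, Nat.sub_add_cancel hlt.le]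
    exact W.smul_mem _ (hA x hx)
  | succ t ht ih =>
    replace hA := hA (t + 1) (by omega) hts
    have hap := hs (t + 1) (by omega) hts
    rw [Nat.cast_succ, ← add_assoc i] at hA hap ⊢
    obtain ⟨hlt', ih'⟩ := ih (by omega)
    obtain ⟨hlt, heq⟩ := tameExp_add_one_of_eq_prime_sub_one hf h0 hap hlt'
    refine ⟨hlt, fun x hx => ?_⟩
    obtain ⟨c, d, hcd⟩ := R.exists_exp_eq (tameExp p e a (i + (t : ZMod f) + 1 + 1) - e)
      (by omega) _ x hx
    rw [hcd, heq, Nat.sub_add_cancel hlt.le]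
    exact W.add_mem (W.smul_mem _ (hA x hx)) (W.smul_mem _ (ih' _ (R.frob_mem _ x hx)))

/-- Across a digit p - 1, multiplication by p moves m_h - e one index back. -/
theorem nPrime_mul_pow {k : ℕ} (hk : k < shift p a i) :
    nPrime p e a i * p ^ k =
      tameExp p e a (i + ((shift p a i - k : ℕ) : ZMod f) + 1) - e := by
  obtain ⟨-, hsf, -, hs⟩ := shift_spec hf hi
  induction k with
  | zero => rw [pow_zero, mul_one, nPrime_of_eq hi, Nat.sub_zero]
  | succ k ih =>
    obtain ⟨t, ht⟩ : ∃ t, shift p a i - k = t + 1 := ⟨shift p a i - k - 1, by omega⟩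
    have ht' : shift p a i - (k + 1) = t := by omega
    have hap := hs (t + 1) (by omega) (by omega)
    have hlt := (exp_mem_of_le_shift R hf he h0 ha hne hi hW t (by omega) (by omega)).1
    rw [Nat.cast_succ, ← add_assoc i] at hap
    rw [pow_succ, ← mul_assoc, ih (by omega), ht, ht', mul_comm, Nat.cast_succ, ← add_assoc i,
      (tameExp_add_one_of_eq_prime_sub_one hf h0 hap hlt).2]

theorem nPrime_mul_pow_shift : nPrime p e a i * p ^ shift p a i = tameExp p e a (i + 1) := by
  obtain ⟨hs1, -, -, -⟩ := shift_spec hf hi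
  obtain ⟨s, hs⟩ : ∃ s, shift p a i = s + 1 := ⟨shift p a i - 1, by omega⟩
  have h1 : shift p a i - s = 1 := by omega
  rw [hs, pow_succ, ← mul_assoc, nPrime_mul_pow R hf he h0 ha hne hi hW (by omega), h1, Nat.cast_one,
    mul_comm, (tameExp_add_one_of_eq_prime hf h0 he ha hi).2]

theorem exp_nPrime_mem (k : ℕ) :
    ∀ x ∈ Eig (i + (shift p a i : ZMod f) + 1 - (k : ZMod f)),
      P (nPrime p e a i * p ^ k) x ∈ W := by
  have hp : p.Prime := Fact.out
  intro x hx
  rcases lt_or_ge k (shift p a i) with hk | hk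
  · rw [nPrime_mul_pow R hf he h0 ha hne hi hW hk]
    refine (exp_mem_of_le_shift R hf he h0 ha hne hi hW _ (by omega) (by omega)).2 x ?_
    rw [Nat.cast_sub hk.le]
    convert hx using 2
    ring
  · obtain ⟨r, rfl⟩ := Nat.exists_eq_add_of_le hk
    have hone : ∃ j, a j ≠ 1 := ⟨i + 1, by rw [hi]; exact hp.one_lt.ne'⟩
    rw [pow_add, ← mul_assoc, nPrime_mul_pow_shift R hf he h0 ha hne hi hW,
      exp_eq_zero_of_lt R hf he h0 ha hone _ (pow_pos hp.pos r)]
    exact W.zero_mem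

end DependentSpan

/-! ### Embeddings of l separate the elements of l ⊗ F. -/

section Embeddings

variable {p : ℕ} [Fact p.Prime] {E : Type*} [Field E] [Algebra ℚ_[p] E] [FiniteDimensional ℚ_[p] E]
variable {F : Type*} [Field F]

/-- The evaluation `F ⊗ l → F` at an embedding of `l` in `F`. -/
def evalEmb (σ : resField p E →+* F) : resTensor p E F →ₗ[F] F := linExt σ.toAddMonoidHom

@[simp] theorem evalEmb_one_tmul (σ : resField p E →+* F) (a : resField p E) :
    evalEmb σ ((1 : F) ⊗ₜ[ℤ] a) = σ a := linExt_one_tmul _ _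

theorem evalEmb_mulTensor (σ : resField p E →+* F) (v : resField p E) (x : resTensor p E F) :
    evalEmb σ (mulTensor F v x) = σ v * evalEmb σ x := by
  have : (evalEmb σ).comp (mulTensor F v) = σ v • evalEmb σ := resTensor_ext fun a => by
    rw [LinearMap.comp_apply, tensorMap_tmul, evalEmb_one_tmul, LinearMap.smul_apply,
      evalEmb_one_tmul, AddMonoidHom.coe_mulLeft, map_mul, smul_eq_mul]
  exact LinearMap.congr_fun this x

theorem evalEmb_tensorMap (σ : resField p E →+* F) (h : resField p E →+* resField p E)
    (x : resTensor p E F) :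
    evalEmb σ (tensorMap F h.toAddMonoidHom x) = evalEmb (σ.comp h) x := by
  have : (evalEmb σ).comp (tensorMap F h.toAddMonoidHom) = evalEmb (σ.comp h) :=
    resTensor_ext fun a => by
      rw [LinearMap.comp_apply, tensorMap_tmul, evalEmb_one_tmul, evalEmb_one_tmul]
      rfl
  exact LinearMap.congr_fun this x

/-- The embeddings of `l` in `F` separate the elements of `F ⊗ l`. -/
theorem eq_zero_of_evalEmb_eq_zero [CharP F p] [IsAlgClosed F] {x : resTensor p E F}
    (hx : ∀ σ : resField p E →+* F, evalEmb σ x = 0) : x = 0 := by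
  classical
  let : Algebra (ZMod p) F := ZMod.algebra F p
  have hfin : Module.Finite (ZMod p) (resField p E) := Module.Finite.of_finite
  let v := Module.finBasis (ZMod p) (resField p E)
  let ψ : (Fin (Module.finrank (ZMod p) (resField p E)) → F) →ₗ[F] resTensor p E F :=
    Fintype.linearCombination F fun i => (1 : F) ⊗ₜ[ℤ] v i
  have hψ : Function.Surjective ψ := by
    rw [← LinearMap.range_eq_top, eq_top_iff]
    rintro y -
    induction y using TensorProduct.induction_on with
    | zero => exact zero_mem _
    | add y z hy hz => exact add_mem hy hz
    | tmul b a =>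
      have h1 : b ⊗ₜ[ℤ] a = b • ((1 : F) ⊗ₜ[ℤ] a) := by
        rw [TensorProduct.smul_tmul', smul_eq_mul, mul_one]
      rw [h1]
      apply Submodule.smul_mem
      rw [← v.sum_repr a, TensorProduct.tmul_sum]
      refine Submodule.sum_mem _ fun i _ => ?_
      have h2 : v.repr a i • v i = (v.repr a i).val • v i := by
        conv_lhs => rw [← ZMod.natCast_zmod_val (v.repr a i)]
        rw [Nat.cast_smul_eq_nsmul]
      rw [h2]
      have h3 : (1 : F) ⊗ₜ[ℤ] ((v.repr a i).val • v i) = (v.repr a i).val • ((1 : F) ⊗ₜ[ℤ] v i) :=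
        map_nsmul (TensorProduct.mk ℤ F (resField p E) 1) _ _
      rw [h3]
      apply nsmul_mem
      refine ⟨Pi.single i 1, ?_⟩
      rw [Fintype.linearCombination_apply_single, one_smul]
  obtain ⟨b, rfl⟩ := hψ x
  have hcard : Fintype.card (resField p E →ₐ[ZMod p] F) =
      Fintype.card (Fin (Module.finrank (ZMod p) (resField p E))) := by
    rw [AlgHom.card, Fintype.card_fin]
  let ε := Fintype.equivOfCardEq hcard
  let B : Matrix (Fin (Module.finrank (ZMod p) (resField p E)))
    (Fin (Module.finrank (ZMod p) (resField p E))) F := fun i j => ε.symm i (v j)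
  -- Linear independence of characters. The matrix is square because F is algebraically closed, so
  -- there are as many embeddings as the degree of l.
  have hB : IsUnit B := by
    rw [← Matrix.vecMul_injective_iff_isUnit]
    change Function.Injective (Matrix.vecMulLinear B)
    rw [injective_iff_map_eq_zero]
    intro c hc
    have hli := (linearIndependent_algHom_toLinearMap (ZMod p) (resField p E) F).comp ε.symm
      ε.symm.injective
    ext i
    refine Fintype.linearIndependent_iff.1 hli c (v.ext fun j => ?_) i
    have : ∑ i, c i * ε.symm i (v j) = 0 := congrFun hc j
    simpa using this
  have hb : b = 0 := by
    apply Matrix.mulVec_injective_iff_isUnit.2 hB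
    rw [Matrix.mulVec_zero]
    ext i
    have h1 := hx (ε.symm i : resField p E →+* F)
    rw [Fintype.linearCombination_apply, map_sum] at h1
    simp only [map_smul, evalEmb_one_tmul, smul_eq_mul] at h1
    rw [Matrix.mulVec, dotProduct, Pi.zero_apply, ← h1]
    exact Finset.sum_congr rfl fun j _ => mul_comm _ _
  rw [hb, map_zero]

end Embeddings

/-! ### Galois eigenspaces in l ⊗ F. -/

section Residue

variable {p : ℕ} [Fact p.Prime] {K : Type*} [Field K] [Algebra ℚ_[p] K] [FiniteDimensional ℚ_[p] K]
  {M : Type*} [Field M] [Algebra ℚ_[p] M] [FiniteDimensional ℚ_[p] M] [Algebra K M]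
  [IsScalarTower ℚ_[p] K M]
variable {F : Type*} [Field F]

variable (p K M) in
/-- The inclusion of the residue field of `K` in that of `M`. -/
abbrev resIncl : resField p K →+* resField p M := resMap p (IsScalarTower.toAlgHom ℚ_[p] K M)

variable (p) in
/-- The action of an automorphism of `M` on the residue field. -/
abbrev resAut (g : M ≃ₐ[K] M) : resField p M →+* resField p M :=
  resMap p (g.restrictScalars ℚ_[p] : M →ₐ[ℚ_[p]] M)

theorem resAut_resIncl (g : M ≃ₐ[K] M) (c : resField p K) :
    resAut p g (resIncl p K M c) = resIncl p K M c := by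
  obtain ⟨x, rfl⟩ := residue_surjective c
  rw [resMap_residue, resMap_residue]
  congr 1
  exact Subtype.ext (g.commutes (x : K))

/-- Let α generate l^×. The product of X - g[α] over the Galois group has coefficients fixed by
Galois, so its reduction is defined over k. The image of α under σ₂ is a root of its transport by
σ₁, hence equals σ₁(gα) for some g. -/
theorem exists_comp_resAut_eq [IsGalois K M] {σ₁ σ₂ : resField p M →+* F}
    (h : σ₁.comp (resIncl p K M) = σ₂.comp (resIncl p K M)) :
    ∃ g : M ≃ₐ[K] M, σ₂ = σ₁.comp (resAut p g) := by
  classical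
  have : FiniteDimensional K M := FiniteDimensional.right ℚ_[p] K M
  obtain ⟨α, hα⟩ := IsCyclic.exists_generator (α := (resField p M)ˣ)
  let ι : (M ≃ₐ[K] M) → integers p M → integers p M := fun g =>
    intMap p (g.restrictScalars ℚ_[p] : M →ₐ[ℚ_[p]] M)
  let ζ := teich p M (α : resField p M)
  let P : Polynomial (integers p M) := ∏ g : M ≃ₐ[K] M, (Polynomial.X - Polynomial.C (ι g ζ))
  have hP : ∀ g : M ≃ₐ[K] M,
      P.map (intMap p (g.restrictScalars ℚ_[p] : M →ₐ[ℚ_[p]] M)) = P := by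
    intro g
    simp only [P, Polynomial.map_prod, Polynomial.map_sub, Polynomial.map_X, Polynomial.map_C]
    exact Fintype.prod_equiv (Equiv.mulLeft g) _ _ fun _ => rfl
  have hlift : P.map (residue _) ∈ Polynomial.lifts (resIncl p K M) := by
    rw [Polynomial.lifts_iff_coeff_lifts]
    intro n
    rw [Polynomial.coeff_map]
    have hfix : ∀ g : M ≃ₐ[K] M, g (P.coeff n : M) = P.coeff n := fun g => by
      have := congrArg (fun Q => ((Polynomial.coeff Q n : integers p M) : M)) (hP g)
      simp only [Polynomial.coeff_map] at this
      exact this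
    obtain ⟨c, hc⟩ := (IsGalois.mem_range_algebraMap_iff_fixed (P.coeff n : M)).2 hfix
    let c' : integers p K := ⟨c, by
      rw [mem_integers, ← absv_map p (IsScalarTower.toAlgHom ℚ_[p] K M)]
      change absv p M (algebraMap K M c) ≤ 1
      rw [hc]
      exact (P.coeff n).2⟩
    refine ⟨residue _ c', ?_⟩
    rw [resMap_residue]
    congr 1
    exact Subtype.ext hc
  obtain ⟨Q, hQ⟩ := (Polynomial.mem_lifts _).1 hlift
  have hroot : (Q.map (σ₂.comp (resIncl p K M))).eval (σ₂ α) = 0 := by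
    have hζ : P.eval ζ = 0 := by
      rw [Polynomial.eval_prod]
      refine Finset.prod_eq_zero (Finset.mem_univ 1) ?_
      rw [Polynomial.eval_sub, Polynomial.eval_X, Polynomial.eval_C, sub_eq_zero]
      rfl
    have hα' : (α : resField p M) = residue _ ζ := (residue_teich _).symm
    rw [← Polynomial.map_map, hQ, Polynomial.eval_map, Polynomial.eval₂_hom, hα',
      Polynomial.eval_map, Polynomial.eval₂_hom, hζ, map_zero, map_zero]
  rw [← h, ← Polynomial.map_map, hQ] at hroot
  simp only [P, Polynomial.map_prod, Polynomial.map_sub, Polynomial.map_X, Polynomial.map_C,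
    Polynomial.eval_prod, Polynomial.eval_sub, Polynomial.eval_X, Polynomial.eval_C,
    Finset.prod_eq_zero_iff, sub_eq_zero] at hroot
  obtain ⟨g, -, hg⟩ := hroot
  refine ⟨g, RingHom.ext fun x => ?_⟩
  have hg' : σ₂ α = σ₁ (resAut p g α) := by
    rw [hg]
    congr 1
    rw [← resMap_residue, residue_teich]
  rcases eq_or_ne x 0 with rfl | hx
  · rw [map_zero, map_zero]
  · obtain ⟨n, hn⟩ := mem_powers_iff_mem_zpowers.2 (hα (Units.mk0 x hx))
    have : x = (α : resField p M) ^ n := by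
      rw [← Units.val_pow_eq_pow_val]
      exact (congrArg Units.val hn).symm
    rw [this, map_pow, map_pow, hg', RingHom.comp_apply]

variable (K) in
/-- The subspace of `F ⊗ l` on which `k` acts through `τ` and `Gal(M/K)` through `ν`. -/
def eigenSubmodule (τ : resField p K →+* F) (ν : (M ≃ₐ[K] M) → F) :
    Submodule F (resTensor p M F) where
  carrier := {x | (∀ c, mulTensor F (resIncl p K M c) x = τ c • x) ∧
    ∀ g, tensorMap F (resAut p g).toAddMonoidHom x = ν g • x}
  add_mem' hx hy := ⟨fun c => by rw [map_add, hx.1, hy.1, smul_add],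
    fun g => by rw [map_add, hx.2, hy.2, smul_add]⟩
  zero_mem' := ⟨fun c => by rw [map_zero, smul_zero], fun g => by rw [map_zero, smul_zero]⟩
  smul_mem' r x hx := ⟨fun c => by rw [map_smul, hx.1, smul_comm],
    fun g => by rw [map_smul, hx.2, smul_comm]⟩

variable {τ : resField p K →+* F} {ν : (M ≃ₐ[K] M) → F}

/-- An eigenvector vanishes at the embeddings not above τ. Those above τ form one Galois orbit, so
an eigenvector vanishing at one of them vanishes at all, hence is zero. -/
theorem exists_eq_smul_of_mem_eigenSubmodule [IsGalois K M] [CharP F p] [IsAlgClosed F]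
    {x y : resTensor p M F} (hx : x ∈ eigenSubmodule K τ ν) (hx0 : x ≠ 0)
    (hy : y ∈ eigenSubmodule K τ ν) : ∃ c : F, y = c • x := by
  have hτ : ∀ z ∈ eigenSubmodule K τ ν, ∀ σ : resField p M →+* F,
      σ.comp (resIncl p K M) ≠ τ → evalEmb σ z = 0 := by
    intro z hz σ hσ
    by_contra h0
    apply hσ
    ext c
    have := congrArg (evalEmb σ) (hz.1 c)
    rw [evalEmb_mulTensor, map_smul, smul_eq_mul] at this
    exact mul_right_cancel₀ h0 this
  obtain ⟨σ, hσ⟩ : ∃ σ : resField p M →+* F, evalEmb σ x ≠ 0 := by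
    by_contra! h
    exact hx0 (eq_zero_of_evalEmb_eq_zero h)
  have hσk : σ.comp (resIncl p K M) = τ := by
    by_contra h
    exact hσ (hτ x hx σ h)
  refine ⟨evalEmb σ y / evalEmb σ x, ?_⟩
  rw [← sub_eq_zero]
  set z := y - (evalEmb σ y / evalEmb σ x) • x with hz
  have hzE : z ∈ eigenSubmodule K τ ν := Submodule.sub_mem _ hy (Submodule.smul_mem _ _ hx)
  have hσz : evalEmb σ z = 0 := by
    rw [hz, map_sub, map_smul, smul_eq_mul, div_mul_cancel₀ _ hσ, sub_self]
  refine eq_zero_of_evalEmb_eq_zero fun σ' => ?_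
  by_cases h : σ'.comp (resIncl p K M) = τ
  · obtain ⟨g, rfl⟩ := exists_comp_resAut_eq (hσk.trans h.symm)
    rw [← evalEmb_tensorMap, hzE.2, map_smul, hσz, smul_zero]
  · exact hτ z hzE σ' h

theorem frobTensor_mem_eigenSubmodule {τ' : resField p K →+* F} (hτ : ∀ c, τ' c = τ (c ^ p))
    {x : resTensor p M F} (hx : x ∈ eigenSubmodule K τ' ν) :
    frobTensor p M F x ∈ eigenSubmodule K τ ν := by
  refine ⟨fun c => ?_, fun g => ?_⟩
  · obtain ⟨d, rfl⟩ : ∃ d, d ^ p = c := (bijective_frobenius (resField p K) p).2 c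
    rw [← hτ, ← map_smul, ← hx.1]
    refine tensorMap_comm (fun a => ?_) x
    simp [frobenius_def, mul_pow]
  · rw [← map_smul, ← hx.2]
    refine tensorMap_comm (fun a => ?_) x
    simp [frobenius_def]

theorem exists_frobTensor_eq {τ' : resField p K →+* F} (hτ : ∀ c, τ' c = τ (c ^ p))
    {x : resTensor p M F} (hx : x ∈ eigenSubmodule K τ ν) :
    ∃ y ∈ eigenSubmodule K τ' ν, frobTensor p M F y = x := by
  -- The inverse Frobenius of l only, which leaves the scalars F alone.
  let ρ : resField p M →+* resField p M := (frobeniusEquiv (resField p M) p).symm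
  have hρ : ∀ a : resField p M, ρ a ^ p = a := fun a => frobenius_apply_frobeniusEquiv_symm (resField p M) p a
  have hρ' : ∀ a : resField p M, ρ (a ^ p) = a := fun a => frobeniusEquiv_symm_apply_frobenius (resField p M) p a
  refine ⟨tensorMap F ρ.toAddMonoidHom x, ⟨fun c => ?_, fun g => ?_⟩, ?_⟩
  · rw [hτ, ← map_smul, ← hx.1]
    refine tensorMap_comm (fun a => ?_) x
    change resIncl p K M c * ρ a = ρ (resIncl p K M (c ^ p) * a)
    rw [map_mul, map_pow, hρ']
  · rw [← map_smul, ← hx.2]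
    refine tensorMap_comm (fun a => ?_) x
    change resAut p g (ρ a) = ρ (resAut p g a)
    rw [← hρ' (resAut p g (ρ a)), ← map_pow, hρ]
  · rw [tensorMap_tensorMap]
    exact tensorMap_eq_self (fun a => hρ a) x

/-- Galois multiplies b by κ(g) in k, which acts on the τ-part as the scalar τ(κ(g)). -/
theorem mulTensor_mem_eigenSubmodule {ν' : (M ≃ₐ[K] M) → F} {b : resField p M}
    {κ : (M ≃ₐ[K] M) → resField p K} (hκ : ∀ g, resAut p g b = resIncl p K M (κ g) * b)
    (hν : ∀ g, ν g = τ (κ g) * ν' g) {x : resTensor p M F} (hx : x ∈ eigenSubmodule K τ ν') :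
    mulTensor F b x ∈ eigenSubmodule K τ ν := by
  refine ⟨fun c => ?_, fun g => ?_⟩
  · rw [← map_smul, ← hx.1]
    exact tensorMap_comm (fun a => mul_left_comm _ _ _) x
  · have h1 : tensorMap F (resAut p g).toAddMonoidHom (mulTensor F b x) =
        mulTensor F (resAut p g b) (tensorMap F (resAut p g).toAddMonoidHom x) :=
      tensorMap_comm (fun a => map_mul (resAut p g) b a) x
    have h2 : mulTensor F (resAut p g b) x =
        mulTensor F b (mulTensor F (resIncl p K M (κ g)) x) := by
      rw [hκ, tensorMap_tensorMap]
      refine congrArg (fun h => tensorMap F h x) (AddMonoidHom.ext fun a => ?_)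
      exact (mul_assoc _ _ _).trans (mul_left_comm _ _ _)
    rw [h1, hx.2, map_smul, h2, hx.1, map_smul, smul_smul, hν, mul_comm]

end Residue

/-! ### Periodicity of the embeddings τ_i. -/

section TauPeriodicity

variable {p : ℕ} [Fact p.Prime] {K : Type*} [Field K] [Algebra ℚ_[p] K] [FiniteDimensional ℚ_[p] K]
  {F : Type*} [Field F] {f : ℕ}

theorem tau_natCast (hcard : Nat.card (resField p K) = p ^ f) (τ₀ : resField p K →+* F) (n : ℕ)
    (c : resField p K) : tau p K τ₀ (n : ZMod f) c = τ₀ (c ^ p ^ n) := by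
  have h1 : ∀ q : ℕ, ∀ c : resField p K, c ^ p ^ (f * q) = c := by
    intro q c
    induction q with
    | zero => simp
    | succ q ih => rw [mul_add, mul_one, pow_add, pow_mul, ih, ← hcard, resField_pow_card]
  rw [tau, RingHom.comp_apply, iterateFrobenius_def, ZMod.val_natCast]
  conv_rhs => rw [← Nat.div_add_mod n f, pow_add, pow_mul, h1]

theorem tau_add_one (hcard : Nat.card (resField p K) = p ^ f) (hf : 0 < f)
    (τ₀ : resField p K →+* F) (i : ZMod f) (c : resField p K) :
    tau p K τ₀ (i + 1) c = tau p K τ₀ i (c ^ p) := by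
  have : NeZero f := ⟨hf.ne'⟩
  obtain ⟨n, rfl⟩ := natCast_eq_of_zmod i
  rw [← Nat.cast_succ, tau_natCast hcard, tau_natCast hcard, ← pow_mul, pow_succ']

/-- From p m_{i+1} = m_i + e a_i and c^e = 1. This is why the unramified character μ does not depend
on i. -/
theorem tau_pow_tameExp (hcard : Nat.card (resField p K) = p ^ f) (hf : 0 < f)
    (τ₀ : resField p K →+* F) {a : ZMod f → ℕ} {e : ℕ} (h0 : p ^ f - 1 ∣ e * digitSum p a 0)
    {c : resField p K} (hc : c ^ e = 1) (i : ZMod f) :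
    tau p K τ₀ i c ^ tameExp p e a i = tau p K τ₀ (0 : ZMod f) c ^ tameExp p e a 0 := by
  have : NeZero f := ⟨hf.ne'⟩
  obtain ⟨n, rfl⟩ := natCast_eq_of_zmod i
  induction n with
  | zero => rw [Nat.cast_zero]
  | succ n ih =>
    rw [Nat.cast_succ, tau_add_one hcard hf, map_pow, ← pow_mul, prime_mul_tameExp hf h0, pow_add,
      pow_mul _ e, ← map_pow _ c e, hc, map_one, one_pow, mul_one, ih]

end TauPeriodicity

/-! ### The relations between ε and the exponential maps. -/

section Relations

variable {p : ℕ} [Fact p.Prime] {K : Type*} [Field K] [Algebra ℚ_[p] K] [FiniteDimensional ℚ_[p] K]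
  {M : Type*} [Field M] [Algebra ℚ_[p] M] [FiniteDimensional ℚ_[p] M] [Algebra K M]
  [IsScalarTower ℚ_[p] K M]
variable {F : Type*} [Field F] [CharP F p]
variable {e : ℕ} {ϖ : integers p M}

/-- The prime `p` as a unit of `K` times the `e`-th power of a uniformizer. -/
theorem exists_prime_eq_pow_mul (hK : IsUniformizer p (p : K)) {π : M} (hπ : IsUniformizer p π)
    (hπp : absv p M (p : M) = absv p M π ^ e) (hπe : ∃ c : K, algebraMap K M c = π ^ e) :
    ∃ (v : resField p K) (d : integers p M), v ≠ 0 ∧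
      (p : M) = π ^ e * (teich p M (resIncl p K M v) + p * d : integers p M) := by
  obtain ⟨c, hc⟩ := hπe
  have hc0 : c ≠ 0 := by
    rintro rfl
    rw [map_zero] at hc
    exact pow_ne_zero _ hπ.1 hc.symm
  have habs : absv p K (p / c) = 1 := by
    have h1 : absv p K c = absv p K (p : K) := by
      rw [← absv_map p (IsScalarTower.toAlgHom ℚ_[p] K M)]
      change absv p M (algebraMap K M c) = _
      rw [hc, absv_pow, ← hπp, absv_natCast_prime, absv_natCast_prime]
    rw [absv_div, h1, div_self (absv_natCast_prime_pos p K).ne']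
  let w : integers p K := ⟨p / c, habs.le⟩
  have hw : IsUnit w := integers_isUnit_iff.2 habs
  obtain ⟨d, hd⟩ := exists_eq_teich_add hK w
  refine ⟨residue _ w, intMap p (IsScalarTower.toAlgHom ℚ_[p] K M) d, (hw.map _).ne_zero, ?_⟩
  have h2 : teich p M (resIncl p K M (residue _ w)) +
      p * intMap p (IsScalarTower.toAlgHom ℚ_[p] K M) d =
      intMap p (IsScalarTower.toAlgHom ℚ_[p] K M) w := by
    conv_rhs => rw [hd]
    rw [map_add, map_mul, map_natCast, intMap_teich]
  rw [h2]
  change (p : M) = π ^ e * algebraMap K M (p / c)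
  rw [map_div₀, hc, map_natCast, mul_div_cancel₀ _ (pow_ne_zero _ hπ.1)]

omit [FiniteDimensional ℚ_[p] K] [Algebra K M] [IsScalarTower ℚ_[p] K M] [Algebra ℚ_[p] K]
  [Field K] in
-- [v] ϖ^{n+e} is p ϖ^n times a unit congruent to 1 mod p. Expand E(pz) at z = ϖ^n times that unit;
-- the unit disappears from the exponential classes.
theorem epsLin_mul_teich_of_prime_eq {v : resField p M} (hv : v ≠ 0) {d : integers p M}
    (hϖ1 : absv p M ϖ < 1) (hp : (p : integers p M) = ϖ ^ e * (teich p M v + p * d)) {n : ℕ}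
    (hn : 0 < n) (x : resTensor p M F) :
    epsLin F (ϖ ^ (n + e)) (mulTensor F v x) =
      expLin F (ϖ ^ n) x + ((p ^ (p - 2) : ℕ) : F) • expLin F (ϖ ^ (p * n)) (frobTensor p M F x) := by
  have hpr : p.Prime := Fact.out
  have hu : IsUnit (teich p M v + p * d) := by
    rw [← residue_ne_zero_iff_isUnit]
    have h0 : residue (integers p M) (p : integers p M) = 0 := by
      rw [residue_eq_zero_iff_absv_lt]
      simpa using absv_natCast_prime_lt_one p M
    rw [map_add, map_mul, h0, zero_mul, add_zero, residue_teich]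
    exact hv
  obtain ⟨W, hW⟩ := hu
  -- With W = [v] + p d and ϖ^e = p W⁻¹, one gets [v] ϖ^e = (W - p d) p W⁻¹ = p (1 + p d₀).
  set d₀ : integers p M := -(d * (W⁻¹ : (integers p M)ˣ)) with hd₀
  have hWinv : (W : integers p M) * (W⁻¹ : (integers p M)ˣ) = 1 := W.mul_inv
  have hpe : ϖ ^ e = p * (W⁻¹ : (integers p M)ˣ) := by
    conv_rhs => rw [hp, ← hW]
    linear_combination (-ϖ ^ e) * hWinv
  have hkey : teich p M v * ϖ ^ (n + e) = p * (ϖ ^ n * (1 + p * d₀)) := by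
    rw [pow_add, hd₀]
    rw [← hW] at hp
    have h1 : ϖ ^ e * teich p M v = p - p * (d * ϖ ^ e) := by
      linear_combination -hp - ϖ ^ e * hW
    linear_combination ϖ ^ n * h1 - ϖ ^ n * p * d * hpe
  have hn1 : absv p M (ϖ ^ n : integers p M) < 1 := absv_pow_lt_one hϖ1 hn.ne'
  have hpn1 : absv p M (ϖ ^ (p * n) : integers p M) < 1 :=
    absv_pow_lt_one hϖ1 (Nat.mul_pos hpr.pos hn).ne'
  have hz1 : absv p M (ϖ ^ n * (1 + p * d₀) : integers p M) < 1 :=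
    absv_lt_one_of_dvd hn1 (dvd_mul_right _ _)
  obtain ⟨d₁, hd₁⟩ : (p : integers p M) ∣ (1 + p * d₀) ^ p - 1 := by
    have := sub_dvd_pow_sub_pow (1 + p * d₀) 1 p
    rw [one_pow, add_sub_cancel_left] at this
    exact (dvd_mul_right _ _).trans this
  rw [← epsLin_teich_mul (absv_pow_lt_one hϖ1 (by omega)), hkey, epsLin_prime_mul hz1,
    expLin_congr hn1 (w := ϖ ^ n * (1 + p * d₀)) (d := d₀ * ϖ ^ n) (absv_mul_lt_one_right _ hn1) (by ring),
    expLin_congr hpn1 (w := (ϖ ^ n * (1 + p * d₀)) ^ p) (d := d₁ * ϖ ^ (p * n)) (absv_mul_lt_one_right _ hpn1) (by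
      rw [mul_pow, ← pow_mul, mul_comm n p]
      linear_combination ϖ ^ (p * n) * hd₁)]

theorem tameRelations (hK : IsUniformizer p (p : K)) {f : ℕ}
    (hcard : Nat.card (resField p K) = p ^ f) (hf : 0 < f) (τ₀ : resField p K →+* F)
    (ν : (M ≃ₐ[K] M) → F) {π : M} (hπ : IsUniformizer p π) (hϖ : (ϖ : M) = π)
    (hπp : absv p M (p : M) = absv p M π ^ e) (hπe : ∃ c : K, algebraMap K M c = π ^ e) :
    TameRelations p e (frobTensor p M F) (fun h : ZMod f => eigenSubmodule K (tau p K τ₀ h) ν)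
      (fun n => epsLin F (ϖ ^ n)) (fun n => expLin F (ϖ ^ n)) where
  eps_frob n hn x := by
    have h1 : absv p M ϖ < 1 := hϖ ▸ hπ.2.1
    rw [mul_comm, pow_mul]
    exact epsLin_pow_frobTensor (absv_pow_lt_one h1 hn.ne') x
  exists_exp_eq n hn h x hx := by
    have h1 : absv p M ϖ < 1 := hϖ ▸ hπ.2.1
    obtain ⟨v, d, hv, hvd⟩ := exists_prime_eq_pow_mul hK hπ hπp hπe
    have h2 := epsLin_mul_teich_of_prime_eq (F := F) (ϖ := ϖ) (e := e)
      ((map_ne_zero (resIncl p K M)).2 hv) h1 (d := d) (Subtype.ext (by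
        rw [← hϖ] at hvd
        simpa using hvd)) hn x
    rw [hx.1, map_smul] at h2
    refine ⟨tau p K τ₀ h v, -((p ^ (p - 2) : ℕ) : F), ?_⟩
    rw [h2, neg_smul, add_neg_cancel_right]
  exp_eq_zero n hn := by
    have h1 : absv p M ϖ < 1 := hϖ ▸ hπ.2.1
    have hn0 : n ≠ 0 := by
      rintro rfl
      simp at hn
    refine expLin_eq_zero (absv_pow_lt_one h1 hn0) ?_
    rw [SubmonoidClass.coe_pow, absv_pow, ← pow_mul, hϖ, hπp, mul_comm n]
    exact pow_lt_pow_right_of_lt_one₀ (absv_pos p hπ.1) hπ.2.1 hn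
  frob_mem h x hx := frobTensor_mem_eigenSubmodule (tau_add_one hcard hf τ₀ h) hx
  exists_frob_eq h x hx := exists_frobTensor_eq (tau_add_one hcard hf τ₀ h) hx

end Relations

/-! ### The kernel of the trace of a finite field. -/

section ArtinSchreier

variable {p : ℕ} [Fact p.Prime]

theorem exists_natCast_eq_of_pow_eq {k : Type*} [Field k] [CharP k p] {x : k} (h : x ^ p = x) :
    ∃ n : ℕ, (n : k) = x := by
  let : Algebra (ZMod p) k := ZMod.algebra k p
  have h1 : x ∈ (⊥ : Subfield k) := (Subfield.mem_bot_iff_pow_eq_self k p).2 h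
  obtain ⟨z, hz⟩ := (bot_le : (⊥ : Subfield k) ≤ (algebraMap (ZMod p) k).fieldRange) h1
  refine ⟨z.val, ?_⟩
  rw [← hz]
  conv_rhs => rw [← ZMod.natCast_zmod_val z]
  exact (map_natCast _ _).symm

variable {l : Type*} [Field l] [Finite l] [Algebra (ZMod p) l]

theorem trace_pow_prime (z : l) : Algebra.trace (ZMod p) l (z ^ p) = Algebra.trace (ZMod p) l z := by
  have h := Algebra.trace_eq_of_algEquiv (FiniteField.frobeniusAlgEquivOfAlgebraic (ZMod p) l) z
  rw [← h, FiniteField.coe_frobeniusAlgEquivOfAlgebraic, ZMod.card]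

/-- Additive Hilbert 90 for finite fields. -/
theorem exists_pow_sub_eq_of_trace_eq_zero {z : l} (hz : Algebra.trace (ZMod p) l z = 0) :
    ∃ w : l, w ^ p - w = z := by
  have : Module.Finite (ZMod p) l := Module.Finite.of_finite
  have : CharP l p := charP_of_injective_algebraMap (algebraMap (ZMod p) l).injective p
  let ψ : l →ₗ[ZMod p] l :=
    (FiniteField.frobeniusAlgEquivOfAlgebraic (ZMod p) l).toLinearMap - LinearMap.id
  have hψ : ∀ w, ψ w = w ^ p - w := fun w => by
    simp only [ψ, LinearMap.sub_apply, LinearMap.id_apply, AlgEquiv.toLinearMap_apply,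
      FiniteField.coe_frobeniusAlgEquivOfAlgebraic, ZMod.card]
  have hle : LinearMap.range ψ ≤ LinearMap.ker (Algebra.trace (ZMod p) l) := by
    rintro _ ⟨w, rfl⟩
    rw [LinearMap.mem_ker, hψ, map_sub, trace_pow_prime, sub_self]
  have hker : LinearMap.ker ψ ≤ Submodule.span (ZMod p) {(1 : l)} := by
    intro w hw
    rw [LinearMap.mem_ker, hψ, sub_eq_zero] at hw
    obtain ⟨n, rfl⟩ := exists_natCast_eq_of_pow_eq hw
    rw [Submodule.mem_span_singleton]
    exact ⟨n, by rw [Nat.cast_smul_eq_nsmul, nsmul_one]⟩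
  have h1 := (Submodule.finrank_mono hker).trans (finrank_span_singleton (K := ZMod p) (one_ne_zero (α := l))).le
  have h2 := ψ.finrank_range_add_finrank_ker
  have h3 := (Algebra.trace (ZMod p) l).finrank_range_add_finrank_ker
  have h4 : Module.finrank (ZMod p) (LinearMap.range (Algebra.trace (ZMod p) l)) = 1 := by
    rw [LinearMap.range_eq_top.2 (Algebra.trace_surjective _ _), finrank_top, Module.finrank_self]
  -- The kernel of w ↦ w^p - w is at most a line and the trace is onto the prime field, so the
  -- dimensions agree.
  have heq := Submodule.eq_of_le_of_finrank_le hle (by omega)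
  have hz' : z ∈ LinearMap.range ψ := heq ▸ LinearMap.mem_ker.2 hz
  obtain ⟨w, hw⟩ := hz'
  exact ⟨w, by rw [← hψ, hw]⟩

end ArtinSchreier

/-! ### The exponential map at the boundary exponent m = e/(p-1). -/

section ExpAtBoundary

variable {p : ℕ} [Fact p.Prime]
  {M : Type*} [Field M] [Algebra ℚ_[p] M] [FiniteDimensional ℚ_[p] M]
variable {F : Type*} [Field F] [CharP F p]
variable {e : ℕ} {ϖ : integers p M}

theorem expLin_add {z z' : integers p M} (hz : absv p M z < 1) (hz' : absv p M z' < 1) :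
    expLin F (z + z') = expLin F z + expLin F z' := by
  refine resTensor_ext fun a => ?_
  rw [LinearMap.add_apply, expLin_one_tmul hz, expLin_one_tmul hz',
    expLin_one_tmul (absv_add_lt_one hz hz'), mul_add,
    expCls_add F (absv_mul_lt_one_right _ hz) (absv_mul_lt_one_right _ hz')]

theorem expLin_natCast_mul {z : integers p M} (hz : absv p M z < 1) (n : ℕ) :
    expLin F ((n : integers p M) * z) = (n : F) • expLin F z := by
  refine resTensor_ext fun a => ?_
  rw [LinearMap.smul_apply, expLin_one_tmul hz, expLin_one_tmul (absv_mul_lt_one_right _ hz),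
    mul_left_comm, expCls_natCast_mul F (absv_mul_lt_one_right _ hz)]

variable (p M F) in
/-- The linear extension to `F ⊗ l` of the trace of `l` over the prime field. -/
def traceTensor : resTensor p M F →ₗ[F] F :=
  let _ : Algebra (ZMod p) F := ZMod.algebra F p
  linExt ((algebraMap (ZMod p) F).toAddMonoidHom.comp
    (Algebra.trace (ZMod p) (resField p M)).toAddMonoidHom)

theorem traceTensor_one_tmul (z : resField p M) :
    traceTensor p M F ((1 : F) ⊗ₜ[ℤ] z) = ((Algebra.trace (ZMod p) (resField p M) z).val : F) := by
  let : Algebra (ZMod p) F := ZMod.algebra F p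
  rw [traceTensor, linExt_one_tmul]
  change algebraMap (ZMod p) F (Algebra.trace (ZMod p) (resField p M) z) = _
  conv_lhs => rw [← ZMod.natCast_zmod_val (Algebra.trace (ZMod p) (resField p M) z)]
  exact map_natCast _ _

theorem traceTensor_tensorMap (g : resField p M ≃+* resField p M) (x : resTensor p M F) :
    traceTensor p M F (tensorMap F (g : resField p M →+* resField p M).toAddMonoidHom x) =
      traceTensor p M F x := by
  have : (traceTensor p M F).comp (tensorMap F (g : resField p M →+* resField p M).toAddMonoidHom) =
      traceTensor p M F := resTensor_ext fun a => by
    rw [LinearMap.comp_apply, tensorMap_tmul, traceTensor_one_tmul, traceTensor_one_tmul]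
    congr 2
    exact Algebra.trace_eq_of_algEquiv (AlgEquiv.ofRingEquiv (f := g) fun n => by
      rw [← ZMod.natCast_zmod_val n, map_natCast, map_natCast]) a
  exact LinearMap.congr_fun this x

variable {v : resField p M} (hv : v ≠ 0) {d₁ : integers p M} (hϖ0 : ϖ ≠ 0) (hϖ1 : absv p M ϖ < 1)
  (hp : (p : integers p M) = ϖ ^ e * (teich p M v + p * d₁)) {m : ℕ} (hm : 0 < m)
  (hme : (p - 1) * m = e)

include hv hp in
theorem absv_prime_eq : absv p M (p : M) = absv p M ϖ ^ e := by
  have hu : absv p M (teich p M v + p * d₁ : integers p M) = 1 := by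
    rw [← integers_isUnit_iff, ← residue_ne_zero_iff_isUnit]
    have h0 : residue (integers p M) (p : integers p M) = 0 := by
      rw [residue_eq_zero_iff_absv_lt]
      simpa using absv_natCast_prime_lt_one p M
    rw [map_add, map_mul, h0, zero_mul, add_zero, residue_teich]
    exact hv
  have h1 := congrArg (fun x : integers p M => absv p M (x : M)) hp
  simp only [MulMemClass.coe_mul, SubmonoidClass.coe_pow, absv_mul, hu, mul_one, absv_pow] at h1
  simpa using h1

include hv hϖ0 hϖ1 hp hm hme

theorem expLin_eq_zero_of_lt {n : ℕ} (hn : m < n) : expLin F (ϖ ^ n) = 0 := by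
  have hp2 := (Fact.out : p.Prime).two_le
  have h0 : 0 < absv p M ϖ := absv_pos p fun h => hϖ0 (Subtype.ext h)
  refine expLin_eq_zero (absv_pow_lt_one hϖ1 (by omega)) ?_
  rw [absv_prime_eq hv hp, SubmonoidClass.coe_pow, absv_pow, ← pow_mul, ← hme,
    mul_comm n]
  exact pow_lt_pow_right_of_lt_one₀ h0 hϖ1 (Nat.mul_lt_mul_of_pos_left hn (by omega))

/-- Here p m = m + e, so A_{pm} at v a = b^p can be computed in two ways: it is P_m(a), as P_{pm} =
0, and it is -P_m(b). -/
theorem expLin_add_eq_zero {a b : resField p M} (hb : b ^ p = v * a) :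
    expLin F (ϖ ^ m) ((1 : F) ⊗ₜ[ℤ] (a + b)) = 0 := by
  have hp2 := (Fact.out : p.Prime).two_le
  have hpm : p * m = m + e := by
    rw [← hme]
    nth_rewrite 1 [show p = 1 + (p - 1) by omega]
    ring
  have h1 := epsLin_mul_teich_of_prime_eq (F := F) hv hϖ1 hp hm ((1 : F) ⊗ₜ[ℤ] a)
  rw [expLin_eq_zero_of_lt hv hϖ0 hϖ1 hp hm hme (n := p * m) (by nlinarith), LinearMap.zero_apply,
    smul_zero, add_zero, tensorMap_tmul, AddMonoidHom.coe_mulLeft, ← hb, ← frobTensor_one_tmul,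
    ← hpm, mul_comm p m, pow_mul, epsLin_pow_frobTensor (absv_pow_lt_one hϖ1 hm.ne')] at h1
  rw [TensorProduct.tmul_add, map_add, ← h1, neg_add_cancel]

/-- P_m kills every a + (v a)^{1/p}. A nonzero a with a + (v a)^{1/p} = 0 would be a (p-1)-th root
of -v; without one this additive map of the finite field is injective, hence surjective. -/
theorem expLin_eq_zero_of_forall_ne (h : ∀ d : resField p M, d ≠ 0 → d ^ (p - 1) ≠ -v) :
    expLin F (ϖ ^ m) = 0 := by
  have hp2 := (Fact.out : p.Prime).two_le
  let ρ : resField p M ≃+* resField p M := (frobeniusEquiv (resField p M) p).symm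
  have hρ : ∀ a : resField p M, ρ a ^ p = a :=
    fun a => frobenius_apply_frobeniusEquiv_symm (resField p M) p a
  let ψ : resField p M →+ resField p M :=
    AddMonoidHom.id _ + (ρ : resField p M →+ resField p M).comp (AddMonoidHom.mulLeft v)
  have hψ : ∀ a, ψ a = a + ρ (v * a) := fun a => rfl
  have hinj : Function.Injective ψ := by
    rw [injective_iff_map_eq_zero]
    intro a ha
    by_contra ha0
    refine h a ha0 ?_
    rw [hψ] at ha
    have h1 : a ^ p = -(v * a) := by
      have h2 : (-a) ^ p = v * a := by rw [← eq_neg_of_add_eq_zero_right ha, hρ]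
      have h3 : (-a) ^ p = -(a ^ p) := by
        have := map_neg (frobenius (resField p M) p) a
        simpa [frobenius_def] using this
      rw [← h2, h3, neg_neg]
    have h4 : a ^ (p - 1) * a = -v * a := by
      rw [← pow_succ, Nat.sub_add_cancel (by omega), h1, neg_mul]
    exact mul_right_cancel₀ ha0 h4
  have hsurj := Finite.surjective_of_injective hinj
  refine resTensor_ext fun z => ?_
  obtain ⟨a, rfl⟩ := hsurj z
  rw [hψ, LinearMap.zero_apply]
  exact expLin_add_eq_zero hv hϖ0 hϖ1 hp hm hme (hρ _)

/-- The relation with a = d w^p and b = -d w says that P_m kills d (w^p - w), so P_m(d ·) factors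
through the trace by additive Hilbert 90. -/
theorem expLin_mulTensor_eq {d : resField p M} (hd : d ^ (p - 1) = -v) {b : resField p M}
    (hb : Algebra.trace (ZMod p) (resField p M) b ≠ 0) (x : resTensor p M F) :
    expLin F (ϖ ^ m) (mulTensor F d x) =
      (traceTensor p M F x / traceTensor p M F ((1 : F) ⊗ₜ[ℤ] b)) •
        expLin F (ϖ ^ m) ((1 : F) ⊗ₜ[ℤ] (d * b)) := by
  have hp2 := (Fact.out : p.Prime).two_le
  have hdp : d ^ p = -v * d := by
    rw [← hd, ← pow_succ, Nat.sub_add_cancel (by omega)]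
  have hAS : ∀ w : resField p M, expLin F (ϖ ^ m) ((1 : F) ⊗ₜ[ℤ] (d * (w ^ p - w))) = 0 := by
    intro w
    have h1 : (-(d * w)) ^ p = v * (d * w ^ p) := by
      have := map_neg (frobenius (resField p M) p) (d * w)
      simp only [frobenius_def] at this
      rw [this, mul_pow, hdp]
      ring
    have h2 := expLin_add_eq_zero (F := F) hv hϖ0 hϖ1 hp hm hme h1
    rwa [← sub_eq_add_neg, ← mul_sub] at h2
  let : Algebra (ZMod p) F := ZMod.algebra F p
  have hval : ∀ n : ZMod p, (n.val : F) = algebraMap (ZMod p) F n := fun n => by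
    conv_rhs => rw [← ZMod.natCast_zmod_val n]
    exact (map_natCast _ _).symm
  have htb : traceTensor p M F ((1 : F) ⊗ₜ[ℤ] b) ≠ 0 := by
    rw [traceTensor_one_tmul, hval]
    exact (map_ne_zero _).2 hb
  have key : (expLin F (ϖ ^ m)).comp (mulTensor F d) =
      ((traceTensor p M F ((1 : F) ⊗ₜ[ℤ] b))⁻¹ • traceTensor p M F).smulRight
        (expLin F (ϖ ^ m) ((1 : F) ⊗ₜ[ℤ] (d * b))) := resTensor_ext fun z => by
    set n := Algebra.trace (ZMod p) (resField p M) z / Algebra.trace (ZMod p) (resField p M) b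
      with hn
    obtain ⟨w, hw⟩ := exists_pow_sub_eq_of_trace_eq_zero (p := p) (z := z - n • b) (by
      rw [map_sub, map_smul, smul_eq_mul, hn, div_mul_cancel₀ _ hb, sub_self])
    have hz : d * z = d * (w ^ p - w) + n.val • (d * b) := by
      have h3 : n • b = n.val • b := by
        conv_lhs => rw [← ZMod.natCast_zmod_val n]
        rw [Nat.cast_smul_eq_nsmul]
      rw [h3] at hw
      rw [hw, mul_sub, mul_smul_comm, sub_add_cancel]
    have h4 : (1 : F) ⊗ₜ[ℤ] (n.val • (d * b)) = (n.val : F) • ((1 : F) ⊗ₜ[ℤ] (d * b)) := by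
      rw [Nat.cast_smul_eq_nsmul]
      exact map_nsmul (TensorProduct.mk ℤ F (resField p M) 1) _ _
    rw [LinearMap.comp_apply, tensorMap_tmul, AddMonoidHom.coe_mulLeft, hz, TensorProduct.tmul_add,
      map_add, hAS, zero_add, h4, map_smul, LinearMap.smulRight_apply, LinearMap.smul_apply,
      traceTensor_one_tmul, traceTensor_one_tmul, hval, hval, hval, hn, map_div₀, smul_eq_mul,
      div_eq_inv_mul]
  have := LinearMap.congr_fun key x
  rw [LinearMap.smulRight_apply, LinearMap.smul_apply, smul_eq_mul, ← div_eq_inv_mul] at this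
  exact this

end ExpAtBoundary

/-! ### Approximate (p-1)-th roots of -p and the cyclotomic character. -/

section RootsOfMinusPrime

variable {p : ℕ} [Fact p.Prime] {E : Type*} [Field E] [Algebra ℚ_[p] E]
  [Algebra.IsAlgebraic ℚ_[p] E]

theorem absv_pow_of_add_prime_lt {x : E} {n : ℕ}
    (hx : absv p E (x ^ n + p) < absv p E (p : E)) : absv p E (x ^ n) = absv p E (p : E) := by
  rw [← absv_neg p (p : E)] at hx ⊢
  refine absv_eq_of_sub_lt ?_
  rwa [← absv_neg, neg_sub, sub_neg_eq_add]

/-- Two approximate `(p - 1)`-th roots of `-p` differ by an element of the prime field. -/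
theorem exists_natCast_absv_div_sub_lt {x y : E}
    (hx : absv p E (x ^ (p - 1) + p) < absv p E (p : E))
    (hy : absv p E (y ^ (p - 1) + p) < absv p E (p : E)) :
    absv p E (x / y) = 1 ∧ ∃ n : ℕ, absv p E (x / y - n) < 1 := by
  have hp2 := (Fact.out : p.Prime).two_le
  have hy1 := absv_pow_of_add_prime_lt hy
  have hp0 := absv_natCast_prime_pos p E
  have hy0 : y ^ (p - 1) ≠ 0 := fun h => by
    rw [h, absv_zero] at hy1
    exact hp0.ne hy1
  have h1 : absv p E (x / y) = 1 := by
    have h2 : absv p E (x / y) ^ (p - 1) = 1 := by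
      rw [← absv_pow, div_pow, absv_div, absv_pow_of_add_prime_lt hx, hy1, div_self hp0.ne']
    exact (pow_eq_one_iff_of_nonneg (absv_nonneg p _) (by omega)).1 h2
  refine ⟨h1, ?_⟩
  let t : integers p E := ⟨x / y, h1.le⟩
  have ht : residue _ (t ^ (p - 1)) = residue _ 1 := by
    rw [residue_eq_residue_iff]
    change absv p E ((x / y) ^ (p - 1) - 1) < 1
    have h3 : (x / y) ^ (p - 1) - 1 = ((x ^ (p - 1) + p) - (y ^ (p - 1) + p)) / y ^ (p - 1) := by
      rw [div_pow, eq_div_iff hy0, sub_mul, div_mul_cancel₀ _ hy0]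
      ring
    rw [h3, absv_div, hy1, div_lt_one hp0]
    exact (absv_sub_le p _ _).trans_lt (max_lt hx hy)
  obtain ⟨n, hn⟩ := exists_natCast_eq_of_pow_eq (p := p) (x := residue _ t) (by
    have h4 := congrArg (· * residue (integers p E) t) ht
    simp only [map_pow, map_one, one_mul] at h4
    rwa [← pow_succ, Nat.sub_add_cancel (by omega)] at h4)
  refine ⟨n, ?_⟩
  rw [← map_natCast (residue (integers p E)), eq_comm, residue_eq_residue_iff] at hn
  simpa using hn

/-- Expanding (1 + w)^p = 1 with w = ζ - 1 gives w^{p-1} = -p S with S congruent to 1. -/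
theorem absv_sub_one_pow_add_prime_lt {ζ : E} (hζ : IsPrimitiveRoot ζ p) :
    absv p E ((ζ - 1) ^ (p - 1) + p) < absv p E (p : E) ∧ absv p E (ζ - 1) < 1 := by
  have hp : p.Prime := Fact.out
  set w := ζ - 1 with hw
  have hw0 : w ≠ 0 := sub_ne_zero.2 (hζ.ne_one hp.one_lt)
  have hζ1 : absv p E ζ = 1 := absv_eq_one_of_pow_eq_one hp.ne_zero hζ.pow_eq_one
  have hw1 : absv p E w ≤ 1 := by
    refine (absv_sub_le p _ _).trans (max_le hζ1.le ?_)
    rw [absv_one]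
  set S : E := ∑ k ∈ Finset.Ioo 0 p, w ^ (k - 1) * 1 ^ (p - k - 1) * ((p.choose k / p : ℕ) : E)
    with hS
  have hSle : absv p E S ≤ 1 := by
    refine absv_sum_le _ _ zero_le_one fun k _ => ?_
    rw [one_pow, mul_one, absv_mul, absv_pow]
    exact mul_le_one₀ (pow_le_one₀ (absv_nonneg p _) hw1) (absv_nonneg p _)
      (absv_natCast_le_one p _)
  have hexp : w ^ (p - 1) = -(p * S) := by
    have h1 := add_pow_prime_eq hp w (1 : E)
    rw [hw, sub_add_cancel, hζ.pow_eq_one, ← hw, one_pow, mul_one, ← hS] at h1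
    have h2 : w * (w ^ (p - 1) + p * S) = 0 := by
      rw [mul_add, ← pow_succ', Nat.sub_add_cancel hp.one_le]
      linear_combination -h1
    rw [mul_eq_zero, or_iff_right hw0] at h2
    linear_combination h2
  have hlt : absv p E w < 1 := by
    have h1 : absv p E w ^ (p - 1) < 1 := by
      rw [← absv_pow, hexp, absv_neg, absv_mul]
      exact mul_lt_one_of_nonneg_of_lt_one_left (absv_nonneg p _) (absv_natCast_prime_lt_one p E)
        hSle
    by_contra h
    rw [le_antisymm hw1 (not_lt.1 h), one_pow] at h1
    exact lt_irrefl _ h1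
  refine ⟨?_, hlt⟩
  have hS1 : absv p E (1 - S) < 1 := by
    have h1 : 1 ∈ Finset.Ioo 0 p := Finset.mem_Ioo.2 ⟨one_pos, hp.one_lt⟩
    rw [hS, ← Finset.add_sum_erase _ _ h1]
    simp only [Nat.sub_self, pow_zero, Nat.choose_one_right, Nat.div_self hp.pos, Nat.cast_one,
      mul_one, one_pow, sub_add_cancel_left, absv_neg]
    refine (absv_sum_le _ _ (absv_nonneg p w) fun k hk => ?_).trans_lt hlt
    rw [Finset.mem_erase, Finset.mem_Ioo] at hk
    have h2 : absv p E w ^ (k - 1) ≤ absv p E w :=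
      pow_le_of_le_one (absv_nonneg p _) hw1 (by omega)
    rw [absv_mul, absv_pow]
    exact (mul_le_of_le_one_right (pow_nonneg (absv_nonneg p _) _) (absv_natCast_le_one p _)).trans h2
  rw [hexp, show -((p : E) * S) + p = p * (1 - S) by ring, absv_mul]
  exact mul_lt_of_lt_one_right (absv_natCast_prime_pos p E) hS1

variable {K : Type*} [Field K] [Algebra ℚ_[p] K] [Algebra K E] [IsScalarTower ℚ_[p] K E]

/-- The cyclotomic character is read off the action on an approximate `(p - 1)`-th root of `-p`. -/
theorem exists_forall_apply_eq_pow {ζ₀ : E} (hζ₀ : IsPrimitiveRoot ζ₀ p) {D U : E}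
    (hD : absv p E (D ^ (p - 1) + p) < absv p E (p : E)) {g : E ≃ₐ[K] E} (hg : g D = U * D) :
    ∃ j : ℕ, absv p E (U - j) < 1 ∧ ∀ ζ : E, ζ ^ p = 1 → g ζ = ζ ^ j := by
  have hp : p.Prime := Fact.out
  have : NeZero p := ⟨hp.ne_zero⟩
  obtain ⟨hw, hw1⟩ := absv_sub_one_pow_add_prime_lt hζ₀
  set w := ζ₀ - 1 with hwdef
  have hw0 : w ≠ 0 := sub_ne_zero.2 (hζ₀.ne_one hp.one_lt)
  obtain ⟨ht1, n, hn⟩ := exists_natCast_absv_div_sub_lt hD hw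
  set t := D / w with ht
  have hDt : D = t * w := by rw [ht, div_mul_cancel₀ _ hw0]
  obtain ⟨j, -, hj⟩ := hζ₀.eq_pow_of_pow_eq_one (ξ := g ζ₀) (by
    rw [← map_pow, hζ₀.pow_eq_one, map_one])
  refine ⟨j, ?_, fun ζ hζ => ?_⟩
  · set S := ∑ i ∈ Finset.range j, ζ₀ ^ i with hS
    have hζ1 : absv p E ζ₀ = 1 := absv_eq_one_of_pow_eq_one hp.ne_zero hζ₀.pow_eq_one
    have hpow : ∀ i, absv p E (ζ₀ ^ i - 1) ≤ absv p E w := fun i => by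
      rw [← mul_geom_sum, absv_mul]
      refine mul_le_of_le_one_right (absv_nonneg p _) (absv_sum_le _ _ zero_le_one fun k _ => ?_)
      rw [absv_pow, hζ1, one_pow]
    have hSj : absv p E (S - j) < 1 := by
      have h1 : S - j = ∑ i ∈ Finset.range j, (ζ₀ ^ i - 1) := by
        rw [Finset.sum_sub_distrib, Finset.sum_const, Finset.card_range, nsmul_one]
      rw [h1]
      exact (absv_sum_le _ _ (absv_nonneg p _) fun i _ => hpow i).trans_lt hw1
    -- S is congruent to j, and D = t w with t congruent to an integer, so g(t) is congruent to t.
    -- Comparing both expressions for g(D) gives U ≡ j.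
    have hgw : g w = w * S := by
      rw [hwdef, map_sub, map_one, ← hj, hS, mul_geom_sum]
    have hUt : U * t = S * g t := by
      have h1 : g D = g t * (w * S) := by rw [hDt, map_mul, hgw]
      rw [hg, hDt] at h1
      exact mul_right_cancel₀ hw0 (by linear_combination h1)
    have hgt : absv p E (g t - t) < 1 := by
      have h1 : g t - t = g (t - n) - (t - n) := by
        rw [map_sub, map_natCast]
        ring
      rw [h1]
      refine (absv_sub_le p _ _).trans_lt (max_lt ?_ hn)
      rwa [absv_algEquiv]
    have h2 : absv p E ((U - j) * t) < 1 := by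
      have h1 : (U - j) * t = (S - j) * g t + j * (g t - t) := by linear_combination hUt
      rw [h1]
      refine (absv_add_le p _ _).trans_lt (max_lt ?_ ?_)
      · rwa [absv_mul, absv_algEquiv, ht1, mul_one]
      · rw [absv_mul]
        exact mul_lt_one_of_nonneg_of_lt_one_right (absv_natCast_le_one p _) (absv_nonneg p _) hgt
    rwa [absv_mul, ht1, mul_one] at h2
  · obtain ⟨i, -, rfl⟩ := hζ₀.eq_pow_of_pow_eq_one hζ
    rw [map_pow, ← hj, ← pow_mul, ← pow_mul, mul_comm]

end RootsOfMinusPrime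

/-! ### Boundary terms and the cyclotomic unit. -/

section Cyclotomic

variable {p : ℕ} [Fact p.Prime] {K : Type*} [Field K] [Algebra ℚ_[p] K] [FiniteDimensional ℚ_[p] K]
  {M : Type*} [Field M] [Algebra ℚ_[p] M] [FiniteDimensional ℚ_[p] M] [Algebra K M]
  [IsScalarTower ℚ_[p] K M]
variable {F : Type*} [Field F] [CharP F p]

omit [FiniteDimensional ℚ_[p] K] in
/-- Galois acts on `l` by automorphisms. -/
theorem exists_ringEquiv_resAut (g : M ≃ₐ[K] M) : ∃ ρ : resField p M ≃+* resField p M,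
    (ρ : resField p M →+* resField p M) = resAut p g :=
  ⟨RingEquiv.ofBijective (resAut p g) (Finite.injective_iff_bijective.1 (resAut p g).injective),
    RingHom.ext fun _ => rfl⟩

omit [FiniteDimensional ℚ_[p] K] in
theorem apply_teich (g : M ≃ₐ[K] M) (c : resField p M) :
    g (teich p M c : M) = teich p M (resAut p g c) :=
  congrArg Subtype.val (intMap_teich (p := p) (g.restrictScalars ℚ_[p] : M →ₐ[ℚ_[p]] M) c)

/-- If `x = d x'` is an eigenvector, `d ^ (p - 1) ∈ k` and `x'` has non-zero trace, then the
eigenvalues are in the prime field and describe the action on `d`. -/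
theorem exists_natCast_of_traceTensor_ne_zero {τ : resField p K →+* F} {ν : (M ≃ₐ[K] M) → F}
    {d : resField p M} (hd0 : d ≠ 0) {c : resField p K} (hd : d ^ (p - 1) = resIncl p K M c)
    {x : resTensor p M F} (hx : mulTensor F d x ∈ eigenSubmodule K τ ν)
    (htr : traceTensor p M F x ≠ 0) (g : M ≃ₐ[K] M) :
    ∃ n : ℕ, ν g = n ∧ resAut p g d = n * d := by
  have hp2 := (Fact.out : p.Prime).two_le
  have h1 : (resAut p g d) ^ (p - 1) = d ^ (p - 1) := by
    rw [← map_pow, hd, resAut_resIncl]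
  obtain ⟨n, hn⟩ := exists_natCast_eq_of_pow_eq (p := p) (x := resAut p g d / d) (by
    have h2 : (resAut p g d / d) ^ (p - 1) = 1 := by
      rw [div_pow, h1, div_self (pow_ne_zero _ hd0)]
    have h3 := congrArg (· * (resAut p g d / d)) h2
    simp only [one_mul] at h3
    rwa [← pow_succ, Nat.sub_add_cancel (by omega)] at h3)
  have hgd : resAut p g d = n * d := by rw [hn, div_mul_cancel₀ _ hd0]
  refine ⟨n, ?_, hgd⟩
  have h4 : ν g • mulTensor F d x =
      mulTensor F ((n : resField p M) * d) (tensorMap F (resAut p g).toAddMonoidHom x) := by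
    rw [← hx.2 g, ← hgd]
    exact tensorMap_comm (fun a => map_mul (resAut p g) d a) x
  have h5 : ∀ y : resTensor p M F, mulTensor F d⁻¹ (mulTensor F ((n : resField p M) * d) y) = (n : F) • y := by
    intro y
    have : (mulTensor F d⁻¹).comp (mulTensor F ((n : resField p M) * d)) =
        (n : F) • (LinearMap.id : resTensor p M F →ₗ[F] resTensor p M F) :=
      resTensor_ext fun a => by
        rw [LinearMap.comp_apply, tensorMap_tmul, tensorMap_tmul, LinearMap.smul_apply,
          LinearMap.id_apply, AddMonoidHom.coe_mulLeft, AddMonoidHom.coe_mulLeft,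
          mul_assoc, mul_left_comm, inv_mul_cancel_left₀ hd0, ← nsmul_eq_mul, Nat.cast_smul_eq_nsmul]
        exact map_nsmul (TensorProduct.mk ℤ F (resField p M) 1) _ _
    exact LinearMap.congr_fun this y
  have h6 : mulTensor F d⁻¹ (mulTensor F d x) = x := by
    rw [tensorMap_tensorMap]
    exact tensorMap_eq_self (fun a => inv_mul_cancel_left₀ hd0 a) x
  -- After removing d, the Galois-invariant trace leaves ν(g) tr(x) = n tr(x).
  have h7 := congrArg (fun y => traceTensor p M F (mulTensor F d⁻¹ y)) h4
  obtain ⟨ρ, hρ⟩ := exists_ringEquiv_resAut (p := p) g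
  simp only [map_smul, h5, h6] at h7
  rw [← hρ, traceTensor_tensorMap, smul_eq_mul, smul_eq_mul] at h7
  exact mul_right_cancel₀ htr h7

variable {e m : ℕ} {ϖ : integers p M} {C : Type*} [Field C] [Algebra ℚ_[p] C]
  [Algebra.IsAlgebraic ℚ_[p] C] [IsAlgClosed C] [Algebra K C] [IsScalarTower ℚ_[p] K C]
  [Algebra M C] [IsScalarTower K M C]

omit [CharP F p] in
-- The (p-1)-th power is [-v] ϖ^e, while p is ϖ^e times a unit with residue v, and the residues
-- cancel.
theorem absv_teich_mul_pow_add_prime_lt {v : resField p M} (hv : v ≠ 0) {d₁ : integers p M}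
    (hp : (p : integers p M) = ϖ ^ e * (teich p M v + p * d₁)) (hme : (p - 1) * m = e)
    {d : resField p M} (hd : d ^ (p - 1) = -v) :
    absv p M ((teich p M d * ϖ ^ m : integers p M) ^ (p - 1) + (p : M)) < absv p M (p : M) := by
  have h1 : ((teich p M d * ϖ ^ m : integers p M) : M) ^ (p - 1) + (p : M) =
      (ϖ ^ e : integers p M) * (teich p M (-v) + teich p M v + p * d₁ : integers p M) := by
    have h2 : (teich p M d * ϖ ^ m) ^ (p - 1) + (p : integers p M) =
        ϖ ^ e * (teich p M (-v) + teich p M v + p * d₁) := by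
      conv_lhs => rw [hp, mul_pow, ← teich_pow, hd, ← pow_mul, mul_comm m, hme]
      ring
    have := congrArg Subtype.val h2
    simpa using this
  rw [h1, absv_mul, absv_prime_eq hv hp, SubmonoidClass.coe_pow, absv_pow, ← absv_pow,
    ← SubmonoidClass.coe_pow]
  refine mul_lt_of_lt_one_right ?_ ?_
  · apply absv_pos
    intro h
    have h3 : ϖ ^ e = 0 := Subtype.ext h
    rw [h3, zero_mul] at hp
    exact natCast_prime_ne_zero p M (by simpa using congrArg Subtype.val hp)
  · rw [← residue_eq_zero_iff_absv_lt, map_add, map_add, map_mul, residue_teich, residue_teich,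
      neg_add_cancel, zero_add, map_natCast, CharP.cast_eq_zero, zero_mul]

variable [IsGalois K M]

/-- Nonzero trace puts ν(g) in the prime field and makes g act on d by the same scalar n. So g
multiplies the approximate root [d] ϖ^m of -p by n κ(g)^m up to congruence, which is the cyclotomic
value; its image under τ is ν(g) τ(κ(g))^m = χ(g). -/
theorem isCyclotomic_of_traceTensor_ne_zero {v : resField p K} (hv : v ≠ 0) {d₁ : integers p M}
    (hp : (p : integers p M) = ϖ ^ e * (teich p M (resIncl p K M v) + p * d₁))
    (hme : (p - 1) * m = e) {d : resField p M} (hd0 : d ≠ 0)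
    (hd : d ^ (p - 1) = -resIncl p K M v) {κ : (M ≃ₐ[K] M) → resField p K}
    (hκ : ∀ g : M ≃ₐ[K] M, g (ϖ : M) = algebraMap K M (teich p K (κ g)) * ϖ)
    (hκ0 : ∀ g, κ g ≠ 0) {τ : resField p K →+* F} {χ : (C ≃ₐ[K] C) →* Fˣ} {χ' : (M ≃ₐ[K] M) → F}
    (hχ : ∀ g : C ≃ₐ[K] C, (χ g : F) = χ' (AlgEquiv.restrictNormal g M)) {x : resTensor p M F}
    (hx : mulTensor F d x ∈ eigenSubmodule K τ (fun g => χ' g * (τ (κ g) ^ m)⁻¹))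
    (htr : traceTensor p M F x ≠ 0) : IsCyclotomic p χ := by
  have : NeZero p := ⟨(Fact.out : p.Prime).ne_zero⟩
  have : NeZero (p : C) := ⟨natCast_prime_ne_zero p C⟩
  have : IsScalarTower ℚ_[p] M C := IsScalarTower.of_algebraMap_eq fun x => by
    rw [IsScalarTower.algebraMap_apply ℚ_[p] K C, IsScalarTower.algebraMap_apply ℚ_[p] K M,
      IsScalarTower.algebraMap_apply K M C]
  have habs : ∀ y : M, absv p C (algebraMap M C y) = absv p M y :=
    absv_map p (IsScalarTower.toAlgHom ℚ_[p] M C)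
  obtain ⟨ζ₀, hζ₀⟩ := HasEnoughRootsOfUnity.exists_primitiveRoot C p
  intro g
  set σ := AlgEquiv.restrictNormal g M with hσ
  have hgM : ∀ y : M, g (algebraMap M C y) = algebraMap M C (σ y) :=
    fun y => (AlgEquiv.restrictNormal_commutes g M y).symm
  obtain ⟨n, hn, hdn⟩ := exists_natCast_of_traceTensor_ne_zero hd0 (c := -v)
    (by rw [hd, map_neg]) hx htr σ
  have hD := absv_teich_mul_pow_add_prime_lt ((map_ne_zero (resIncl p K M)).2 hv) hp hme hd
  rw [← habs, ← habs p, map_add, map_pow, map_natCast] at hD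
  have hU : g (algebraMap M C (teich p M d * ϖ ^ m : integers p M)) =
      algebraMap M C (teich p M (n * resIncl p K M (κ σ) ^ m)) *
        algebraMap M C (teich p M d * ϖ ^ m : integers p M) := by
    rw [hgM, ← map_mul]
    congr 1
    have h1 : algebraMap K M (teich p K (κ σ)) = teich p M (resIncl p K M (κ σ)) :=
      congrArg Subtype.val (intMap_teich (IsScalarTower.toAlgHom ℚ_[p] K M) (κ σ))
    rw [MulMemClass.coe_mul, map_mul, apply_teich, hdn, SubmonoidClass.coe_pow, map_pow, hκ, h1]
    simp only [teich_mul, teich_pow, MulMemClass.coe_mul, SubmonoidClass.coe_pow]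
    ring
  obtain ⟨j, hj, hζ⟩ := exists_forall_apply_eq_pow hζ₀ hD hU
  refine ⟨j, ?_, hζ⟩
  have h0 : residue (integers p M) (teich p M (n * resIncl p K M (κ σ) ^ m)) =
      residue (integers p M) (j : integers p M) := by
    rw [residue_eq_residue_iff]
    rw [← map_natCast (algebraMap M C), ← map_sub, habs] at hj
    simpa using hj
  have h1 : (n : resField p K) * κ σ ^ m = j := by
    apply (resIncl p K M).injective
    rw [residue_teich, map_natCast] at h0
    rw [map_mul, map_pow, map_natCast, map_natCast, h0]
  rw [hχ, ← map_natCast τ, ← h1, map_mul, map_natCast, map_pow, ← hn,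
    inv_mul_cancel_right₀ (pow_ne_zero _ ((map_ne_zero τ).2 (hκ0 σ)))]

omit [IsGalois K M] [IsAlgClosed C] [Algebra M C] [IsScalarTower K M C] [Algebra.IsAlgebraic ℚ_[p] C]
  [Algebra ℚ_[p] C] [IsScalarTower ℚ_[p] K C] [Algebra K C] [Field C] in
-- By E(x)^p = E(x^p) exp(px), u_cyc is minus the exponential class at δ of the p-th root of b.
-- Modulo a term too small to matter, δ is a nonzero integer multiple of [d] ϖ^m, so both sides are
-- multiples of one class.
theorem expLin_mem_span_cycUnit {v : resField p M} (hv : v ≠ 0) {d₁ : integers p M}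
    (hϖ0 : ϖ ≠ 0) (hϖ1 : absv p M ϖ < 1)
    (hp : (p : integers p M) = ϖ ^ e * (teich p M v + p * d₁)) (hm : 0 < m)
    (hme : (p - 1) * m = e) {d : resField p M}
    (hd : d ^ (p - 1) = -v) {δ : M} (hδ : δ ^ (p - 1) = -(p : M)) {b : resField p M}
    (hb : Algebra.trace (ZMod p) (resField p M) b ≠ 0) (x : resTensor p M F) :
    expLin F (ϖ ^ m) (mulTensor F d x) ∈ Submodule.span F {cycUnit p M F δ b} := by
  have hp2 := (Fact.out : p.Prime).two_le
  obtain ⟨b, rfl⟩ : ∃ b₁, b₁ ^ p = b := (bijective_frobenius (resField p M) p).2 b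
  rw [trace_pow_prime] at hb
  rw [expLin_mulTensor_eq hv hϖ0 hϖ1 hp hm hme hd hb]
  apply Submodule.smul_mem
  have hδ1 : absv p M δ < 1 := by
    by_contra h
    have h1 : 1 ≤ absv p M δ ^ (p - 1) := one_le_pow₀ (not_lt.1 h)
    rw [← absv_pow, hδ, absv_neg] at h1
    exact absurd (absv_natCast_prime_lt_one p M) h1.not_gt
  have hδ2 : absv p M (δ ^ (p - 1) + p) < absv p M (p : M) := by
    rw [hδ, neg_add_cancel, absv_zero]
    exact absv_natCast_prime_pos p M
  let δ₀ : integers p M := ⟨δ, hδ1.le⟩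
  have hδ₀ : absv p M δ₀ < 1 := hδ1
  set D : integers p M := teich p M d * ϖ ^ m with hDdef
  have hD := absv_teich_mul_pow_add_prime_lt hv hp hme hd
  have hD1 : absv p M D < 1 := absv_mul_lt_one_right _ (absv_pow_lt_one hϖ1 hm.ne')
  have hDp := absv_pow_of_add_prime_lt hD
  have hD0 : (D : M) ≠ 0 := fun h => by
    rw [h, zero_pow (by omega), absv_zero] at hDp
    exact (absv_natCast_prime_pos p M).ne hDp
  obtain ⟨h1, n, hn⟩ := exists_natCast_absv_div_sub_lt hδ2 hD
  have hn0 : (n : F) ≠ 0 := by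
    rw [Ne, CharP.cast_eq_zero_iff F p, ← CharP.cast_eq_zero_iff (resField p M) p]
    intro h0
    rw [← map_natCast (residue (integers p M)), residue_eq_zero_iff_absv_lt] at h0
    have h2 := absv_add_le p (δ / D - n) (n : M)
    rw [sub_add_cancel, h1] at h2
    exact absurd h2 (not_le.2 (max_lt hn (by simpa using h0)))
  have hr : absv p M (δ₀ - (n : integers p M) * D : integers p M) < absv p M D := by
    have h2 : ((δ₀ - (n : integers p M) * D : integers p M) : M) = (δ / D - n) * D := by
      rw [sub_mul, div_mul_cancel₀ _ hD0]
      simp [δ₀]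
    rw [h2, absv_mul]
    exact mul_lt_of_lt_one_left (absv_pos p hD0) hn
  have hr0 : expLin F (δ₀ - (n : integers p M) * D) = 0 := by
    refine expLin_eq_zero (hr.trans hD1) ?_
    rw [← hDp, absv_pow]
    exact pow_lt_pow_left₀ hr (absv_nonneg p _) (by omega)
  have hcyc : cycUnit p M F δ (b ^ p) =
      -((n : F) • expLin F (ϖ ^ m) ((1 : F) ⊗ₜ[ℤ] (d * b))) := by
    have h3 : δ ^ p = ((δ₀ ^ p : integers p M) : M) := rfl
    rw [cycUnit, h3, eps_eq_epsLin (absv_pow_lt_one hδ₀ (by omega)), ← frobTensor_one_tmul,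
      epsLin_pow_frobTensor hδ₀, ← add_sub_cancel ((n : integers p M) * D) δ₀,
      expLin_add (absv_mul_lt_one_right _ hD1) (hr.trans hD1), hr0, add_zero,
      expLin_natCast_mul hD1, LinearMap.smul_apply, hDdef,
      expLin_teich_mul (absv_pow_lt_one hϖ1 hm.ne'), tensorMap_tmul, AddMonoidHom.coe_mulLeft]
  rw [Submodule.mem_span_singleton]
  refine ⟨-(n : F)⁻¹, ?_⟩
  rw [hcyc, smul_neg, neg_smul, neg_neg, smul_smul, inv_mul_cancel₀ hn0, one_smul]

/-- The exponential terms at the boundary of convergence vanish unless the character is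
cyclotomic, when they are multiples of the cyclotomic unit. -/
theorem expLin_mem_of_mem_eigenSubmodule {v : resField p K} (hv : v ≠ 0) {d₁ : integers p M}
    (hϖ0 : ϖ ≠ 0) (hϖ1 : absv p M ϖ < 1)
    (hp : (p : integers p M) = ϖ ^ e * (teich p M (resIncl p K M v) + p * d₁)) (hm : 0 < m)
    (hme : (p - 1) * m = e) {κ : (M ≃ₐ[K] M) → resField p K}
    (hκ : ∀ g : M ≃ₐ[K] M, g (ϖ : M) = algebraMap K M (teich p K (κ g)) * ϖ)
    (hκ0 : ∀ g, κ g ≠ 0) {τ : resField p K →+* F} {χ : (C ≃ₐ[K] C) →* Fˣ} {χ' : (M ≃ₐ[K] M) → F}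
    (hχ : ∀ g : C ≃ₐ[K] C, (χ g : F) = χ' (AlgEquiv.restrictNormal g M))
    {δ : M} {b : resField p M}
    (hcyc : IsCyclotomic p χ → δ ^ (p - 1) = -(p : M) ∧ Algebra.trace (ZMod p) (resField p M) b ≠ 0)
    {x : resTensor p M F}
    (hx : x ∈ eigenSubmodule K τ (fun g => χ' g * (τ (κ g) ^ m)⁻¹)) :
    expLin F (ϖ ^ m) x ∈
      Submodule.span F {u | IsCyclotomic p χ ∧ u = cycUnit p M F δ b} := by
  have hv' := (map_ne_zero (resIncl p K M)).2 hv
  by_cases hex : ∃ d : resField p M, d ≠ 0 ∧ d ^ (p - 1) = -resIncl p K M v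
  · obtain ⟨d, hd0, hd⟩ := hex
    obtain ⟨y, rfl⟩ : ∃ y, x = mulTensor F d y := ⟨mulTensor F d⁻¹ x, by
      rw [tensorMap_tensorMap]
      exact (tensorMap_eq_self (fun a => mul_inv_cancel_left₀ hd0 a) x).symm⟩
    by_cases htr : traceTensor p M F y = 0
    -- The given b is only known to have nonzero trace when χ is cyclotomic; with trace zero on the
    -- other factor, any b' will do.
    · obtain ⟨b', hb'⟩ : ∃ b', Algebra.trace (ZMod p) (resField p M) b' ≠ 0 := by
        have : Module.Finite (ZMod p) (resField p M) := Module.Finite.of_finite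
        obtain ⟨b', hb'⟩ := Algebra.trace_surjective (ZMod p) (resField p M) 1
        exact ⟨b', hb' ▸ one_ne_zero⟩
      rw [expLin_mulTensor_eq hv' hϖ0 hϖ1 hp hm hme hd hb', htr, zero_div, zero_smul]
      exact zero_mem _
    · have hc := isCyclotomic_of_traceTensor_ne_zero hv hp hme hd0 hd hκ hκ0 hχ hx htr
      obtain ⟨hδ, hb⟩ := hcyc hc
      refine Submodule.span_mono ?_ (expLin_mem_span_cycUnit hv' hϖ0 hϖ1 hp hm hme hd hδ hb y)
      rintro _ rfl
      exact ⟨hc, rfl⟩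
  · push Not at hex
    rw [expLin_eq_zero_of_forall_ne hv' hϖ0 hϖ1 hp hm hme hex, LinearMap.zero_apply]
    exact zero_mem _

end Cyclotomic

/-! ### Positivity of n_i' and independence of μ from i. -/

section Exponents

variable {p f : ℕ} [Fact p.Prime] {a : ZMod f → ℕ} {e : ℕ}

theorem lt_tameExp_shift (hf : 0 < f) (h0 : p ^ f - 1 ∣ e * digitSum p a 0) (he : 0 < e)
    (ha : ∀ i, 1 ≤ a i) {i : ZMod f} (hi : a (i + 1) = p) :
    e < tameExp p e a (i + (shift p a i : ZMod f) + 1) := by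
  obtain ⟨hs1, -, -, hs⟩ := shift_spec hf hi
  have : ∀ t : ℕ, 1 ≤ t → t ≤ shift p a i → e < tameExp p e a (i + (t : ZMod f) + 1) := by
    intro t ht hts
    induction t, ht using Nat.le_induction with
    | base =>
      rw [Nat.cast_one]
      exact (tameExp_add_one_of_eq_prime hf h0 he ha hi).1
    | succ t ht ih =>
      have hap := hs (t + 1) (by omega) hts
      rw [Nat.cast_succ, ← add_assoc i] at hap ⊢
      exact (tameExp_add_one_of_eq_prime_sub_one hf h0 hap (ih (by omega))).1
  exact this _ hs1 le_rfl

theorem nPrime_pos (hf : 0 < f) (h0 : p ^ f - 1 ∣ e * digitSum p a 0) (he : 0 < e)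
    (ha : ∀ i, 1 ≤ a i) (i : ZMod f) : 0 < nPrime p e a i := by
  by_cases hi : a (i + 1) = p
  · rw [nPrime_of_eq hi]
    exact Nat.sub_pos_of_lt (lt_tameExp_shift hf h0 he ha hi)
  · rw [(nPrime_of_ne hi).2]
    exact tameExp_pos hf h0 he ha _

theorem mul_tameExp_of_forall_eq_one (hf : 0 < f) (h0 : p ^ f - 1 ∣ e * digitSum p a 0)
    (ha : ∀ i, a i = 1) (i : ZMod f) : (p - 1) * tameExp p e a i = e := by
  have h1 := prime_mul_tameExp hf h0 i
  have h2 : tameExp p e a (i + 1) = tameExp p e a i := by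
    simp only [tameExp, digitSum, ha]
  rw [h2, ha, mul_one] at h1
  rw [Nat.sub_mul, one_mul, h1, Nat.add_sub_cancel_left]

variable {K : Type*} [Field K] [Algebra ℚ_[p] K] [FiniteDimensional ℚ_[p] K]
  {F : Type*} [Field F]

/-- Subtracting e from the exponent is harmless because c^e = 1, so the case a_{i+1} = p reduces to
`tau_pow_tameExp`. -/
theorem tau'_pow_nPrime (hcard : Nat.card (resField p K) = p ^ f) (hf : 0 < f)
    (τ₀ : resField p K →+* F) (h0 : p ^ f - 1 ∣ e * digitSum p a 0) (he : 0 < e)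
    (ha : ∀ i, 1 ≤ a i) {c : resField p K} (hc : c ^ e = 1) (i : ZMod f) :
    tau' p K τ₀ a i c ^ nPrime p e a i = tau p K τ₀ (0 : ZMod f) c ^ tameExp p e a 0 := by
  rw [tau']
  by_cases hi : a (i + 1) = p
  · rw [nPrime_of_eq hi, ← tau_pow_tameExp hcard hf τ₀ h0 hc (i + (shift p a i : ZMod f) + 1)]
    conv_rhs => rw [← Nat.sub_add_cancel (lt_tameExp_shift hf h0 he ha hi).le, pow_add,
      ← map_pow _ c e, hc, map_one, mul_one]
  · obtain ⟨hs, hn⟩ := nPrime_of_ne (e := e) hi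
    rw [hs, hn, Nat.cast_zero, add_zero, tau_pow_tameExp hcard hf τ₀ h0 hc]

end Exponents

/-! ### Effect of a principal unit and of a Teichmüller factor. -/

section ChangeOfUniformizer

variable {p : ℕ} [Fact p.Prime] {K : Type*} [Field K] [Algebra ℚ_[p] K] [FiniteDimensional ℚ_[p] K]
  {M : Type*} [Field M] [Algebra ℚ_[p] M] [FiniteDimensional ℚ_[p] M] [Algebra K M]
  [IsScalarTower ℚ_[p] K M]
variable {F : Type*} [Field F] [CharP F p]

omit [CharP F p] in
theorem iterate_frobTensor_mem_eigenSubmodule {f : ℕ} (hcard : Nat.card (resField p K) = p ^ f)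
    (hf : 0 < f) {τ₀ : resField p K →+* F} {ν : (M ≃ₐ[K] M) → F} {h : ZMod f}
    {x : resTensor p M F} (hx : x ∈ eigenSubmodule K (tau p K τ₀ h) ν) (k : ℕ) :
    (frobTensor p M F)^[k] x ∈ eigenSubmodule K (tau p K τ₀ (h - (k : ZMod f))) ν := by
  induction k with
  | zero => simpa using hx
  | succ k ih =>
    rw [Function.iterate_succ_apply']
    refine frobTensor_mem_eigenSubmodule (tau_add_one hcard hf τ₀ _) ?_
    rwa [Nat.cast_succ, sub_add_eq_sub_sub, sub_add_cancel]

/-- Multiplying the argument of `ε` by a principal unit of `K`. -/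
theorem epsLin_mul_intMap_sub_mem (hK : IsUniformizer p (p : K)) {f : ℕ}
    (hcard : Nat.card (resField p K) = p ^ f) (hf : 0 < f) {τ₀ : resField p K →+* F}
    {ν : (M ≃ₐ[K] M) → F} {h : ZMod f} {x : resTensor p M F}
    (hx : x ∈ eigenSubmodule K (tau p K τ₀ h) ν) {y : integers p K}
    (hy : (p : integers p K) ∣ y - 1) {z : integers p M} (hz : absv p M z < 1)
    {W : Submodule F (unitTensor p M F)}
    (hW : ∀ k, expLin F (z ^ p ^ k) ((frobTensor p M F)^[k] x) ∈ W) :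
    epsLin F (z * intMap p (IsScalarTower.toAlgHom ℚ_[p] K M) y) x - epsLin F z x ∈ W := by
  have hp2 := (Fact.out : p.Prime).two_le
  have h1 : ∀ n, ∃ c : integers p K, y ^ p ^ n - 1 = (p : integers p K) ^ (n + 1) * c := fun n => by
    have := dvd_sub_pow_of_dvd_sub hy n
    rwa [one_pow] at this
  choose c hc using h1
  choose d hd using fun n => exists_eq_teich_add hK (c n)
  obtain ⟨n, hn⟩ := exists_pow_lt_of_lt_one (absv_natCast_prime_pos p M) hz
  rw [epsLin_mul hz (c := fun n => intMap p (IsScalarTower.toAlgHom ℚ_[p] K M) (c n))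
    (ζ := fun n => resIncl p K M (residue _ (c n))) (n := n), add_sub_cancel_left]
  · refine W.sum_mem fun k _ => ?_
    rw [(iterate_frobTensor_mem_eigenSubmodule hcard hf hx k).1, map_smul]
    exact W.smul_mem _ (hW k)
  · intro n
    rw [← map_pow, ← add_sub_cancel 1 (y ^ p ^ n), hc, map_add, map_one, map_mul, map_pow,
      map_natCast]
  · intro n
    refine ⟨intMap p (IsScalarTower.toAlgHom ℚ_[p] K M) (d n), ?_⟩
    have h1 := congrArg (intMap p (IsScalarTower.toAlgHom ℚ_[p] K M)) (hd n)
    rw [map_add, map_mul, map_natCast, intMap_teich] at h1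
    linear_combination h1
  · refine lt_of_le_of_lt ?_ hn
    rw [SubmonoidClass.coe_pow, absv_pow]
    exact pow_le_pow_of_le_one (absv_nonneg p _) hz.le (Nat.lt_pow_self hp2).le

theorem resAut_eq_of_eq_mul {π π' : M} (hπ : π ≠ 0) {b : resField p M}
    {y : K} (hy : y ≠ 0) (h : π' = teich p M b * π * algebraMap K M y) {g : M ≃ₐ[K] M} {κ κ' : resField p K}
    (hκ0 : κ ≠ 0) (hκ : g π = algebraMap K M (teich p K κ) * π)
    (hκ' : g π' = algebraMap K M (teich p K κ') * π') :
    resAut p g b = resIncl p K M (κ' / κ) * b := by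
  have h1 : ∀ c : resField p K, algebraMap K M (teich p K c) = teich p M (resIncl p K M c) :=
    fun c => congrArg Subtype.val (intMap_teich (IsScalarTower.toAlgHom ℚ_[p] K M) c)
  have hy' : algebraMap K M y ≠ 0 := (map_ne_zero _).2 hy
  rw [h, map_mul, map_mul, AlgEquiv.commutes, apply_teich, hκ, h1, h1] at hκ'
  have h2 : teich p M (resAut p g b * resIncl p K M κ) = teich p M (resIncl p K M κ' * b) := by
    apply Subtype.ext
    simp only [teich_mul, MulMemClass.coe_mul]
    apply mul_right_cancel₀ (mul_ne_zero hπ hy')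
    linear_combination hκ'
  have h3 := teich_injective h2
  rw [map_div₀, div_mul_eq_mul_div, eq_div_iff ((map_ne_zero _).2 hκ0), h3]

end ChangeOfUniformizer

/-! ### The vectors λ_i as eigenvectors for Gal(M/K). -/

section Eigenvectors

variable {p : ℕ} [Fact p.Prime] {K : Type*} [Field K] [Algebra ℚ_[p] K] [FiniteDimensional ℚ_[p] K]
  {C : Type*} [Field C] [Algebra K C]
  {M : Type*} [Field M] [Algebra ℚ_[p] M] [FiniteDimensional ℚ_[p] M] [Algebra K M]
  [IsScalarTower ℚ_[p] K M] [Algebra M C] [IsScalarTower K M C] [Normal K M]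
variable {F : Type*} [Field F]

theorem exists_eq_restrictNormal [Normal K C] {χ : (C ≃ₐ[K] C) →* Fˣ}
    (hχM : ∀ g : C ≃ₐ[K] C, (∀ x : M, g (algebraMap M C x) = algebraMap M C x) → χ g = 1) :
    ∃ χ' : (M ≃ₐ[K] M) → F, ∀ g, (χ g : F) = χ' (AlgEquiv.restrictNormal g M) := by
  have hsurj : Function.Surjective fun g : C ≃ₐ[K] C => AlgEquiv.restrictNormal g M :=
    AlgEquiv.restrictNormalHom_surjective C
  choose s hs using hsurj
  refine ⟨fun σ => χ (s σ), fun g => ?_⟩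
  set h := s (AlgEquiv.restrictNormal g M) with hh
  have hgh : ∀ x : M, h (algebraMap M C x) = g (algebraMap M C x) := fun x => by
    rw [← AlgEquiv.restrictNormal_commutes g M x, ← AlgEquiv.restrictNormal_commutes h M x]
    exact congrArg (fun ρ : M ≃ₐ[K] M => algebraMap M C (ρ x)) (hs _)
  have h1 : χ (h⁻¹ * g) = 1 := hχM _ fun x => by
    rw [AlgEquiv.mul_apply, ← hgh]
    exact h.symm_apply_apply _
  rw [map_mul, map_inv, inv_mul_eq_one] at h1
  exact congrArg Units.val h1.symm

/-- The eigencharacter is rewritten with exponent m_0 and embedding τ_0, so that all λ_i, and the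
spaces in `TameRelations`, carry the same character. -/
theorem IsEigenvector.mem_eigenSubmodule [Normal K C] {f : ℕ}
    (hcard : Nat.card (resField p K) = p ^ f) (hf : 0 < f) {τ₀ : resField p K →+* F}
    {a : ZMod f → ℕ} {e : ℕ} (h0 : p ^ f - 1 ∣ e * digitSum p a 0) (he : 0 < e)
    (ha : ∀ i, 1 ≤ a i) {χ : (C ≃ₐ[K] C) →* Fˣ} {χ' : (M ≃ₐ[K] M) → F}
    (hχ : ∀ g, (χ g : F) = χ' (AlgEquiv.restrictNormal g M)) {π : M}
    (hκ : ∀ g : M ≃ₐ[K] M, kummerChar p K π g ^ e = 1) {i : ZMod f} {x : resTensor p M F}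
    (hx : IsEigenvector p K M τ₀ χ a e π i x) :
    x ∈ eigenSubmodule K (tau p K τ₀ (i + (shift p a i : ZMod f) + 1))
      (fun g => χ' g * (tau p K τ₀ (0 : ZMod f) (kummerChar p K π g) ^ tameExp p e a 0)⁻¹) := by
  refine ⟨fun c => ?_, fun σ => ?_⟩
  · rw [← one_tmul_mul_eq]
    exact hx.1 c
  · obtain ⟨g, rfl⟩ := AlgEquiv.restrictNormalHom_surjective (F := K) (K₁ := M) C σ
    have h1 := hx.2 g
    rw [mu, tau'_pow_nPrime hcard hf τ₀ h0 he ha (hκ _), hχ] at h1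
    exact h1

end Eigenvectors

/-! ### The exponential terms lie in the required span. -/

section Main

variable {p : ℕ} [Fact p.Prime] {K : Type*} [Field K] [Algebra ℚ_[p] K] [FiniteDimensional ℚ_[p] K]
  {C : Type*} [Field C] [Algebra ℚ_[p] C] [Algebra.IsAlgebraic ℚ_[p] C] [IsAlgClosed C]
  [Algebra K C] [IsScalarTower ℚ_[p] K C] [Normal K C]
  {M : Type*} [Field M] [Algebra ℚ_[p] M] [FiniteDimensional ℚ_[p] M] [Algebra K M]
  [IsScalarTower ℚ_[p] K M] [Algebra M C] [IsScalarTower K M C] [IsGalois K M]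
variable {F : Type*} [Field F] [CharP F p]

theorem eq_mul_of_mulTensor_mem {τ : resField p K →+* F} {ν : (M ≃ₐ[K] M) → F} [IsAlgClosed F]
    {B : resField p M} (hB : B ≠ 0) {x y : resTensor p M F} (hx0 : x ≠ 0) (hy0 : y ≠ 0)
    (hx : x ∈ eigenSubmodule K τ ν) (hy : mulTensor F B y ∈ eigenSubmodule K τ ν) :
    ∃ c : F, c ≠ 0 ∧ mulTensor F B y = c • x := by
  obtain ⟨c, hc⟩ := exists_eq_smul_of_mem_eigenSubmodule hx hx0 hy
  refine ⟨c, ?_, hc⟩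
  rintro rfl
  apply hy0
  have h1 : mulTensor F B⁻¹ (mulTensor F B y) = y := by
    rw [tensorMap_tensorMap]
    exact tensorMap_eq_self (fun a => inv_mul_cancel_left₀ hB a) y
  rw [← h1, hc, zero_smul, map_zero]

omit [Normal K C] in
/-- The exponential terms by which `u_i` changes with the uniformizer lie in the span of the
`u_j` for dependent pairs and of the cyclotomic unit. -/
theorem expLin_iterate_frobTensor_mem_span [IsAlgClosed F] (hK : IsUniformizer p (p : K)) {f : ℕ}
    (hcard : Nat.card (resField p K) = p ^ f) (hf : 0 < f) (τ₀ : resField p K →+* F)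
    {χ : (C ≃ₐ[K] C) →* Fˣ} {χ' : (M ≃ₐ[K] M) → F}
    (hχ : ∀ g, (χ g : F) = χ' (AlgEquiv.restrictNormal g M)) {a : ZMod f → ℕ}
    (ha : ∀ i, 1 ≤ a i) (hne : ∃ i, a i ≠ p) {e : ℕ} (he : 0 < e)
    (hedvd : e ∣ Nat.card (resField p K) - 1) (h0 : p ^ f - 1 ∣ e * digitSum p a 0)
    {ϖ : integers p M} (hπ : IsUniformizer p (ϖ : M))
    (hπp : absv p M (p : M) = absv p M (ϖ : M) ^ e) (hπe : ∃ c : K, algebraMap K M c = (ϖ : M) ^ e)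
    {lam : ZMod f → resTensor p M F} (hlam0 : ∀ i, lam i ≠ 0)
    (hlam : ∀ i, lam i ∈ eigenSubmodule K (tau p K τ₀ (i + (shift p a i : ZMod f) + 1))
      (fun g => χ' g * (tau p K τ₀ (0 : ZMod f) (kummerChar p K (ϖ : M) g) ^ tameExp p e a 0)⁻¹))
    {δ : M} {b : resField p M}
    (hcyc : IsCyclotomic p χ → δ ^ (p - 1) = -(p : M) ∧ Algebra.trace (ZMod p) (resField p M) b ≠ 0)
    {i : ZMod f} {x : resTensor p M F}
    (hx : x ∈ eigenSubmodule K (tau p K τ₀ (i + (shift p a i : ZMod f) + 1))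
      (fun g => χ' g * (tau p K τ₀ (0 : ZMod f) (kummerChar p K (ϖ : M) g) ^ tameExp p e a 0)⁻¹))
    (k : ℕ) :
    expLin F ((ϖ ^ nPrime p e a i) ^ p ^ k) ((frobTensor p M F)^[k] x) ∈
      Submodule.span F
        ({u | ∃ j, DependentPair p a i j ∧ u = basisUnit p M a e (ϖ : M) j (lam j)} ∪
          {u | IsCyclotomic p χ ∧ u = cycUnit p M F δ b}) := by
  have hp : p.Prime := Fact.out
  set ν : (M ≃ₐ[K] M) → F :=
    fun g => χ' g * (tau p K τ₀ (0 : ZMod f) (kummerChar p K (ϖ : M) g) ^ tameExp p e a 0)⁻¹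
    with hν
  have R := tameRelations hK hcard hf τ₀ ν hπ rfl hπp hπe
  have hxk := iterate_frobTensor_mem_eigenSubmodule hcard hf hx k
  rw [← pow_mul]
  by_cases hi : a (i + 1) = p
  -- The second member j of a dependent pair has a_{j+1} ≠ p, so n_j' = m_{j+1}, and y is a multiple
  -- of λ_j.
  · refine exp_nPrime_mem R hf he h0 ha hne hi (fun j hj hjp y hy => ?_) k _ hxk
    obtain ⟨hs, hn⟩ := nPrime_of_ne (e := e) hjp
    have hl := hlam j
    rw [hs, Nat.cast_zero, add_zero] at hl
    obtain ⟨c, rfl⟩ := exists_eq_smul_of_mem_eigenSubmodule hl (hlam0 j) hy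
    rw [map_smul]
    refine Submodule.smul_mem _ _ (Submodule.subset_span (Or.inl ⟨j, hj, ?_⟩))
    rw [basisUnit, hn, ← SubmonoidClass.coe_pow,
      eps_eq_epsLin (absv_pow_lt_one hπ.2.1 (tameExp_pos hf h0 he ha _).ne')]
  · obtain ⟨hs, hn⟩ := nPrime_of_ne (e := e) hi
    rw [hs, Nat.cast_zero, add_zero] at hx
    rw [hn]
    by_cases h1 : ∃ j, a j ≠ 1
    · rw [exp_eq_zero_of_lt R hf he h0 ha h1 (i + 1) (pow_pos hp.pos k), LinearMap.zero_apply]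
      exact zero_mem _
    -- All digits are 1, so the exponent is exactly e/(p-1): the term k = 0 is on the boundary, the
    -- others are beyond it.
    · push Not at h1
      have hme := mul_tameExp_of_forall_eq_one hf h0 h1 (i + 1)
      have hm := tameExp_pos hf h0 he ha (i + 1)
      have hϖ0 : ϖ ≠ 0 := fun h => hπ.1 (by rw [h]; rfl)
      obtain ⟨v, d, hv, hvd⟩ := exists_prime_eq_pow_mul hK hπ hπp hπe
      have hvd' : (p : integers p M) = ϖ ^ e * (teich p M (resIncl p K M v) + p * d) :=
        Subtype.ext (by simpa using hvd)
      cases k with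
      | zero =>
        rw [pow_zero, mul_one, Function.iterate_zero_apply]
        have hκ := kummerChar_spec p hπ.1 hedvd hπe
        refine Submodule.span_mono Set.subset_union_right ?_
        refine expLin_mem_of_mem_eigenSubmodule hv hϖ0 hπ.2.1 hvd' hm hme (fun g => (hκ g).2.1)
          (fun g => (hκ g).1) (τ := tau p K τ₀ (i + 1)) hχ hcyc ?_
        convert hx using 4 with g
        exact congrArg (·⁻¹) (tau_pow_tameExp hcard hf τ₀ h0 (hκ g).2.2 (i + 1))
      | succ k =>
        rw [expLin_eq_zero_of_lt ((map_ne_zero (resIncl p K M)).2 hv) hϖ0 hπ.2.1 hvd' hm hme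
          (lt_mul_of_one_lt_right hm (Nat.one_lt_pow k.succ_ne_zero hp.one_lt)),
          LinearMap.zero_apply]
        exact zero_mem _

end Main

end TameUnits

end

theorem proposition5p2
    (p : ℕ) [Fact p.Prime]
    (K : Type*) [Field K] [Algebra ℚ_[p] K] [FiniteDimensional ℚ_[p] K]
    (hK : TameUnits.IsUnramified p ℚ_[p] K)
    (f : ℕ) (hf : Module.finrank ℚ_[p] K = f)
    (Kbar : Type*) [Field Kbar] [Algebra ℚ_[p] Kbar] [Algebra K Kbar]
    [IsScalarTower ℚ_[p] K Kbar] [IsAlgClosure K Kbar]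
    (F : Type*) [Field F] [Algebra (ZMod p) F] [IsAlgClosure (ZMod p) F]
    (τ₀ : TameUnits.resField p K →+* F)
    (χ : (Kbar ≃ₐ[K] Kbar) →* Fˣ)
    (a : ZMod f → ℕ) (ha : TameUnits.IsTameSignature p K Kbar τ₀ χ a)
    (M : Type*) [Field M] [Algebra ℚ_[p] M] [FiniteDimensional ℚ_[p] M] [Algebra K M]
    [IsScalarTower ℚ_[p] K M] [Algebra M Kbar] [IsScalarTower K M Kbar] [IsAbelianGalois K M]
    (hχM : ∀ g : Kbar ≃ₐ[K] Kbar,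
      (∀ x : M, g (algebraMap M Kbar x) = algebraMap M Kbar x) → χ g = 1)
    (L : IntermediateField K M) (hL : TameUnits.IsUnramified p K L)
    (hLp : (Module.finrank K L).Coprime p)
    (e : ℕ) (he : TameUnits.IsRamificationIndex p K M e) (hef : e ∣ p ^ f - 1)
    (π : M) (hπ : TameUnits.IsUniformizer p π) (hπe : ∃ c : K, algebraMap K M c = π ^ e)
    (hM : IntermediateField.adjoin L {π} = ⊤)
    (π' : M) (hπ' : TameUnits.IsUniformizer p π') (hπe' : ∃ c : K, algebraMap K M c = π' ^ e)
    (lam : ZMod f → TameUnits.resTensor p M F)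
    (hlam : ∀ i, lam i ≠ 0 ∧ TameUnits.IsEigenvector p K M τ₀ χ a e π i (lam i))
    (lam' : ZMod f → TameUnits.resTensor p M F)
    (hlam' : ∀ i, lam' i ≠ 0 ∧ TameUnits.IsEigenvector p K M τ₀ χ a e π' i (lam' i))
    (δ : M) (b : TameUnits.resField p M)
    (hcyc : TameUnits.IsCyclotomic p χ →
      δ ^ (p - 1) = -(p : M) ∧ Algebra.trace (ZMod p) (TameUnits.resField p M) b ≠ 0)
    (i : ZMod f) :
    ∃ c : F, c ≠ 0 ∧
      TameUnits.basisUnit p M a e π' i (lam' i) - c • TameUnits.basisUnit p M a e π i (lam i) ∈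
        Submodule.span F
          ({u | ∃ j, TameUnits.DependentPair p a i j ∧
              u = TameUnits.basisUnit p M a e π j (lam j)} ∪
            {u | TameUnits.IsCyclotomic p χ ∧ u = TameUnits.cycUnit p M F δ b}) := by
  obtain ⟨ϖ, rfl⟩ : ∃ ϖ : TameUnits.integers p M, (ϖ : M) = π := ⟨⟨π, hπ.2.1.le⟩, rfl⟩
  have hC : IsAlgClosed Kbar := IsAlgClosure.isAlgClosed K
  have halgK : Algebra.IsAlgebraic K Kbar := IsAlgClosure.isAlgebraic
  have halg : Algebra.IsAlgebraic ℚ_[p] Kbar := Algebra.IsAlgebraic.trans ℚ_[p] K Kbar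
  have hF : IsAlgClosed F := IsAlgClosure.isAlgClosed (ZMod p)
  have hFp : CharP F p := charP_of_injective_algebraMap (algebraMap (ZMod p) F).injective p
  have hnorm : Normal K Kbar := IsAlgClosure.normal K Kbar
  have hKp := TameUnits.isUniformizer_prime_of_isUnramified hK
  have hcard : Nat.card (TameUnits.resField p K) = p ^ f := hf ▸ TameUnits.card_resField hKp
  have hf0 : 0 < f := hf ▸ Module.finrank_pos
  obtain ⟨ha1, hane, hχI⟩ := ha
  have hedvd : e ∣ Nat.card (TameUnits.resField p K) - 1 := hcard ▸ hef
  have hπp : TameUnits.absv p M (p : M) = TameUnits.absv p M (ϖ : M) ^ e := by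
    obtain ⟨x, y, hx, hy, hxy⟩ := he
    rw [TameUnits.absv_eq_of_isUniformizer hπ hy, ← hxy, TameUnits.absv_natCast_prime,
      ← TameUnits.absv_natCast_prime p (E := K), TameUnits.absv_eq_of_isUniformizer hKp hx]
    exact (TameUnits.absv_map p (IsScalarTower.toAlgHom ℚ_[p] K M) x).symm
  have he0 : 0 < e := by
    rw [Nat.pos_iff_ne_zero]
    rintro rfl
    rw [pow_zero] at hπp
    exact (TameUnits.absv_natCast_prime_lt_one p M).ne hπp
  have h0 : p ^ f - 1 ∣ e * TameUnits.digitSum p a 0 := by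
    rw [← hcard] at hχI ⊢
    exact TameUnits.dvd_mul_of_forall_inertial hKp L hL hedvd hπ.1 hπe hM τ₀ χ hχM hχI
  obtain ⟨χ', hχ'⟩ := TameUnits.exists_eq_restrictNormal hχM
  have hκ := TameUnits.kummerChar_spec p hπ.1 hedvd hπe
  have hκ' := TameUnits.kummerChar_spec p hπ'.1 hedvd hπe'
  have hlE := fun j => (hlam j).2.mem_eigenSubmodule hcard hf0 h0 he0 (fun i => (ha1 i).1) hχ'
    (fun g => (hκ g).2.2)
  have hlE' := fun j => (hlam' j).2.mem_eigenSubmodule hcard hf0 h0 he0 (fun i => (ha1 i).1) hχ'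
    (fun g => (hκ' g).2.2)
  obtain ⟨β, y, hβ, hy, hπy, -⟩ := TameUnits.exists_uniformizer_eq hKp
    (IsScalarTower.toAlgHom ℚ_[p] K M) hedvd hπ hπe hπ' hπe'
  have hy0 : (y : K) ≠ 0 := by
    intro h
    rw [h, map_zero, mul_zero] at hπy
    exact hπ'.1 hπy
  obtain ⟨n, hn⟩ : ∃ n, n = TameUnits.nPrime p e a i := ⟨_, rfl⟩
  have hn0 : n ≠ 0 := hn ▸ (TameUnits.nPrime_pos hf0 h0 he0 (fun i => (ha1 i).1) i).ne'
  have hϖ : TameUnits.absv p M (ϖ ^ n : TameUnits.integers p M) < 1 :=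
    TameUnits.absv_pow_lt_one hπ.2.1 hn0
  have hyn : (p : TameUnits.integers p K) ∣ y ^ n - 1 := by
    have := sub_dvd_pow_sub_pow y 1 n
    rw [one_pow] at this
    exact hy.trans this
  have hpow : π' ^ n = (TameUnits.teich p M (β ^ n) *
      (ϖ ^ n * TameUnits.intMap p (IsScalarTower.toAlgHom ℚ_[p] K M) (y ^ n)) :
        TameUnits.integers p M) := by
    rw [hπy, TameUnits.teich_pow, map_pow, ← mul_pow, ← mul_pow, SubmonoidClass.coe_pow, mul_assoc]
    rfl
  have hzn : TameUnits.absv p M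
      (ϖ ^ n * TameUnits.intMap p (IsScalarTower.toAlgHom ℚ_[p] K M) (y ^ n) :
        TameUnits.integers p M) < 1 :=
    TameUnits.absv_lt_one_of_dvd hϖ (dvd_mul_right _ _)
  have hmem := TameUnits.mulTensor_mem_eigenSubmodule (b := β ^ n)
    (κ := fun g => (TameUnits.kummerChar p K π' g / TameUnits.kummerChar p K (ϖ : M) g) ^ n)
    (ν := fun g => χ' g * (TameUnits.tau p K τ₀ (0 : ZMod f) (TameUnits.kummerChar p K (ϖ : M) g) ^
      TameUnits.tameExp p e a 0)⁻¹)
    (fun g => by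
      rw [map_pow, map_pow, ← mul_pow, TameUnits.resAut_eq_of_eq_mul hπ.1 hy0 hπy (hκ g).1
        (hκ g).2.1 (hκ' g).2.1])
    -- Both eigencharacters are χ' divided by the i-independent power of the Kummer character, so
    -- their quotient is the n-th power of the ratio of the two Kummer characters under τ_i'.
    (fun g => by
      have h1 := TameUnits.tau'_pow_nPrime hcard hf0 τ₀ h0 he0 (fun i => (ha1 i).1) (hκ g).2.2 i
      have h2 := TameUnits.tau'_pow_nPrime hcard hf0 τ₀ h0 he0 (fun i => (ha1 i).1) (hκ' g).2.2 i
      have h3 : TameUnits.tau p K τ₀ (0 : ZMod f) (TameUnits.kummerChar p K π' g) ^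
          TameUnits.tameExp p e a 0 ≠ 0 := pow_ne_zero _ ((map_ne_zero _).2 (hκ' g).1)
      rw [map_pow, map_div₀, div_pow]
      change _ = TameUnits.tau' p K τ₀ a i _ ^ n / TameUnits.tau' p K τ₀ a i _ ^ n * _
      rw [hn, h1, h2, div_mul_eq_mul_div, mul_left_comm, mul_inv_cancel₀ h3, mul_one, div_eq_mul_inv])
    (hlE' i)
  obtain ⟨c, hc0, hc⟩ := TameUnits.eq_mul_of_mulTensor_mem (pow_ne_zero n hβ) (hlam i).1
    (hlam' i).1 (hlE i) hmem
  refine ⟨c, hc0, ?_⟩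
  have hu : TameUnits.basisUnit p M a e (ϖ : M) i (lam i) = TameUnits.epsLin F (ϖ ^ n) (lam i) := by
    rw [TameUnits.basisUnit, ← hn, ← SubmonoidClass.coe_pow, TameUnits.eps_eq_epsLin hϖ]
  have hu' : TameUnits.basisUnit p M a e π' i (lam' i) =
      TameUnits.epsLin F (ϖ ^ n * TameUnits.intMap p (IsScalarTower.toAlgHom ℚ_[p] K M) (y ^ n))
        (TameUnits.mulTensor F (β ^ n) (lam' i)) := by
    rw [TameUnits.basisUnit, ← hn, hpow,
      TameUnits.eps_eq_epsLin (TameUnits.absv_mul_lt_one_right _ hzn), TameUnits.epsLin_teich_mul hzn]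
  rw [hu, hu', ← map_smul, ← hc]
  subst hn
  -- Both units are now values at the same vector β^n λ_i' = c λ_i, and their arguments differ by
  -- the principal unit y^n of K.
  exact TameUnits.epsLin_mul_intMap_sub_mem hKp hcard hf0 hmem hyn hϖ fun k =>
    TameUnits.expLin_iterate_frobTensor_mem_span (ϖ := ϖ) hKp hcard hf0 τ₀ hχ'
      (fun i => (ha1 i).1) hane he0 hedvd h0 hπ hπp hπe (fun i => (hlam i).1) hlE hcyc hmem k
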